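/- For $a\in[-1,0)$ and $x=(x_1,x_2)\in\mathbb R^2$ let $\mathbf A_0(x)=(-x_2,0)$, $\sigma(x)=1$ if $x_2>0$ and $\sigma(x)=a$ if $x_2<0$. Let $\mathcal L_a=-(\nabla-i\sigma\mathbf A_0)^2$ be the self-adjoint magnetic Hamiltonian in $L^2(\mathbb R^2)$ and $\beta_a=\inf\mathrm{sp}(\mathcal L_a)$. For $R>0$ let $S_R=(-R/2,R/2)\times\mathbb R$, $$\mathcal D_R=\Big\{u\in L^2(S_R):\ (\nabla-i\sigma\mathbf A_0)u\in L^2(S_R),\ u\big(x_1=\pm\tfrac R2,\cdot\big)=0\Big\}$$ (weak derivatives, boundary values in the sense of $H^1_0$), and for $b>0$ and $u\in\mathcal D_R$ $$\mathcal G_{a,b,R}(u)=\int_{S_R}\Big(b\,|(\nabla-i\sigma\mathbf A_0)u|^2-|u|^2+\tfrac12|u|^4\Big)\,dx,\qquad \mathfrak g_a(b,R)=\inf_{u\in\mathcal D_R}\mathcal G_{a,b,R}(u).$$ There exists a universal constant $C>0$ (independent of $a$, $b$ and $R$) such that, for all $a\in[-1,0)$, all $b$ with $\frac1{|a|}\le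 b<\frac1{\beta_a}$ and all $R>0$, the functional $\mathcal G_{a,b,R}$ has a minimizer: there is $\varphi\in\mathcal D_R$ with $$\mathcal G_{a,b,R}(\varphi)=\mathfrak g_a(b,R)\quad\text{and}\quad\|\varphi\|_{L^\infty(S_R)}\le 1,$$ which moreover satisfies $$\int_{S_R\cap\{|x_2|\ge4\}}\frac{|x_2|}{(\ln|x_2|)^2}\Big(|(\nabla-i\sigma\mathbf A_0)\varphi|^2+|\varphi|^2\Big)\,dx\le CbR,$$ $$\int_{S_R\cap\{|x_2|\ge4\}}\frac{|x_2|^3}{(\ln|x_2|)^2}|\varphi|^4\,dx\le Cb^2R,$$ $$\int_{S_R}\Big(b\,|(\nabla-i\sigma\mathbf A_0)\varphi|^2+|\varphi|^2\Big)\,dx\le CbR.$$ -/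

import Mathlib

open MeasureTheory Set Filter Topology
open scoped ContDiff ENNReal

noncomputable section

namespace MagneticStep

/-- The step function `σ`, equal to `1` on the upper half plane and to `a` on the lower one
(its value on the null set `x₂ = 0` is irrelevant). -/
def sigma (a : ℝ) (x : ℝ × ℝ) : ℝ := if 0 < x.2 then 1 else a

/-- The magnetic potential `A₀(x) = (-x₂, 0)`. -/
def A0 (x : ℝ × ℝ) : Fin 2 → ℝ := ![-x.2, 0]

/-- The standard basis of `ℝ²`. -/
def e : Fin 2 → ℝ × ℝ := ![(1, 0), (0, 1)]

/-- The strip `S_R = (-R/2, R/2) × ℝ`. -/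
def strip (R : ℝ) : Set (ℝ × ℝ) := Ioo (-R / 2) (R / 2) ×ˢ univ

/-- `ψ ∈ C_c^∞(U; F)`. -/
structure IsTest {F : Type*} [NormedAddCommGroup F] [NormedSpace ℝ F]
    (U : Set (ℝ × ℝ)) (ψ : ℝ × ℝ → F) : Prop where
  smooth : ContDiff ℝ ∞ ψ
  compact : HasCompactSupport ψ
  supp : tsupport ψ ⊆ U

/-- `w` is the weak partial derivative `∂_j u` in the open set `U`. -/
structure HasWeakPartial (U : Set (ℝ × ℝ)) (j : Fin 2) (u w : ℝ × ℝ → ℂ) : Prop where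
  locInt : LocallyIntegrableOn u U
  locInt_deriv : LocallyIntegrableOn w U
  byParts : ∀ ψ : ℝ × ℝ → ℝ, IsTest U ψ →
    ∫ x in U, (fderiv ℝ ψ x (e j) : ℂ) * u x = -∫ x in U, (ψ x : ℂ) * w x

open Classical in
/-- The weak partial derivative `∂_j u` in `U` (unique up to null sets); `0` if there is none. -/
def weakPartial (U : Set (ℝ × ℝ)) (j : Fin 2) (u : ℝ × ℝ → ℂ) : ℝ × ℝ → ℂ :=
  if h : ∃ w, HasWeakPartial U j u w then h.choose else 0

/-- The `j`-th component of `(∇ - iσA₀)u` in `U`, in the weak sense. -/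
def covDeriv (a : ℝ) (U : Set (ℝ × ℝ)) (j : Fin 2) (u : ℝ × ℝ → ℂ) (x : ℝ × ℝ) : ℂ :=
  weakPartial U j u x - Complex.I * (sigma a x * A0 x j : ℝ) * u x

/-- The `j`-th component of `(∇ - iσA₀)ψ` for a smooth function `ψ`. -/
def covDerivSmooth (a : ℝ) (j : Fin 2) (ψ : ℝ × ℝ → ℂ) (x : ℝ × ℝ) : ℂ :=
  fderiv ℝ ψ x (e j) - Complex.I * (sigma a x * A0 x j : ℝ) * ψ x

/-- `|(∇ - iσA₀)u|²`. -/
def covGradSq (a : ℝ) (U : Set (ℝ × ℝ)) (u : ℝ × ℝ → ℂ) (x : ℝ × ℝ) : ℝ :=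
  ∑ j, ‖covDeriv a U j u x‖ ^ 2

/-- `u ∈ L²(U)` and `(∇ - iσA₀)u ∈ L²(U)`. -/
structure MemMagSobolev (a : ℝ) (U : Set (ℝ × ℝ)) (u : ℝ × ℝ → ℂ) : Prop where
  memLp : MemLp u 2 (volume.restrict U)
  weakDiff : ∀ j, ∃ w, HasWeakPartial U j u w
  memLp_covDeriv : ∀ j, MemLp (covDeriv a U j u) 2 (volume.restrict U)

/-- `u` vanishes on `∂U` in the Sobolev (`H¹₀`) sense: it is a limit of functions of
`C_c^∞(U)` in the norm `(‖u‖²_{L²} + ‖(∇ - iσA₀)u‖²_{L²})^{1/2}`. -/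
def VanishesOnBoundary (a : ℝ) (U : Set (ℝ × ℝ)) (u : ℝ × ℝ → ℂ) : Prop :=
  ∃ ψ : ℕ → ℝ × ℝ → ℂ, (∀ n, IsTest U (ψ n)) ∧
    Tendsto (fun n => eLpNorm (fun x => ψ n x - u x) 2 (volume.restrict U)) atTop (𝓝 0) ∧
    ∀ j, Tendsto (fun n => eLpNorm (fun x => covDerivSmooth a j (ψ n) x - covDeriv a U j u x) 2
      (volume.restrict U)) atTop (𝓝 0)

/-- The space `𝓓_R`. Functions are considered on `S_R` only; their values elsewhere are
immaterial. -/
def domainD (a R : ℝ) : Set (ℝ × ℝ → ℂ) :=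
  {u | MemMagSobolev a (strip R) u ∧ VanishesOnBoundary a (strip R) u}

/-- The reduced Ginzburg–Landau functional `𝓖_{a,b,R}`. -/
def energyG (a b R : ℝ) (u : ℝ × ℝ → ℂ) : ℝ :=
  ∫ x in strip R, (b * covGradSq a (strip R) u x - ‖u x‖ ^ 2 + 1 / 2 * ‖u x‖ ^ 4)

/-- The ground state energy `𝔤_a(b, R)`. -/
def groundEnergy (a b R : ℝ) : ℝ := sInf (energyG a b R '' domainD a R)

/-- `L²(ℝ²; ℂ)`. -/
abbrev L2 : Type := Lp ℂ 2 (volume : Measure (ℝ × ℝ))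

/-- The graph of the self-adjoint magnetic Hamiltonian `𝓛_a = -(∇ - iσA₀)²` in `L²(ℝ²)`:
`u ∈ dom 𝓛_a` and `𝓛_a u = f`. It is the operator associated with the closed quadratic form
`∫ |(∇ - iσA₀)u|²` on `{u ∈ L² : (∇ - iσA₀)u ∈ L²}`, of which `C_c^∞(ℝ²)` is a core. -/
def HamiltonianGraph (a : ℝ) (u f : L2) : Prop :=
  MemMagSobolev a univ u ∧
    ∀ ψ : ℝ × ℝ → ℂ, IsTest univ ψ →
      ∑ j, ∫ x, covDeriv a univ j u x * star (covDerivSmooth a j ψ x) = ∫ x, f x * star (ψ x)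

/-- The resolvent set of `𝓛_a`: `𝓛_a - z` is a bijection from `dom 𝓛_a` onto `L²(ℝ²)` with
bounded inverse. -/
def resolventSetL (a : ℝ) : Set ℂ :=
  {z | (∀ g : L2, ∃! u : L2, HamiltonianGraph a u (g + z • u)) ∧
    ∃ C : ℝ, ∀ u f : L2, HamiltonianGraph a u f → ‖u‖ ≤ C * ‖f - z • u‖}

/-- `β_a = inf sp(𝓛_a)`, the spectrum being a subset of `ℝ`. -/
def beta (a : ℝ) : ℝ := sInf {t : ℝ | (t : ℂ) ∉ resolventSetL a}

end MagneticStep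

end

/-!
Since `𝓓_R` is unbounded, minimizing sequences could lose mass as `|x₂| → ∞`. We therefore take
near-minimizers `ψ` among the smooth functions supported in the boxes `S_R ∩ {|x₂| ≤ m}`, truncated
at modulus one, which does not raise the energy, and bound them uniformly in `m`.

Varying `ψ` in the direction `χ(x₂)² ψ`, for a weight `χ` vanishing near `x₂ = 0`, gives up to an
arbitrarily small error
`∫ (b |(∇ - iσA₀)(χψ)|² - |χψ|² + χ² |ψ|⁴) ≤ b ∫ χ'² |ψ|²`.
On each of the two half planes the magnetic field is constant, equal to `1` or `a`, and the
commutator of the covariant derivatives yields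
`∫ |(∇ - iσA₀)(χψ)|² ≥ min(1, |a|) ∫ |χψ|²`. As `b` and `b |a|` are at least `1`, the first two
terms on the left have a nonnegative sum, and `∫ χ² |ψ|⁴` is controlled by `b ∫ χ'² |ψ|²`. With
`χ = |x₂|^{3/2} / ln |x₂|`, Young's inequality absorbs the right-hand side into the quartic term
up to `b² ∫ (χ'²/χ)²`, which is finite exactly because of the logarithm. This controls the quartic
term, and a second weight `|x₂|^{1/2} / ln |x₂|` then controls the other two.

The weighted bounds prevent the loss of mass, so that near-minimizers converge in `L²` along a
subsequence. By the parallelogram identity they even converge in the graph norm, and by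
Ladyzhenskaya's inequality in `L⁴`; hence their limit is a minimizer, and it inherits the bounds.
-/

noncomputable section

namespace MagneticStep

variable {U : Set (ℝ × ℝ)} {ψ : ℝ × ℝ → ℂ}

/-- The function `κ(t)` with `κ(x₂) = σ(x) x₂`, so that `σA₀ = (-κ(x₂), 0)`; unlike `σ` it is
continuous. -/
def stepPotential (a t : ℝ) : ℝ := max t 0 + a * min t 0

theorem continuous_stepPotential (a : ℝ) : Continuous (stepPotential a) := by
  unfold stepPotential; fun_prop

theorem stepPotential_of_nonneg (a : ℝ) {t : ℝ} (ht : 0 ≤ t) : stepPotential a t = t := by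
  simp [stepPotential, ht]

theorem stepPotential_of_nonpos (a : ℝ) {t : ℝ} (ht : t ≤ 0) : stepPotential a t = a * t := by
  simp [stepPotential, ht]

theorem abs_stepPotential_le (a t : ℝ) : |stepPotential a t| ≤ max 1 |a| * |t| := by
  rcases le_total 0 t with ht | ht
  · rw [stepPotential_of_nonneg a ht]
    exact le_mul_of_one_le_left (abs_nonneg t) (le_max_left _ _)
  · rw [stepPotential_of_nonpos a ht, abs_mul]
    exact mul_le_mul_of_nonneg_right (le_max_right _ _) (abs_nonneg t)

theorem sigma_mul_A0_zero (a : ℝ) (x : ℝ × ℝ) : sigma a x * A0 x 0 = -stepPotential a x.2 := by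
  simp only [A0, sigma, Matrix.cons_val_zero]
  split_ifs with h
  · rw [stepPotential_of_nonneg a h.le, one_mul]
  · rw [stepPotential_of_nonpos a (not_lt.1 h), mul_neg]

theorem sigma_mul_A0_one (a : ℝ) (x : ℝ × ℝ) : sigma a x * A0 x 1 = 0 := by
  simp [A0]

theorem continuous_sigma_mul_A0 (a : ℝ) (j : Fin 2) :
    Continuous fun x : ℝ × ℝ => sigma a x * A0 x j := by
  fin_cases j
  · simp only [Fin.zero_eta, sigma_mul_A0_zero]
    exact ((continuous_stepPotential a).comp continuous_snd).neg
  · simpa only [Fin.mk_one, sigma_mul_A0_one] using continuous_const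

theorem covDerivSmooth_zero (a : ℝ) (ψ : ℝ × ℝ → ℂ) (x : ℝ × ℝ) :
    covDerivSmooth a 0 ψ x
      = fderiv ℝ ψ x (1, 0) + Complex.I * (stepPotential a x.2 : ℝ) * ψ x := by
  simp [covDerivSmooth, sigma_mul_A0_zero, e]

theorem covDerivSmooth_one (a : ℝ) (ψ : ℝ × ℝ → ℂ) (x : ℝ × ℝ) :
    covDerivSmooth a 1 ψ x = fderiv ℝ ψ x (0, 1) := by
  simp [covDerivSmooth, sigma_mul_A0_one, e]

/-- `|(∇ - iσA₀)ψ|²` for a smooth function `ψ`. -/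
def covGradSqSmooth (a : ℝ) (ψ : ℝ × ℝ → ℂ) (x : ℝ × ℝ) : ℝ :=
  ∑ j, ‖covDerivSmooth a j ψ x‖ ^ 2

theorem covGradSqSmooth_eq (a : ℝ) (ψ : ℝ × ℝ → ℂ) (x : ℝ × ℝ) :
    covGradSqSmooth a ψ x = ‖covDerivSmooth a 0 ψ x‖ ^ 2 + ‖covDerivSmooth a 1 ψ x‖ ^ 2 :=
  Fin.sum_univ_two _

theorem covGradSqSmooth_nonneg (a : ℝ) (ψ : ℝ × ℝ → ℂ) (x : ℝ × ℝ) :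
    0 ≤ covGradSqSmooth a ψ x :=
  Finset.sum_nonneg fun _ _ => by positivity

theorem covDerivSmooth_eq_zero_of_notMem_tsupport (a : ℝ) (j : Fin 2) {x : ℝ × ℝ}
    (hx : x ∉ tsupport ψ) : covDerivSmooth a j ψ x = 0 := by
  simp [covDerivSmooth, fderiv_of_notMem_tsupport ℝ hx, image_eq_zero_of_notMem_tsupport hx]

theorem covGradSqSmooth_eq_zero_of_notMem_tsupport (a : ℝ) {x : ℝ × ℝ} (hx : x ∉ tsupport ψ) :
    covGradSqSmooth a ψ x = 0 := by
  simp [covGradSqSmooth, covDerivSmooth_eq_zero_of_notMem_tsupport a _ hx]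

/-! ### Calculus of test functions -/

namespace IsTest

section Vector

variable {F G : Type*} [NormedAddCommGroup F] [NormedSpace ℝ F] [NormedAddCommGroup G]
  {f g : ℝ × ℝ → F}

theorem continuous (hf : IsTest U f) : Continuous f := hf.smooth.continuous

theorem differentiable (hf : IsTest U f) : Differentiable ℝ f :=
  hf.smooth.differentiable (by simp)

theorem contDiff_fderiv_apply (hf : IsTest U f) (v : ℝ × ℝ) :
    ContDiff ℝ ∞ fun x => fderiv ℝ f x v :=
  (hf.smooth.fderiv_right (m := ∞) (by simp)).clm_apply contDiff_const

theorem continuous_fderiv_apply (hf : IsTest U f) (v : ℝ × ℝ) :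
    Continuous fun x => fderiv ℝ f x v := (hf.contDiff_fderiv_apply v).continuous

theorem integrable (hf : IsTest U f) {h : ℝ × ℝ → G} (hh : Continuous h)
    (h0 : ∀ x, x ∉ tsupport f → h x = 0) : Integrable h :=
  hh.integrable_of_hasCompactSupport (HasCompactSupport.intro hf.compact h0)

theorem of_tsupport_subset [NormedSpace ℝ G] {h : ℝ × ℝ → G} (hf : IsTest U f) (hh : ContDiff ℝ ∞ h)
    (hs : tsupport h ⊆ tsupport f) : IsTest U h where
  smooth := hh
  compact := hf.compact.mono' ((subset_tsupport _).trans hs)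
  supp := hs.trans hf.supp

theorem comp_left [NormedSpace ℝ G] (hf : IsTest U f) {Φ : F → G} (hΦ : ContDiff ℝ ∞ Φ)
    (hΦ0 : Φ 0 = 0) : IsTest U fun x => Φ (f x) :=
  hf.of_tsupport_subset (hΦ.comp hf.smooth) (tsupport_comp_subset hΦ0 f)

theorem zero (U : Set (ℝ × ℝ)) : IsTest U fun _ => (0 : F) where
  smooth := contDiff_const
  compact := HasCompactSupport.zero
  supp := by simp [tsupport]

theorem add (hf : IsTest U f) (hg : IsTest U g) : IsTest U fun x => f x + g x where
  smooth := hf.smooth.add hg.smooth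
  compact := hf.compact.add hg.compact
  supp := (tsupport_add f g).trans (union_subset hf.supp hg.supp)

end Vector

section Integral

variable {H : Type*} [NormedAddCommGroup H] [InnerProductSpace ℝ H] {f g : ℝ × ℝ → H}

theorem integral_inner_fderiv (hf : IsTest U f) (hg : ContDiff ℝ 1 g) (v : ℝ × ℝ) :
    ∫ x, inner ℝ (f x) (fderiv ℝ g x v) = -∫ x, inner ℝ (fderiv ℝ f x v) (g x) := by
  have hg' : Continuous fun x => fderiv ℝ g x v :=
    (hg.continuous_fderiv one_ne_zero).clm_apply continuous_const
  refine integral_bilinear_fderiv_right_eq_neg_left_of_integrable (B := innerSL ℝ)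
    (hf.integrable ((hf.continuous_fderiv_apply v).inner hg.continuous) fun x hx => ?_)
    (hf.integrable (hf.continuous.inner hg') fun x hx => ?_)
    (hf.integrable (hf.continuous.inner hg.continuous) fun x hx => ?_)
    (fun x _ => hf.differentiable x) (fun x _ => hg.differentiable one_ne_zero x)
  · simp [fderiv_of_notMem_tsupport ℝ hx]
  all_goals simp [image_eq_zero_of_notMem_tsupport hx]

theorem integral_snd_mul_fderiv {f : ℝ × ℝ → ℝ} (hf : IsTest U f) :
    ∫ x : ℝ × ℝ, x.2 * fderiv ℝ f x (0, 1) = -∫ x, f x := by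
  have h := hf.integral_inner_fderiv (contDiff_snd (𝕜 := ℝ)) (0, 1)
  simp only [RCLike.inner_apply, conj_trivial, fderiv_snd, ContinuousLinearMap.coe_snd',
    one_mul] at h
  rw [h, neg_neg]

end Integral

theorem normSq (h : IsTest U ψ) : IsTest U fun x => ‖ψ x‖ ^ 2 :=
  h.comp_left (contDiff_norm_sq ℝ) (by simp)

theorem fderiv_normSq (h : IsTest U ψ) (x v : ℝ × ℝ) :
    fderiv ℝ (fun x => ‖ψ x‖ ^ 2) x v = 2 * inner ℝ (ψ x) (fderiv ℝ ψ x v) := by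
  rw [(h.differentiable x).hasFDerivAt.norm_sq.fderiv]
  simp only [smul_apply, ContinuousLinearMap.comp_apply, innerSL_apply_apply,
    nsmul_eq_mul, Nat.cast_ofNat]

theorem continuous_inner_fderiv (h : IsTest U ψ) (v : ℝ × ℝ) :
    Continuous fun x => inner ℝ (ψ x) (fderiv ℝ ψ x v) :=
  h.continuous.inner (h.continuous_fderiv_apply v)

theorem continuous_covDerivSmooth (h : IsTest U ψ) (a : ℝ) (j : Fin 2) :
    Continuous (covDerivSmooth a j ψ) := by
  unfold covDerivSmooth
  have := continuous_sigma_mul_A0 a j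
  have := h.continuous
  have := h.continuous_fderiv_apply (e j)
  fun_prop

theorem continuous_covGradSqSmooth (h : IsTest U ψ) (a : ℝ) :
    Continuous (covGradSqSmooth a ψ) :=
  continuous_finsetSum _ fun j _ => (h.continuous_covDerivSmooth a j).norm.pow 2

theorem integrable_norm_pow (h : IsTest U ψ) {p : ℕ} (hp : p ≠ 0) :
    Integrable fun x => ‖ψ x‖ ^ p :=
  h.integrable (h.continuous.norm.pow p) fun x hx => by
    simp [image_eq_zero_of_notMem_tsupport hx, hp]

theorem integrable_normSq (h : IsTest U ψ) : Integrable fun x => ‖ψ x‖ ^ 2 :=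
  h.integrable_norm_pow two_ne_zero

theorem integrable_norm_pow_four (h : IsTest U ψ) : Integrable fun x => ‖ψ x‖ ^ 4 :=
  h.integrable_norm_pow four_ne_zero

theorem integrable_covGradSqSmooth (h : IsTest U ψ) (a : ℝ) : Integrable (covGradSqSmooth a ψ) :=
  h.integrable (h.continuous_covGradSqSmooth a) fun _ hx =>
    covGradSqSmooth_eq_zero_of_notMem_tsupport a hx

end IsTest

theorem inner_fderiv_sq_le (a : ℝ) (ψ : ℝ × ℝ → ℂ) (x : ℝ × ℝ) :
    inner ℝ (ψ x) (fderiv ℝ ψ x (0, 1)) ^ 2 ≤ ‖ψ x‖ ^ 2 * covGradSqSmooth a ψ x := by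
  rw [covGradSqSmooth_eq, covDerivSmooth_one]
  calc inner ℝ (ψ x) (fderiv ℝ ψ x (0, 1)) ^ 2
      = |inner ℝ (ψ x) (fderiv ℝ ψ x (0, 1))| ^ 2 := (sq_abs _).symm
    _ ≤ (‖ψ x‖ * ‖fderiv ℝ ψ x (0, 1)‖) ^ 2 := by gcongr; exact abs_real_inner_le_norm _ _
    _ = ‖ψ x‖ ^ 2 * ‖fderiv ℝ ψ x (0, 1)‖ ^ 2 := mul_pow _ _ _
    _ ≤ _ := by gcongr; exact le_add_of_nonneg_left (sq_nonneg _)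

/-- The product of `ψ` with a real function `χ(x₂)`. -/
def sndMul (χ : ℝ → ℝ) (ψ : ℝ × ℝ → ℂ) (x : ℝ × ℝ) : ℂ := (χ x.2 : ℂ) * ψ x

theorem norm_sndMul (χ : ℝ → ℝ) (ψ : ℝ × ℝ → ℂ) (x : ℝ × ℝ) :
    ‖sndMul χ ψ x‖ = |χ x.2| * ‖ψ x‖ := by
  simp [sndMul]

theorem IsTest.sndMul (h : IsTest U ψ) {χ : ℝ → ℝ} (hχ : ContDiff ℝ ∞ χ) :
    IsTest U (sndMul χ ψ) :=
  h.of_tsupport_subset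
    ((Complex.ofRealCLM.contDiff.comp (hχ.comp contDiff_snd)).mul h.smooth)
    (tsupport_mul_subset_right (f := fun x : ℝ × ℝ => (χ x.2 : ℂ)))

theorem fderiv_sndMul {χ : ℝ → ℝ} {x : ℝ × ℝ} (hχ : DifferentiableAt ℝ χ x.2)
    (hψ : DifferentiableAt ℝ ψ x) (v : ℝ × ℝ) :
    fderiv ℝ (sndMul χ ψ) x v
      = (χ x.2 : ℂ) * fderiv ℝ ψ x v + ((deriv χ x.2 * v.2 : ℝ) : ℂ) * ψ x := by
  have hχ' : HasFDerivAt (fun x : ℝ × ℝ => (χ x.2 : ℂ)) _ x :=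
    Complex.ofRealCLM.hasFDerivAt.comp x (hχ.hasDerivAt.comp_hasFDerivAt x hasFDerivAt_snd)
  have hmul : fderiv ℝ (sndMul χ ψ) x = _ := (hχ'.mul hψ.hasFDerivAt).fderiv
  rw [hmul]
  simp only [ContinuousLinearMap.comp_smulₛₗ, Real.ringHom_apply, add_apply, smul_apply,
    smul_eq_mul, ContinuousLinearMap.comp_apply, ContinuousLinearMap.coe_snd',
    Complex.ofRealCLM_apply, Complex.real_smul, Complex.ofReal_mul, add_right_inj]
  ring

theorem covDerivSmooth_zero_sndMul {χ : ℝ → ℝ} {x : ℝ × ℝ} (hχ : DifferentiableAt ℝ χ x.2)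
    (hψ : DifferentiableAt ℝ ψ x) (a : ℝ) :
    covDerivSmooth a 0 (sndMul χ ψ) x = χ x.2 • covDerivSmooth a 0 ψ x := by
  rw [covDerivSmooth_zero, covDerivSmooth_zero, fderiv_sndMul hχ hψ, Complex.real_smul, sndMul]
  simp only [mul_zero, Complex.ofReal_zero, zero_mul, add_zero]
  ring

theorem covDerivSmooth_one_sndMul {χ : ℝ → ℝ} {x : ℝ × ℝ} (hχ : DifferentiableAt ℝ χ x.2)
    (hψ : DifferentiableAt ℝ ψ x) (a : ℝ) :
    covDerivSmooth a 1 (sndMul χ ψ) x = χ x.2 • covDerivSmooth a 1 ψ x + deriv χ x.2 • ψ x := by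
  rw [covDerivSmooth_one, covDerivSmooth_one, fderiv_sndMul hχ hψ]
  simp

theorem covGradSqSmooth_sndMul {χ : ℝ → ℝ} {x : ℝ × ℝ} (hχ : DifferentiableAt ℝ χ x.2)
    (hψ : DifferentiableAt ℝ ψ x) (a : ℝ) :
    covGradSqSmooth a (sndMul χ ψ) x = χ x.2 ^ 2 * covGradSqSmooth a ψ x
      + 2 * χ x.2 * deriv χ x.2 * inner ℝ (ψ x) (fderiv ℝ ψ x (0, 1))
      + deriv χ x.2 ^ 2 * ‖ψ x‖ ^ 2 := by
  rw [covGradSqSmooth_eq, covGradSqSmooth_eq, covDerivSmooth_zero_sndMul hχ hψ,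
    covDerivSmooth_one_sndMul hχ hψ, norm_add_sq_real, real_inner_smul_left,
    real_inner_smul_right, real_inner_comm, covDerivSmooth_one]
  simp only [norm_smul, mul_pow, Real.norm_eq_abs, sq_abs]
  ring

/-! ### The magnetic lower bound -/

theorem fderiv_fderiv_apply_comm {F : Type*} [NormedAddCommGroup F] [NormedSpace ℝ F]
    {f : ℝ × ℝ → F} (hf : ContDiff ℝ 2 f) (x v w : ℝ × ℝ) :
    fderiv ℝ (fun y => fderiv ℝ f y w) x v = fderiv ℝ (fun y => fderiv ℝ f y v) x w := by
  have hd : DifferentiableAt ℝ (fderiv ℝ f) x :=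
    (hf.fderiv_right (m := 1) (by norm_num)).differentiable one_ne_zero x
  have hsymm : IsSymmSndFDerivAt ℝ f x := hf.contDiffAt.isSymmSndFDerivAt (by simp)
  simpa [fderiv_clm_apply hd (differentiableAt_const _)] using hsymm v w

namespace IsTest

theorem integral_inner_fderiv_I_mul_fderiv_eq_zero (h : IsTest U ψ) (v w : ℝ × ℝ) :
    ∫ x, inner ℝ (fderiv ℝ ψ x v) (Complex.I * fderiv ℝ ψ x w) = 0 := by
  have byParts (v w : ℝ × ℝ) : ∫ x, inner ℝ (fderiv ℝ ψ x v) (Complex.I * fderiv ℝ ψ x w)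
      = -∫ x, inner ℝ (ψ x) (Complex.I * fderiv ℝ (fun y => fderiv ℝ ψ y w) x v) := by
    have hw := h.contDiff_fderiv_apply w
    have hIw (x : ℝ × ℝ) : fderiv ℝ (fun y => Complex.I * fderiv ℝ ψ y w) x v
        = Complex.I * fderiv ℝ (fun y => fderiv ℝ ψ y w) x v := by
      rw [fderiv_const_mul (hw.differentiable (by simp) x)]
      simp
    simp_rw [← hIw]
    rw [h.integral_inner_fderiv ((contDiff_const.mul hw).of_le (by simp)), neg_neg]
  have symm : ∫ x, inner ℝ (fderiv ℝ ψ x v) (Complex.I * fderiv ℝ ψ x w)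
      = ∫ x, inner ℝ (fderiv ℝ ψ x w) (Complex.I * fderiv ℝ ψ x v) := by
    have hsmooth : ContDiff ℝ 2 ψ := contDiff_infty.1 h.smooth 2
    have hsymm (x : ℝ × ℝ) := fderiv_fderiv_apply_comm hsmooth x v w
    simp_rw [byParts, hsymm]
  have antisymm : ∫ x, inner ℝ (fderiv ℝ ψ x v) (Complex.I * fderiv ℝ ψ x w)
      = -∫ x, inner ℝ (fderiv ℝ ψ x w) (Complex.I * fderiv ℝ ψ x v) := by
    rw [← integral_neg]
    congr with x
    simp only [Complex.inner, Complex.mul_re, Complex.mul_im, Complex.I_re, Complex.I_im,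
      Complex.conj_re, Complex.conj_im]
    ring
  linarith

-- The commutator of `∂₁ + i c x₂` and `∂₂` is `-i c`.
theorem integral_inner_covDeriv_constant_field (h : IsTest U ψ) (c : ℝ) :
    ∫ x, inner ℝ (fderiv ℝ ψ x (1, 0) + Complex.I * (c * x.2 : ℝ) * ψ x)
      (Complex.I * fderiv ℝ ψ x (0, 1)) = -(c / 2) * ∫ x, ‖ψ x‖ ^ 2 := by
  have expand (x : ℝ × ℝ) : inner ℝ (fderiv ℝ ψ x (1, 0) + Complex.I * (c * x.2 : ℝ) * ψ x)
      (Complex.I * fderiv ℝ ψ x (0, 1))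
      = inner ℝ (fderiv ℝ ψ x (1, 0)) (Complex.I * fderiv ℝ ψ x (0, 1))
        + c / 2 * (x.2 * fderiv ℝ (fun x => ‖ψ x‖ ^ 2) x (0, 1)) := by
    rw [h.fderiv_normSq]
    simp only [Complex.inner, map_add, map_mul, Complex.conj_I, Complex.conj_ofReal,
      Complex.add_re, Complex.add_im, Complex.neg_re, Complex.neg_im, Complex.mul_re,
      Complex.mul_im, Complex.I_re, Complex.I_im, Complex.conj_re, Complex.conj_im,
      Complex.ofReal_re, Complex.ofReal_im]
    ring
  simp_rw [expand]
  rw [integral_add, h.integral_inner_fderiv_I_mul_fderiv_eq_zero, integral_const_mul,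
    h.normSq.integral_snd_mul_fderiv]
  · ring
  · refine h.integrable ((h.continuous_fderiv_apply _).inner
      (continuous_const.mul (h.continuous_fderiv_apply _))) fun x hx => ?_
    simp [fderiv_of_notMem_tsupport ℝ hx]
  · refine h.normSq.integrable (continuous_const.mul
      (continuous_snd.mul (h.normSq.continuous_fderiv_apply _))) fun x hx => ?_
    simp [fderiv_of_notMem_tsupport ℝ hx]

theorem abs_mul_integral_normSq_le_constant_field (h : IsTest U ψ) (c : ℝ) :
    |c| * ∫ x, ‖ψ x‖ ^ 2 ≤ ∫ x, (‖fderiv ℝ ψ x (1, 0) + Complex.I * (c * x.2 : ℝ) * ψ x‖ ^ 2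
      + ‖fderiv ℝ ψ x (0, 1)‖ ^ 2) := by
  set D : ℝ × ℝ → ℂ := fun x => fderiv ℝ ψ x (1, 0) + Complex.I * (c * x.2 : ℝ) * ψ x
  have h₁ := h.continuous_fderiv_apply (1, 0)
  have h₂ := h.continuous_fderiv_apply (0, 1)
  have h₀ := h.continuous
  have hD : Continuous D := by fun_prop
  have hD0 (x) (hx : x ∉ tsupport ψ) : D x = 0 := by
    simp [D, fderiv_of_notMem_tsupport ℝ hx, image_eq_zero_of_notMem_tsupport hx]
  have iGrad : Integrable fun x => ‖D x‖ ^ 2 + ‖fderiv ℝ ψ x (0, 1)‖ ^ 2 :=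
    h.integrable (by fun_prop) fun x hx => by simp [hD0 x hx, fderiv_of_notMem_tsupport ℝ hx]
  have iInner : Integrable fun x => inner ℝ (D x) (Complex.I * fderiv ℝ ψ x (0, 1)) :=
    h.integrable (by fun_prop) fun x hx => by simp [hD0 x hx]
  have square_nonneg (s : ℝ) (hs : s ^ 2 = 1) :
      0 ≤ (∫ x, (‖D x‖ ^ 2 + ‖fderiv ℝ ψ x (0, 1)‖ ^ 2))
        + 2 * s * ∫ x, inner ℝ (D x) (Complex.I * fderiv ℝ ψ x (0, 1)) := by
    rw [← integral_const_mul, ← integral_add iGrad (iInner.const_mul _)]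
    refine integral_nonneg fun x => (sq_nonneg
      ‖D x + s • (Complex.I * fderiv ℝ ψ x (0, 1))‖).trans_eq ?_
    rw [norm_add_sq_real, real_inner_smul_right, norm_smul, mul_pow, Real.norm_eq_abs, sq_abs, hs,
      norm_mul, Complex.norm_I]
    ring
  have hI : ∫ x, inner ℝ (D x) (Complex.I * fderiv ℝ ψ x (0, 1)) = -(c / 2) * ∫ x, ‖ψ x‖ ^ 2 :=
    h.integral_inner_covDeriv_constant_field c
  have hpos := square_nonneg 1 (by norm_num)
  have hneg := square_nonneg (-1) (by norm_num)
  rw [hI] at hpos hneg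
  rcases abs_cases c with ⟨hc, _⟩ | ⟨hc, _⟩ <;> rw [hc] <;> linarith

end IsTest

theorem covGradSqSmooth_congr (a : ℝ) {φ : ℝ × ℝ → ℂ} {x : ℝ × ℝ} (hφ : φ =ᶠ[𝓝 x] ψ) :
    covGradSqSmooth a φ x = covGradSqSmooth a ψ x := by
  simp only [covGradSqSmooth, covDerivSmooth, hφ.fderiv_eq, hφ.eq_of_nhds]

section Indicator

variable {H : Set (ℝ × ℝ)} {x : ℝ × ℝ}

theorem indicator_eventuallyEq_of_mem (hH : Disjoint (tsupport ψ) (frontier H)) (hx : x ∈ H) :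
    H.indicator ψ =ᶠ[𝓝 x] ψ := by
  by_cases hxψ : x ∈ tsupport ψ
  · have hxH : x ∈ interior H := self_sdiff_frontier H ▸ ⟨hx, disjoint_left.1 hH hxψ⟩
    filter_upwards [mem_interior_iff_mem_nhds.1 hxH] with y hy using indicator_of_mem hy ψ
  · filter_upwards [notMem_tsupport_iff_eventuallyEq.1 hxψ] with y hy
    exact indicator_apply_eq_self.2 fun _ => hy

theorem indicator_eventuallyEq_zero (hH : Disjoint (tsupport ψ) (frontier H)) (hx : x ∉ H) :
    H.indicator ψ =ᶠ[𝓝 x] 0 := by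
  filter_upwards [indicator_eventuallyEq_of_mem (H := Hᶜ) (by rwa [frontier_compl]) hx] with y hy
  rw [indicator_compl] at hy
  simpa using hy

theorem covGradSqSmooth_indicator (hH : Disjoint (tsupport ψ) (frontier H)) (a : ℝ) :
    covGradSqSmooth a (H.indicator ψ) = H.indicator (covGradSqSmooth a ψ) := by
  ext x
  by_cases hx : x ∈ H
  · rw [indicator_of_mem hx, covGradSqSmooth_congr a (indicator_eventuallyEq_of_mem hH hx)]
  · rw [indicator_of_notMem hx]
    exact covGradSqSmooth_eq_zero_of_notMem_tsupport a
      (notMem_tsupport_iff_eventuallyEq.2 (indicator_eventuallyEq_zero hH hx))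

theorem IsTest.indicator (h : IsTest U ψ) (hH : Disjoint (tsupport ψ) (frontier H)) :
    IsTest U (H.indicator ψ) := by
  refine h.of_tsupport_subset (contDiff_iff_contDiffAt.2 fun x => ?_)
    (closure_mono (support_indicator.trans_subset inter_subset_right))
  by_cases hx : x ∈ H
  · exact h.smooth.contDiffAt.congr_of_eventuallyEq (indicator_eventuallyEq_of_mem hH hx)
  · exact contDiffAt_const.congr_of_eventuallyEq (indicator_eventuallyEq_zero hH hx)

end Indicator

namespace IsTest

theorem min_mul_integral_normSq_le_of_halfPlane (a : ℝ) (h : IsTest U ψ)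
    (h0 : (∀ x : ℝ × ℝ, x.2 ≤ 0 → ψ x = 0) ∨ ∀ x : ℝ × ℝ, 0 ≤ x.2 → ψ x = 0) :
    min 1 |a| * ∫ x, ‖ψ x‖ ^ 2 ≤ ∫ x, covGradSqSmooth a ψ x := by
  have of_constant_field (c : ℝ) (hc : min 1 |a| ≤ |c|)
      (hk : ∀ x, ψ x = 0 ∨ stepPotential a x.2 = c * x.2) :
      min 1 |a| * ∫ x, ‖ψ x‖ ^ 2 ≤ ∫ x, covGradSqSmooth a ψ x := by
    refine (mul_le_mul_of_nonneg_right hc (integral_nonneg fun x => by positivity)).trans ?_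
    refine (h.abs_mul_integral_normSq_le_constant_field c).trans_eq ?_
    congr with x
    rw [covGradSqSmooth_eq, covDerivSmooth_one, covDerivSmooth_zero]
    rcases hk x with h1 | h1
    · simp [h1]
    · rw [h1]
  rcases h0 with h0 | h0
  · refine of_constant_field 1 (by simp) fun x => (le_total x.2 0).imp (h0 x) fun hx => ?_
    rw [stepPotential_of_nonneg a hx, one_mul]
  · exact of_constant_field a (min_le_right _ _) fun x =>
      (le_total 0 x.2).imp (h0 x) (stepPotential_of_nonpos a)

theorem min_mul_integral_normSq_le (a : ℝ) (h : IsTest U ψ) (h0 : ∀ x ∈ tsupport ψ, x.2 ≠ 0) :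
    min 1 |a| * ∫ x, ‖ψ x‖ ^ 2 ≤ ∫ x, covGradSqSmooth a ψ x := by
  set H : Set (ℝ × ℝ) := {x | 0 < x.2}
  have hH : MeasurableSet H := measurableSet_lt measurable_const measurable_snd
  have disjoint_frontier : Disjoint (tsupport ψ) (frontier H) := disjoint_left.2 fun x hx hxH =>
    h0 x hx (frontier_lt_subset_eq continuous_const continuous_snd hxH).symm
  have on_halfPlane (S : Set (ℝ × ℝ)) (hS : MeasurableSet S)
      (hψS : Disjoint (tsupport ψ) (frontier S))
      (hS0 : (∀ x : ℝ × ℝ, x.2 ≤ 0 → S.indicator ψ x = 0) ∨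
        ∀ x : ℝ × ℝ, 0 ≤ x.2 → S.indicator ψ x = 0) :
      min 1 |a| * ∫ x in S, ‖ψ x‖ ^ 2 ≤ ∫ x in S, covGradSqSmooth a ψ x := by
    have hle := (h.indicator hψS).min_mul_integral_normSq_le_of_halfPlane a hS0
    rw [covGradSqSmooth_indicator hψS, integral_indicator hS] at hle
    convert hle using 2
    rw [← integral_indicator hS]
    congr with x
    by_cases hx : x ∈ S <;> simp [hx]
  rw [← integral_add_compl hH h.integrable_normSq,
    ← integral_add_compl hH (h.integrable_covGradSqSmooth a), mul_add]
  refine add_le_add (on_halfPlane H hH disjoint_frontier (Or.inl fun x hx =>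
    indicator_of_notMem (s := H) (not_lt.2 hx) ψ)) (on_halfPlane Hᶜ hH.compl
      (by rwa [frontier_compl]) (Or.inr fun x hx => ?_))
  rcases hx.eq_or_lt with hx | hx
  · exact indicator_apply_eq_zero.2 fun _ =>
      image_eq_zero_of_notMem_tsupport fun hxψ => h0 x hxψ hx.symm
  · exact indicator_of_notMem (not_not.2 hx) ψ

end IsTest

/-! ### Near-minimizers in boxes -/

/-- The Ginzburg–Landau energy `𝓖_{a,b,R}` of a smooth function. -/
def energySmooth (a b : ℝ) (ψ : ℝ × ℝ → ℂ) : ℝ :=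
  ∫ x, (b * covGradSqSmooth a ψ x - ‖ψ x‖ ^ 2 + 1 / 2 * ‖ψ x‖ ^ 4)

theorem IsTest.integrable_energySmooth (h : IsTest U ψ) (a b : ℝ) :
    Integrable fun x => b * covGradSqSmooth a ψ x - ‖ψ x‖ ^ 2 + 1 / 2 * ‖ψ x‖ ^ 4 :=
  (((h.integrable_covGradSqSmooth a).const_mul b).sub h.integrable_normSq).add
    (h.integrable_norm_pow_four.const_mul _)

theorem IsTest.energySmooth_eq (h : IsTest U ψ) (a b : ℝ) :
    energySmooth a b ψ
      = b * (∫ x, covGradSqSmooth a ψ x) - (∫ x, ‖ψ x‖ ^ 2) + 1 / 2 * ∫ x, ‖ψ x‖ ^ 4 := by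
  have iGrad := (h.integrable_covGradSqSmooth a).const_mul b
  have iDiff : Integrable fun x => b * covGradSqSmooth a ψ x - ‖ψ x‖ ^ 2 :=
    iGrad.sub h.integrable_normSq
  rw [energySmooth, integral_add iDiff (h.integrable_norm_pow_four.const_mul _),
    integral_sub iGrad h.integrable_normSq, integral_const_mul, integral_const_mul]

theorem energySmooth_zero (a b : ℝ) : energySmooth a b (fun _ => 0) = 0 := by
  simp [energySmooth, covGradSqSmooth, covDerivSmooth]

/-- The part `|x₂| ≤ m` of the strip `S_R`. -/
def box (R m : ℝ) : Set (ℝ × ℝ) := Ioo (-R / 2) (R / 2) ×ˢ Icc (-m) m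

theorem measurableSet_box (R m : ℝ) : MeasurableSet (box R m) :=
  measurableSet_Ioo.prod measurableSet_Icc

theorem volume_box (R m : ℝ) :
    volume (box R m) = ENNReal.ofReal R * ENNReal.ofReal (2 * m) := by
  rw [box, Measure.volume_eq_prod, Measure.prod_prod, Real.volume_Ioo, Real.volume_Icc]
  congr 2 <;> ring

theorem volume_box_ne_top (R m : ℝ) : volume (box R m) ≠ ⊤ := by
  rw [volume_box]
  exact ENNReal.mul_ne_top ENNReal.ofReal_ne_top ENNReal.ofReal_ne_top

theorem volume_real_box {R m : ℝ} (hR : 0 ≤ R) (hm : 0 ≤ m) :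
    volume.real (box R m) = R * (2 * m) := by
  rw [Measure.real, volume_box, ENNReal.toReal_mul, ENNReal.toReal_ofReal hR,
    ENNReal.toReal_ofReal (by positivity)]

/-- Test functions in the strip `S_R` which vanish for `|x₂| > m`; their closed supports lie in
`box R m`, but the edges `|x₂| = m` are not excluded. -/
structure IsBoxTest (R m : ℝ) (ψ : ℝ × ℝ → ℂ) : Prop where
  test : IsTest (strip R) ψ
  zero : ∀ x : ℝ × ℝ, m < |x.2| → ψ x = 0

theorem IsBoxTest.eq_zero {R m : ℝ} (h : IsBoxTest R m ψ) {x : ℝ × ℝ} (hx : x ∉ box R m) :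
    ψ x = 0 := by
  contrapose! hx
  exact ⟨(h.test.supp (subset_tsupport _ hx)).1, abs_le.1 (not_lt.1 fun hm => hx (h.zero x hm))⟩

theorem isBoxTest_zero (R m : ℝ) : IsBoxTest R m fun _ => 0 := ⟨.zero _, fun _ _ => rfl⟩

theorem integral_le_add_mul_volume {α : Type*} [MeasurableSpace α] {μ : Measure α} {s : Set α}
    (hs : MeasurableSet s) (hμs : μ s ≠ ⊤) {c : ℝ} {f g : α → ℝ} (hf : Integrable f μ)
    (hg : Integrable g μ) (hfg_in : ∀ x ∈ s, f x ≤ g x + c) (hfg_out : ∀ x ∉ s, f x ≤ g x) :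
    ∫ x, f x ∂μ ≤ (∫ x, g x ∂μ) + μ.real s * c := by
  have hc : Integrable (s.indicator fun _ => c) μ :=
    (integrable_indicator_iff hs).2 (integrableOn_const hμs)
  rw [← smul_eq_mul, ← setIntegral_const, ← integral_indicator hs, ← integral_add hg hc]
  refine integral_mono hf (hg.add hc) fun x => ?_
  by_cases hx : x ∈ s
  · simpa [hx] using hfg_in x hx
  · simpa [hx] using hfg_out x hx

theorem integral_le_add_of_box {R m c : ℝ} (hR : 0 ≤ R) (hm : 0 ≤ m) {f g : ℝ × ℝ → ℝ}
    (hf : Integrable f) (hg : Integrable g) (hfg_in : ∀ x ∈ box R m, f x ≤ g x + c)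
    (hfg_out : ∀ x ∉ box R m, f x ≤ g x) : ∫ x, f x ≤ (∫ x, g x) + R * (2 * m) * c := by
  rw [← volume_real_box hR hm]
  exact integral_le_add_mul_volume (measurableSet_box R m) (volume_box_ne_top R m) hf hg hfg_in
    hfg_out

theorem IsBoxTest.integral_normSq_le {R m : ℝ} (hR : 0 ≤ R) (hm : 0 ≤ m) (h : IsBoxTest R m ψ)
    (hle : ∀ x, ‖ψ x‖ ≤ 1) : ∫ x, ‖ψ x‖ ^ 2 ≤ R * (2 * m) := by
  simpa using integral_le_add_of_box (c := 1) hR hm h.test.integrable_normSq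
    (integrable_zero _ ℝ _) (fun x _ => by simpa using hle x) fun x hx => by simp [h.eq_zero hx]

theorem IsBoxTest.neg_le_energySmooth {R m b : ℝ} (hR : 0 ≤ R) (hm : 0 ≤ m) (hb : 0 ≤ b) (a : ℝ)
    (h : IsBoxTest R m ψ) : -(R * (2 * m) * (1 / 2)) ≤ energySmooth a b ψ := by
  have hgrad (x : ℝ × ℝ) : 0 ≤ b * covGradSqSmooth a ψ x :=
    mul_nonneg hb (covGradSqSmooth_nonneg a ψ x)
  have hle := integral_le_add_of_box (c := 1 / 2) hR hm (integrable_zero _ ℝ _)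
    (h.test.integrable_energySmooth a b)
    (fun x _ => by
      rw [Pi.zero_apply]
      nlinarith [hgrad x, sq_nonneg (‖ψ x‖ ^ 2 - 1)])
    (fun x hx => by simpa [h.eq_zero hx] using hgrad x)
  simp only [Pi.zero_apply, integral_zero] at hle
  rw [energySmooth]
  linarith

/-! ### Smooth truncation at modulus one -/

theorem norm_smul_add_inner_smul_sq_le {E : Type*} [NormedAddCommGroup E] [InnerProductSpace ℝ E]
    {h h' : ℝ} {z ζ : E} (h_nonneg : 0 ≤ h) (h_le : h ≤ 1) (h'_nonpos : h' ≤ 0)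
    (h_add : 0 ≤ h + ‖z‖ ^ 2 * h') :
    ‖h • ζ + (2 * h' * inner ℝ z ζ) • z‖ ^ 2 ≤ ‖ζ‖ ^ 2 := by
  have expand : ‖h • ζ + (2 * h' * inner ℝ z ζ) • z‖ ^ 2
      = h ^ 2 * ‖ζ‖ ^ 2 + 4 * (h' * (h + ‖z‖ ^ 2 * h') * inner ℝ z ζ ^ 2) := by
    rw [norm_add_sq_real, real_inner_smul_left, real_inner_smul_right, real_inner_comm]
    simp only [norm_smul, mul_pow, Real.norm_eq_abs, sq_abs]
    ring
  have cross_nonpos : h' * (h + ‖z‖ ^ 2 * h') * inner ℝ z ζ ^ 2 ≤ 0 :=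
    mul_nonpos_of_nonpos_of_nonneg (mul_nonpos_of_nonpos_of_nonneg h'_nonpos h_add) (sq_nonneg _)
  have square_le : h ^ 2 * ‖ζ‖ ^ 2 ≤ ‖ζ‖ ^ 2 :=
    mul_le_of_le_one_left (sq_nonneg _) (pow_le_one₀ h_nonneg h_le)
  linarith

theorem real_inner_covDerivSmooth (a : ℝ) (j : Fin 2) (ψ : ℝ × ℝ → ℂ) (x : ℝ × ℝ) :
    inner ℝ (ψ x) (covDerivSmooth a j ψ x) = inner ℝ (ψ x) (fderiv ℝ ψ x (e j)) := by
  simp only [covDerivSmooth, Complex.inner]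
  generalize sigma a x * A0 x j = r
  simp only [Complex.mul_re, Complex.mul_im, Complex.sub_re, Complex.sub_im, Complex.I_re,
    Complex.I_im, Complex.ofReal_re, Complex.ofReal_im, Complex.conj_re, Complex.conj_im]
  ring

theorem covDerivSmooth_radial {g : ℝ → ℝ} {g' : ℝ} {x : ℝ × ℝ} (hψ : DifferentiableAt ℝ ψ x)
    (hg : HasDerivAt g g' (‖ψ x‖ ^ 2)) (a : ℝ) (j : Fin 2) :
    covDerivSmooth a j (fun x => g (‖ψ x‖ ^ 2) • ψ x) x = g (‖ψ x‖ ^ 2) • covDerivSmooth a j ψ x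
      + (2 * g' * inner ℝ (ψ x) (covDerivSmooth a j ψ x)) • ψ x := by
  have hfderiv : fderiv ℝ (fun x => g (‖ψ x‖ ^ 2) • ψ x) x = _ :=
    ((hg.comp_hasFDerivAt x hψ.hasFDerivAt.norm_sq).smul hψ.hasFDerivAt).fderiv
  rw [real_inner_covDerivSmooth, covDerivSmooth, covDerivSmooth, hfderiv]
  simp only [add_apply, smul_apply, innerSL_apply_apply,
    ContinuousLinearMap.smulRight_apply, ContinuousLinearMap.comp_apply, nsmul_eq_mul,
    Nat.cast_ofNat, smul_eq_mul, Complex.real_smul, Function.comp_apply]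
  push_cast
  ring

theorem covGradSqSmooth_radial_le {g : ℝ → ℝ} {g' : ℝ} {x : ℝ × ℝ}
    (hψ : DifferentiableAt ℝ ψ x) (hg : HasDerivAt g g' (‖ψ x‖ ^ 2)) (a : ℝ)
    (hg_nonneg : 0 ≤ g (‖ψ x‖ ^ 2)) (hg_le : g (‖ψ x‖ ^ 2) ≤ 1) (hg'_nonpos : g' ≤ 0)
    (hg_add : 0 ≤ g (‖ψ x‖ ^ 2) + ‖ψ x‖ ^ 2 * g') :
    covGradSqSmooth a (fun x => g (‖ψ x‖ ^ 2) • ψ x) x ≤ covGradSqSmooth a ψ x :=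
  Finset.sum_le_sum fun j _ => by
    rw [covDerivSmooth_radial hψ hg]
    exact norm_smul_add_inner_smul_sq_le hg_nonneg hg_le hg'_nonpos hg_add

/-- The radial factor `(1 + s^k)^(-1/(2k))`: as `k → ∞`, `s * cutFactor k s ^ 2` approximates
`min s 1`. -/
def cutFactor (k : ℕ) (s : ℝ) : ℝ := (1 + s ^ k) ^ (-(1 / (2 * k : ℝ)))

theorem hasDerivAt_cutFactor {k : ℕ} (hk : k ≠ 0) {s : ℝ} (hs : 0 ≤ s) :
    HasDerivAt (cutFactor k) (-(1 / 2) * s ^ (k - 1) * (cutFactor k s / (1 + s ^ k))) s := by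
  have hpos : 0 < 1 + s ^ k := by positivity
  have hpow : HasDerivAt (fun s : ℝ => 1 + s ^ k) (k * s ^ (k - 1)) s := by
    simpa using (hasDerivAt_pow k s).const_add 1
  have hrpow := hpow.rpow_const (p := -(1 / (2 * k : ℝ))) (Or.inl hpos.ne')
  refine hrpow.congr_deriv ?_
  have hk' : (k : ℝ) ≠ 0 := Nat.cast_ne_zero.2 hk
  rw [Real.rpow_sub_one hpos.ne', cutFactor]
  field_simp

theorem cutFactor_pos (k : ℕ) {s : ℝ} (hs : 0 ≤ s) : 0 < cutFactor k s :=
  Real.rpow_pos_of_pos (by positivity) _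

theorem cutFactor_le_one (k : ℕ) {s : ℝ} (hs : 0 ≤ s) : cutFactor k s ≤ 1 :=
  Real.rpow_le_one_of_one_le_of_nonpos (by simpa using pow_nonneg hs k)
    (neg_nonpos.2 (by positivity))

theorem cutFactor_sq {k : ℕ} (hk : k ≠ 0) {s : ℝ} (hs : 0 ≤ s) :
    cutFactor k s ^ 2 = ((1 + s ^ k) ^ (1 / (k : ℝ)))⁻¹ := by
  have hpos : 0 < 1 + s ^ k := by positivity
  have hk' : (k : ℝ) ≠ 0 := Nat.cast_ne_zero.2 hk
  rw [cutFactor, ← Real.rpow_natCast, ← Real.rpow_mul hpos.le, ← Real.rpow_neg hpos.le]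
  congr 1
  push_cast
  field_simp

theorem mul_cutFactor_sq_le_one {k : ℕ} (hk : k ≠ 0) {s : ℝ} (hs : 0 ≤ s) :
    s * cutFactor k s ^ 2 ≤ 1 := by
  have hpos : 0 < 1 + s ^ k := by positivity
  rw [cutFactor_sq hk hs, ← div_eq_mul_inv, div_le_one (Real.rpow_pos_of_pos hpos _)]
  calc s = (s ^ k) ^ (1 / (k : ℝ)) := by rw [one_div, Real.pow_rpow_inv_natCast hs hk]
    _ ≤ _ := Real.rpow_le_rpow (by positivity) (by linarith) (by positivity)

theorem min_mul_le_mul_cutFactor_sq {k : ℕ} (hk : k ≠ 0) {s : ℝ} (hs : 0 ≤ s) :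
    min s 1 * ((2 : ℝ) ^ (1 / (k : ℝ)))⁻¹ ≤ s * cutFactor k s ^ 2 := by
  have hpos : 0 < 1 + s ^ k := by positivity
  rw [cutFactor_sq hk hs, ← div_eq_mul_inv, ← div_eq_mul_inv,
    div_le_div_iff₀ (by positivity) (Real.rpow_pos_of_pos hpos _)]
  rcases le_total s 1 with h | h
  · rw [min_eq_left h]
    gcongr
    linarith [pow_le_one₀ hs h (n := k)]
  · rw [min_eq_right h, one_mul]
    calc (1 + s ^ k) ^ (1 / (k : ℝ)) ≤ (s ^ k * 2) ^ (1 / (k : ℝ)) := by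
          gcongr
          linarith [one_le_pow₀ h (n := k)]
      _ = s * 2 ^ (1 / (k : ℝ)) := by
          rw [Real.mul_rpow (by positivity) (by norm_num), one_div, Real.pow_rpow_inv_natCast hs hk]

theorem cutFactor_add_mul_deriv_nonneg {k : ℕ} (hk : k ≠ 0) {s : ℝ} (hs : 0 ≤ s) :
    0 ≤ cutFactor k s + s * (-(1 / 2) * s ^ (k - 1) * (cutFactor k s / (1 + s ^ k))) := by
  have hpos := cutFactor_pos k hs
  have hmul : s * (-(1 / 2) * s ^ (k - 1) * (cutFactor k s / (1 + s ^ k)))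
      = -(1 / 2) * (s ^ k * cutFactor k s / (1 + s ^ k)) := by
    rw [← mul_pow_sub_one hk s]
    ring
  have hle : s ^ k * cutFactor k s / (1 + s ^ k) ≤ cutFactor k s := by
    rw [div_le_iff₀ (by positivity)]
    linarith
  rw [hmul]
  linarith

/-- The smooth truncation of a complex number at modulus one. -/
def softTrunc (k : ℕ) (z : ℂ) : ℂ := cutFactor k (‖z‖ ^ 2) • z

theorem softTrunc_zero (k : ℕ) : softTrunc k 0 = 0 := smul_zero _

theorem norm_softTrunc_sq (k : ℕ) (z : ℂ) :
    ‖softTrunc k z‖ ^ 2 = ‖z‖ ^ 2 * cutFactor k (‖z‖ ^ 2) ^ 2 := by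
  rw [softTrunc, norm_smul, mul_pow, Real.norm_eq_abs, sq_abs, mul_comm]

theorem norm_softTrunc_le_one {k : ℕ} (hk : k ≠ 0) (z : ℂ) : ‖softTrunc k z‖ ≤ 1 := by
  rw [← sq_le_one_iff₀ (norm_nonneg _), norm_softTrunc_sq]
  exact mul_cutFactor_sq_le_one hk (sq_nonneg _)

theorem contDiff_softTrunc (k : ℕ) : ContDiff ℝ ∞ (softTrunc k) := by
  unfold softTrunc cutFactor
  refine (ContDiff.rpow_const_of_ne ?_ fun z => ?_).smul contDiff_id
  · exact contDiff_const.add ((contDiff_norm_sq ℝ).pow k)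
  · positivity

theorem potential_softTrunc_le {k : ℕ} (hk : k ≠ 0) (z : ℂ) :
    -‖softTrunc k z‖ ^ 2 + 1 / 2 * (‖softTrunc k z‖ ^ 2) ^ 2
      ≤ -‖z‖ ^ 2 + 1 / 2 * (‖z‖ ^ 2) ^ 2 + (1 - ((2 : ℝ) ^ (1 / (k : ℝ)))⁻¹) := by
  rw [norm_softTrunc_sq]
  have hs : 0 ≤ ‖z‖ ^ 2 := sq_nonneg _
  generalize ‖z‖ ^ 2 = s at hs
  have ht_nonneg : 0 ≤ s * cutFactor k s ^ 2 := mul_nonneg hs (sq_nonneg _)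
  have ht_le_one : s * cutFactor k s ^ 2 ≤ 1 := mul_cutFactor_sq_le_one hk hs
  have ht_le : s * cutFactor k s ^ 2 ≤ s := mul_le_of_le_one_right hs
    (pow_le_one₀ (cutFactor_pos k hs).le (cutFactor_le_one k hs))
  have le_ht := min_mul_le_mul_cutFactor_sq hk hs
  have hc : ((2 : ℝ) ^ (1 / (k : ℝ)))⁻¹ ≤ 1 :=
    inv_le_one_of_one_le₀ (Real.one_le_rpow (by norm_num) (by positivity))
  rcases le_total s 1 with h | h
  · rw [min_eq_left h] at le_ht
    nlinarith
  · rw [min_eq_right h, one_mul] at le_ht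
    nlinarith [sq_nonneg (1 - s)]

theorem covGradSqSmooth_softTrunc_le {k : ℕ} (hk : k ≠ 0) {x : ℝ × ℝ}
    (hψ : DifferentiableAt ℝ ψ x) (a : ℝ) :
    covGradSqSmooth a (fun x => softTrunc k (ψ x)) x ≤ covGradSqSmooth a ψ x := by
  have hs : 0 ≤ ‖ψ x‖ ^ 2 := sq_nonneg _
  have hpos := cutFactor_pos k hs
  refine covGradSqSmooth_radial_le hψ (hasDerivAt_cutFactor hk hs) a hpos.le
    (cutFactor_le_one k hs) ?_ (cutFactor_add_mul_deriv_nonneg hk hs)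
  rw [mul_assoc]
  exact mul_nonpos_of_nonpos_of_nonneg (by norm_num) (by positivity)

theorem IsBoxTest.softTrunc {R m : ℝ} (h : IsBoxTest R m ψ) (k : ℕ) :
    IsBoxTest R m fun x => softTrunc k (ψ x) :=
  ⟨h.test.comp_left (contDiff_softTrunc k) (softTrunc_zero k),
    fun x hx => by rw [h.zero x hx, softTrunc_zero]⟩

theorem IsBoxTest.energySmooth_softTrunc_le {R m b : ℝ} (hR : 0 ≤ R) (hm : 0 ≤ m) (hb : 0 ≤ b)
    (a : ℝ) (h : IsBoxTest R m ψ) {k : ℕ} (hk : k ≠ 0) :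
    energySmooth a b (fun x => MagneticStep.softTrunc k (ψ x)) ≤ energySmooth a b ψ
      + R * (2 * m) * (1 - ((2 : ℝ) ^ (1 / (k : ℝ)))⁻¹) := by
  have hgrad (x : ℝ × ℝ) :=
    mul_le_mul_of_nonneg_left (covGradSqSmooth_softTrunc_le hk (h.test.differentiable x) a) hb
  refine integral_le_add_of_box hR hm ((h.softTrunc k).test.integrable_energySmooth a b)
    (h.test.integrable_energySmooth a b) (fun x _ => ?_) fun x hx => ?_
  · linear_combination hgrad x + potential_softTrunc_le hk (ψ x)
  · simpa [h.eq_zero hx, softTrunc_zero] using hgrad x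

theorem tendsto_one_sub_two_rpow_inv :
    Tendsto (fun k : ℕ => 1 - ((2 : ℝ) ^ (1 / (k : ℝ)))⁻¹) atTop (𝓝 0) := by
  have hpow : Tendsto (fun k : ℕ => (2 : ℝ) ^ (1 / (k : ℝ))) atTop (𝓝 1) := by
    simpa [Function.comp_def] using (Real.continuous_const_rpow (a := 2)
      (by norm_num)).continuousAt.tendsto.comp tendsto_one_div_atTop_nhds_zero_nat
  simpa using (hpow.inv₀ one_ne_zero).const_sub 1

theorem exists_isBoxTest_near_min {R m b ε : ℝ} (hR : 0 ≤ R) (hm : 0 ≤ m) (hb : 0 ≤ b) (a : ℝ)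
    (hε : 0 < ε) : ∃ ψ, IsBoxTest R m ψ ∧ (∀ x, ‖ψ x‖ ≤ 1) ∧
      ∀ v, IsBoxTest R m v → energySmooth a b ψ ≤ energySmooth a b v + ε := by
  set S : Set ℝ := energySmooth a b '' {v | IsBoxTest R m v}
  have hS_bdd : BddBelow S :=
    ⟨_, by rintro _ ⟨v, hv, rfl⟩; exact hv.neg_le_energySmooth hR hm hb a⟩
  obtain ⟨_, ⟨v, hv, rfl⟩, hv_lt⟩ := exists_lt_of_csInf_lt
    (s := S) ⟨_, _, isBoxTest_zero R m, rfl⟩ (lt_add_of_pos_right (sInf S) (half_pos hε))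
  have hlim := tendsto_one_sub_two_rpow_inv.const_mul (R * (2 * m))
  rw [mul_zero] at hlim
  obtain ⟨k, hk_lt, hk⟩ := ((hlim.eventually_lt_const (half_pos hε)).and
    (eventually_ne_atTop 0)).exists
  refine ⟨_, hv.softTrunc k, fun x => norm_softTrunc_le_one hk _, fun w hw => ?_⟩
  have hsoft := hv.energySmooth_softTrunc_le hR hm hb a hk
  have hinf : sInf S ≤ energySmooth a b w := csInf_le hS_bdd ⟨w, hw, rfl⟩
  linarith

/-! ### The approximate Euler–Lagrange inequality -/

/-- Half the derivative at `t = 0` of the energy of `(1 + tη(x₂))ψ`. -/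
def firstVariation (a b : ℝ) (η : ℝ → ℝ) (ψ : ℝ × ℝ → ℂ) : ℝ :=
  ∫ x : ℝ × ℝ, (b * (η x.2 * covGradSqSmooth a ψ x
      + deriv η x.2 * inner ℝ (ψ x) (fderiv ℝ ψ x (0, 1)))
    - η x.2 * ‖ψ x‖ ^ 2 + η x.2 * ‖ψ x‖ ^ 4)

namespace IsTest

theorem integrable_snd_mul (h : IsTest U ψ) {w : ℝ → ℝ} (hw : Continuous w) {g : ℝ × ℝ → ℝ}
    (hg : Continuous g) (hg0 : ∀ x, x ∉ tsupport ψ → g x = 0) :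
    Integrable fun x : ℝ × ℝ => w x.2 * g x :=
  h.integrable ((hw.comp continuous_snd).mul hg) fun x hx => by rw [hg0 x hx, mul_zero]

theorem integrable_snd_mul_covGradSqSmooth (h : IsTest U ψ) (a : ℝ) {w : ℝ → ℝ}
    (hw : Continuous w) : Integrable fun x : ℝ × ℝ => w x.2 * covGradSqSmooth a ψ x :=
  h.integrable_snd_mul hw (h.continuous_covGradSqSmooth a) fun _ hx =>
    covGradSqSmooth_eq_zero_of_notMem_tsupport a hx

theorem integrable_snd_mul_inner_fderiv (h : IsTest U ψ) {w : ℝ → ℝ} (hw : Continuous w) :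
    Integrable fun x : ℝ × ℝ => w x.2 * inner ℝ (ψ x) (fderiv ℝ ψ x (0, 1)) :=
  h.integrable_snd_mul hw (h.continuous_inner_fderiv _) fun x hx => by
    rw [image_eq_zero_of_notMem_tsupport hx, inner_zero_left]

theorem integrable_snd_mul_norm_pow (h : IsTest U ψ) {w : ℝ → ℝ} (hw : Continuous w) {p : ℕ}
    (hp : p ≠ 0) : Integrable fun x : ℝ × ℝ => w x.2 * ‖ψ x‖ ^ p :=
  h.integrable_snd_mul hw (h.continuous.norm.pow p) fun x hx => by
    simp [image_eq_zero_of_notMem_tsupport hx, hp]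

theorem integrable_firstVariation (h : IsTest U ψ) (a b : ℝ) {η : ℝ → ℝ} (hη : ContDiff ℝ ∞ η) :
    Integrable fun x : ℝ × ℝ =>
      b * (η x.2 * covGradSqSmooth a ψ x + deriv η x.2 * inner ℝ (ψ x) (fderiv ℝ ψ x (0, 1)))
        - η x.2 * ‖ψ x‖ ^ 2 + η x.2 * ‖ψ x‖ ^ 4 :=
  ((((h.integrable_snd_mul_covGradSqSmooth a hη.continuous).add
    (h.integrable_snd_mul_inner_fderiv (hη.continuous_deriv (by simp)))).const_mul b).sub
    (h.integrable_snd_mul_norm_pow hη.continuous two_ne_zero)).add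
    (h.integrable_snd_mul_norm_pow hη.continuous four_ne_zero)

end IsTest

theorem IsBoxTest.notMem_tsupport {R m : ℝ} (h : IsBoxTest R m ψ) {x : ℝ × ℝ} (hx : m < |x.2|) :
    x ∉ tsupport ψ := by
  rw [notMem_tsupport_iff_eventuallyEq]
  filter_upwards [(continuous_snd.abs.tendsto x).eventually_const_lt hx] with y hy
  exact h.zero y hy

theorem IsBoxTest.sndMul {R m : ℝ} (h : IsBoxTest R m ψ) {χ : ℝ → ℝ} (hχ : ContDiff ℝ ∞ χ) :
    IsBoxTest R m (sndMul χ ψ) :=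
  ⟨h.test.sndMul hχ, fun x hx => by simp [MagneticStep.sndMul, h.zero x hx]⟩

section ScalarExpansion

variable {t y y' M g s c : ℝ}

theorem kinetic_expansion_le (hy : 0 ≤ y) (hyM : y ≤ M) (hy' : |y'| ≤ M) (hg : 0 ≤ g)
    (hs : 0 ≤ s) (hc : c ^ 2 ≤ s * g) :
    (1 - t * y) ^ 2 * g + 2 * (1 - t * y) * (-(t * y')) * c + (-(t * y')) ^ 2 * s
      ≤ g - 2 * t * (y * g + y' * c) + t ^ 2 * (2 * M ^ 2 * (g + s)) := by
  have cross : 2 * (y * y' * c) ≤ y ^ 2 * g + y' ^ 2 * s :=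
    two_mul_le_add_of_sq_le_mul (by positivity) (by positivity) <| by
      calc (y * y' * c) ^ 2 = y ^ 2 * y' ^ 2 * c ^ 2 := by ring
        _ ≤ y ^ 2 * y' ^ 2 * (s * g) := by gcongr
        _ = y ^ 2 * g * (y' ^ 2 * s) := by ring
  have second_order : y ^ 2 * g + 2 * (y * y' * c) + y' ^ 2 * s ≤ 2 * M ^ 2 * (g + s) :=
    calc y ^ 2 * g + 2 * (y * y' * c) + y' ^ 2 * s ≤ 2 * (y ^ 2 * g + |y'| ^ 2 * s) := by
          rw [sq_abs]
          linarith
      _ ≤ 2 * (M ^ 2 * g + M ^ 2 * s) := by gcongr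
      _ = _ := by ring
  linear_combination t ^ 2 * second_order

theorem potential_expansion_le (ht : 0 ≤ t) (ht1 : t ≤ 1) (hy : 0 ≤ y) (hyM : y ≤ M)
    (hs : 0 ≤ s) (hs1 : s ≤ 1) :
    -((1 - t * y) ^ 2 * s) + 1 / 2 * ((1 - t * y) ^ 4 * s ^ 2)
      ≤ -s + 1 / 2 * s ^ 2 - 2 * t * (-(y * s) + y * s ^ 2)
        + t ^ 2 * ((3 * M ^ 2 + M ^ 4) * s) := by
  have hss : s ^ 2 ≤ s := by nlinarith
  have square : 0 ≤ t ^ 2 * (y ^ 2 * s) := by positivity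
  have cubic : 0 ≤ (t * y) ^ 3 * s ^ 2 := by positivity
  have quadratic : t ^ 2 * (y ^ 2 * s ^ 2) ≤ t ^ 2 * (M ^ 2 * s) := by gcongr
  have quartic : t ^ 2 * (t ^ 2 * (y ^ 4 * s ^ 2)) ≤ t ^ 2 * (1 * (M ^ 4 * s)) := by
    gcongr
    exact pow_le_one₀ ht ht1
  have quartic_nonneg : 0 ≤ t ^ 2 * (M ^ 4 * s) := by positivity
  linear_combination square + 2 * cubic + 3 * quadratic + 1 / 2 * quartic + 1 / 2 * quartic_nonneg

end ScalarExpansion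

section NearMin

variable {R m M a b : ℝ} {η : ℝ → ℝ}

theorem IsBoxTest.energySmooth_sndMul_le (hψ : IsBoxTest R m ψ) (hle : ∀ x, ‖ψ x‖ ≤ 1)
    (hb : 0 ≤ b) {t : ℝ} (ht : 0 ≤ t) (ht1 : t ≤ 1) (hη : ContDiff ℝ ∞ η)
    (hη_nonneg : ∀ s, 0 ≤ η s) (hη_le : ∀ s, |s| ≤ m → η s ≤ M)
    (hη' : ∀ s, |s| ≤ m → |deriv η s| ≤ M) :
    energySmooth a b (MagneticStep.sndMul (fun s => 1 - t * η s) ψ)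
      ≤ energySmooth a b ψ - 2 * t * firstVariation a b η ψ
        + t ^ 2 * (2 * M ^ 2 * (b * ∫ x, covGradSqSmooth a ψ x)
          + (2 * b * M ^ 2 + 3 * M ^ 2 + M ^ 4) * ∫ x, ‖ψ x‖ ^ 2) := by
  have hT := hψ.test
  have hχ : ContDiff ℝ ∞ fun s => 1 - t * η s := contDiff_const.sub (contDiff_const.mul hη)
  have hχ' (s : ℝ) : deriv (fun s => 1 - t * η s) s = -(t * deriv η s) := by
    rw [deriv_const_sub, deriv_const_mul _ ((hη.differentiable (by simp)) s)]
  have iE := hT.integrable_energySmooth a b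
  have iV := (hT.integrable_firstVariation a b hη).const_mul (2 * t)
  have iG := ((hT.integrable_covGradSqSmooth a).const_mul b).const_mul (2 * M ^ 2)
  have iN := hT.integrable_normSq.const_mul (2 * b * M ^ 2 + 3 * M ^ 2 + M ^ 4)
  rw [energySmooth, firstVariation, energySmooth, ← integral_const_mul, ← integral_const_mul,
    ← integral_const_mul, ← integral_const_mul, ← integral_add iG iN, ← integral_const_mul,
    ← integral_sub iE iV]
  refine (integral_mono ((hψ.sndMul hχ).test.integrable_energySmooth a b)
    ((iE.sub iV).add ((iG.add iN).const_mul _)) fun x => ?_).trans_eq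
      (integral_add (iE.sub iV) ((iG.add iN).const_mul _))
  simp only [Pi.add_apply, Pi.sub_apply]
  by_cases hx : |x.2| ≤ m
  · have kinetic := mul_le_mul_of_nonneg_left (kinetic_expansion_le (t := t) (hη_nonneg x.2)
      (hη_le x.2 hx) (hη' x.2 hx) (covGradSqSmooth_nonneg a ψ x) (sq_nonneg ‖ψ x‖)
      (inner_fderiv_sq_le a ψ x)) hb
    have potential := potential_expansion_le ht ht1 (hη_nonneg x.2) (hη_le x.2 hx)
      (sq_nonneg ‖ψ x‖) (pow_le_one₀ (norm_nonneg _) (hle x))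
    rw [covGradSqSmooth_sndMul (hχ.differentiable (by simp) _) (hT.differentiable x), norm_sndMul,
      hχ', mul_pow, mul_pow, sq_abs, Even.pow_abs (by decide : Even 4)]
    linear_combination kinetic + potential
  · have hx := not_le.1 hx
    simp [covGradSqSmooth_eq_zero_of_notMem_tsupport a (hψ.notMem_tsupport hx),
      covGradSqSmooth_eq_zero_of_notMem_tsupport a ((hψ.sndMul hχ).notMem_tsupport hx),
      hψ.zero x hx, (hψ.sndMul hχ).zero x hx]

theorem exists_near_min_firstVariation_le {δ : ℝ} (hR : 0 ≤ R) (hm : 0 ≤ m) (hb : 0 ≤ b)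
    (a M : ℝ) (hδ : 0 < δ) : ∃ ε > 0, ∀ ψ, IsBoxTest R m ψ → (∀ x, ‖ψ x‖ ≤ 1) →
      (∀ v, IsBoxTest R m v → energySmooth a b ψ ≤ energySmooth a b v + ε) →
      ∀ η : ℝ → ℝ, ContDiff ℝ ∞ η → (∀ t, 0 ≤ η t) → (∀ t, |t| ≤ m → η t ≤ M) →
        (∀ t, |t| ≤ m → |deriv η t| ≤ M) → firstVariation a b η ψ ≤ δ := by
  set A := R * (2 * m)
  have : 0 ≤ A := by positivity
  set K := 2 * M ^ 2 * (A + 1) + (2 * b * M ^ 2 + 3 * M ^ 2 + M ^ 4) * A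
  have : 0 ≤ K := by positivity
  set t := min 1 (δ / (K + 1))
  have ht : 0 < t := lt_min one_pos (by positivity)
  have htK : t * K ≤ δ := by
    have htδ : t * (K + 1) ≤ δ := (le_div_iff₀ (by positivity)).1 (min_le_right _ _)
    linarith
  refine ⟨min 1 (t * δ), lt_min one_pos (by positivity), ?_⟩
  intro ψ hψ hle hmin η hη hη_nonneg hη_le hη'
  have hN : ∫ x, ‖ψ x‖ ^ 2 ≤ A := hψ.integral_normSq_le hR hm hle
  have hG : b * ∫ x, covGradSqSmooth a ψ x ≤ A + 1 := by
    have hE := hmin _ (isBoxTest_zero R m)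
    rw [energySmooth_zero, hψ.test.energySmooth_eq] at hE
    have h4 : 0 ≤ ∫ x, ‖ψ x‖ ^ 4 := integral_nonneg fun x => by positivity
    linarith [min_le_left 1 (t * δ)]
  have hE := hψ.energySmooth_sndMul_le (a := a) hle hb ht.le (min_le_left _ _) hη hη_nonneg hη_le
    hη'
  have hEmin := hmin _ (hψ.sndMul (χ := fun s => 1 - t * η s)
    (contDiff_const.sub (contDiff_const.mul hη)))
  have remainder_le : t ^ 2 * (2 * M ^ 2 * (b * ∫ x, covGradSqSmooth a ψ x)
      + (2 * b * M ^ 2 + 3 * M ^ 2 + M ^ 4) * ∫ x, ‖ψ x‖ ^ 2) ≤ t * δ :=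
    calc _ ≤ t ^ 2 * K := mul_le_mul_of_nonneg_left (add_le_add
          (mul_le_mul_of_nonneg_left hG (by positivity))
          (mul_le_mul_of_nonneg_left hN (by positivity))) (sq_nonneg t)
      _ = t * (t * K) := by ring
      _ ≤ t * δ := by gcongr
  have : 2 * t * firstVariation a b η ψ ≤ 2 * t * δ := by
    linarith [min_le_right 1 (t * δ)]
  exact le_of_mul_le_mul_left this (by positivity)

end NearMin

/-! ### The weights -/

theorem one_le_log {t : ℝ} (ht : 4 ≤ t) : 1 ≤ Real.log t := by
  rw [Real.le_log_iff_exp_le (by linarith)]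
  linarith [Real.exp_one_lt_d9]

theorem quarter_le_div_log_sq {t : ℝ} (ht : 4 ≤ t) : 1 / 4 ≤ t / Real.log t ^ 2 := by
  have log_sqrt_le : Real.log √t ≤ √t - 1 :=
    Real.log_le_sub_one_of_pos (Real.sqrt_pos.2 (by linarith))
  rw [Real.log_sqrt (by linarith)] at log_sqrt_le
  have log_pos := one_le_log ht
  rw [div_le_div_iff₀ (by norm_num) (by positivity)]
  nlinarith [Real.sqrt_nonneg t, Real.sq_sqrt (show 0 ≤ t by linarith)]

theorem integrableOn_inv_mul_log_sq :
    IntegrableOn (fun t : ℝ => 1 / (t * Real.log t ^ 2)) (Ioi 4) := by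
  have hasDerivAt_neg_inv_log : ∀ t ∈ Ici (4 : ℝ), HasDerivAt (fun t => -(Real.log t)⁻¹)
      (1 / (t * Real.log t ^ 2)) t := by
    intro t (ht : 4 ≤ t)
    have log_pos := one_le_log ht
    refine ((Real.hasDerivAt_log (by positivity)).inv (by positivity)).neg.congr_deriv ?_
    field_simp
  refine integrableOn_Ioi_deriv_of_nonneg' hasDerivAt_neg_inv_log (fun t (ht : 4 < t) => ?_)
    (l := 0) ?_
  · positivity
  · simpa using Real.tendsto_log_atTop.inv_tendsto_atTop.neg

/-- The even function equal to `f |t|` for `|t| ≥ 3`, cut off smoothly to `0` on `[-2, 2]`. -/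
def stepMul (f : ℝ → ℝ) (t : ℝ) : ℝ := Real.smoothTransition (|t| - 2) * f |t|

section StepMul

variable {f : ℝ → ℝ} {t : ℝ}

theorem stepMul_of_le (ht : |t| ≤ 2) : stepMul f t = 0 := by
  rw [stepMul, Real.smoothTransition.zero_of_nonpos (by linarith), zero_mul]

theorem stepMul_of_ge (ht : 3 ≤ |t|) : stepMul f t = f |t| := by
  rw [stepMul, Real.smoothTransition.one_of_one_le (by linarith), one_mul]

theorem contDiff_stepMul (hf : ∀ t, 1 < t → ContDiffAt ℝ ∞ f t) : ContDiff ℝ ∞ (stepMul f) := by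
  rw [contDiff_iff_contDiffAt]
  intro t
  rcases lt_or_ge 1 |t| with h | h
  · have habs : ContDiffAt ℝ ∞ (fun t : ℝ => |t|) t :=
      contDiffAt_abs (abs_pos.1 (by linarith))
    exact (Real.smoothTransition.contDiffAt.comp t (habs.sub contDiffAt_const)).mul
      ((hf |t| h).comp t habs)
  · have zero_near : stepMul f =ᶠ[𝓝 t] fun _ => 0 := by
      filter_upwards [continuous_abs.continuousAt.eventually_lt_const
        (show |t| < 2 by linarith)] with y hy using stepMul_of_le hy.le
    exact contDiffAt_const.congr_of_eventuallyEq zero_near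

theorem deriv_stepMul_sq {f' : ℝ} (ht : 3 < |t|) (hf : HasDerivAt f f' |t|) :
    deriv (stepMul f) t ^ 2 = f' ^ 2 := by
  have ht0 : t ≠ 0 := abs_pos.1 (by linarith)
  have eq_comp_abs : stepMul f =ᶠ[𝓝 t] f ∘ fun t => |t| := by
    filter_upwards [continuous_abs.continuousAt.eventually_const_lt ht] with y hy
      using stepMul_of_ge hy.le
  rw [eq_comp_abs.deriv_eq, (hf.comp t (hasDerivAt_abs ht0)).deriv, mul_pow]
  rcases ht0.lt_or_gt with h | h <;> simp [h]

end StepMul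

/-- The strong weight, equal to `|t|^{3/2} / ln |t|` for `|t| ≥ 3`. -/
def strongWeight : ℝ → ℝ := stepMul fun t => t * (√t / Real.log t)

/-- The weak weight, equal to `|t|^{1/2} / ln |t|` for `|t| ≥ 3`. -/
def weakWeight : ℝ → ℝ := stepMul fun t => √t / Real.log t

theorem contDiffAt_sqrt_div_log {t : ℝ} (ht : 1 < t) :
    ContDiffAt ℝ ∞ (fun t => √t / Real.log t) t :=
  (Real.contDiffAt_sqrt (by linarith)).div (Real.contDiffAt_log.2 (by linarith))
    (Real.log_pos ht).ne'

theorem contDiff_strongWeight : ContDiff ℝ ∞ strongWeight :=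
  contDiff_stepMul fun _ ht => contDiffAt_id.mul (contDiffAt_sqrt_div_log ht)

theorem contDiff_weakWeight : ContDiff ℝ ∞ weakWeight :=
  contDiff_stepMul fun _ ht => contDiffAt_sqrt_div_log ht

theorem continuous_strongWeight_sq : Continuous fun t => strongWeight t ^ 2 :=
  contDiff_strongWeight.continuous.pow 2

theorem continuous_weakWeight_sq : Continuous fun t => weakWeight t ^ 2 :=
  contDiff_weakWeight.continuous.pow 2

theorem hasDerivAt_sqrt_div_log {t : ℝ} (ht : 1 < t) :
    HasDerivAt (fun t => √t / Real.log t) ((1 / 2 * Real.log t - 1) / (√t * Real.log t ^ 2)) t := by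
  have hL : 0 < Real.log t := Real.log_pos ht
  have ht0 : 0 < t := by linarith
  refine ((Real.hasDerivAt_sqrt ht0.ne').div (Real.hasDerivAt_log ht0.ne') hL.ne').congr_deriv ?_
  field_simp
  rw [Real.sq_sqrt ht0.le]
  field_simp

theorem hasDerivAt_mul_sqrt_div_log {t : ℝ} (ht : 1 < t) :
    HasDerivAt (fun t => t * (√t / Real.log t))
      (√t * (3 / 2 * Real.log t - 1) / Real.log t ^ 2) t := by
  have hL : 0 < Real.log t := Real.log_pos ht
  have ht0 : 0 < t := by linarith
  refine ((hasDerivAt_id t).mul (hasDerivAt_sqrt_div_log ht)).congr_deriv ?_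
  simp only [id]
  field_simp
  rw [Real.sq_sqrt ht0.le]
  ring

section Far

variable {t : ℝ} (ht : 4 ≤ |t|)
include ht

theorem strongWeight_sq : strongWeight t ^ 2 = |t| ^ 3 / Real.log |t| ^ 2 := by
  rw [strongWeight, stepMul_of_ge (by linarith), mul_pow, div_pow, Real.sq_sqrt (abs_nonneg t)]
  ring

theorem weakWeight_sq : weakWeight t ^ 2 = |t| / Real.log |t| ^ 2 := by
  rw [weakWeight, stepMul_of_ge (by linarith), div_pow, Real.sq_sqrt (abs_nonneg t)]

theorem quarter_le_weakWeight_sq : 1 / 4 ≤ weakWeight t ^ 2 := by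
  rw [weakWeight_sq ht]
  exact quarter_le_div_log_sq ht

theorem deriv_strongWeight_sq_le : deriv strongWeight t ^ 2 ≤ 9 / 4 * (|t| / Real.log |t| ^ 2) := by
  have log_ge := one_le_log ht
  have numerator_le : (3 / 2 * Real.log |t| - 1) ^ 2 ≤ 9 / 4 * Real.log |t| ^ 2 := by nlinarith
  rw [strongWeight,
    deriv_stepMul_sq (by linarith) (hasDerivAt_mul_sqrt_div_log (by linarith))]
  calc (√|t| * (3 / 2 * Real.log |t| - 1) / Real.log |t| ^ 2) ^ 2
      = |t| * (3 / 2 * Real.log |t| - 1) ^ 2 / (Real.log |t| ^ 2) ^ 2 := by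
        rw [div_pow, mul_pow, Real.sq_sqrt (abs_nonneg t)]
    _ ≤ |t| * (9 / 4 * Real.log |t| ^ 2) / (Real.log |t| ^ 2) ^ 2 := by gcongr
    _ = 9 / 4 * (|t| / Real.log |t| ^ 2) := by field_simp

theorem deriv_weakWeight_sq_le_one : deriv weakWeight t ^ 2 ≤ 1 := by
  have log_ge := one_le_log ht
  have numerator_le : (1 / 2 * Real.log |t| - 1) ^ 2 ≤ Real.log |t| ^ 2 := by nlinarith
  rw [weakWeight, deriv_stepMul_sq (by linarith) (hasDerivAt_sqrt_div_log (by linarith)), div_pow,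
    mul_pow, Real.sq_sqrt (abs_nonneg t), div_le_one (by positivity)]
  calc (1 / 2 * Real.log |t| - 1) ^ 2 ≤ 1 * (1 * Real.log |t| ^ 2) := by linarith
    _ ≤ |t| * (Real.log |t| ^ 2 * Real.log |t| ^ 2) := by
        gcongr
        · linarith
        · exact one_le_pow₀ log_ge
    _ = |t| * (Real.log |t| ^ 2) ^ 2 := by ring

end Far

theorem exists_deriv_weakWeight_sq_le : ∃ c, ∀ t, deriv weakWeight t ^ 2 ≤ c := by
  obtain ⟨c, hc⟩ := isCompact_Icc.exists_bound_of_continuousOn (s := Icc (-4 : ℝ) 4)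
    ((contDiff_weakWeight.continuous_deriv (by simp)).pow 2).continuousOn
  refine ⟨max c 1, fun t => ?_⟩
  rcases le_total |t| 4 with h4 | h4
  · exact (le_abs_self _).trans ((hc t (abs_le.1 h4)).trans (le_max_left _ _))
  · exact (deriv_weakWeight_sq_le_one h4).trans (le_max_right _ _)

/-- The remainder left by Young's inequality when `χ'²` and `η²`, for the strong weight `χ` and
the weak weight `η`, are absorbed into `χ²`. -/
def youngRemainder (t : ℝ) : ℝ :=
  if |t| ≤ 4 then deriv strongWeight t ^ 2 + weakWeight t ^ 2
  else 3 * (1 / (|t| * Real.log |t| ^ 2))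

theorem youngRemainder_nonneg (t : ℝ) : 0 ≤ youngRemainder t := by
  rw [youngRemainder]
  split_ifs <;> positivity

theorem integrable_youngRemainder : Integrable youngRemainder := by
  have above : IntegrableOn (fun t : ℝ => 3 * (1 / (|t| * Real.log |t| ^ 2))) (Ioi 4) :=
    IntegrableOn.congr_fun (integrableOn_inv_mul_log_sq.const_mul 3)
      (fun t (ht : 4 < t) => by rw [abs_of_pos (by linarith)]) measurableSet_Ioi
  have below := above.comp_neg
  simp only [neg_Ioi, abs_neg] at below
  have far : IntegrableOn (fun t : ℝ => 3 * (1 / (|t| * Real.log |t| ^ 2))) {t | |t| ≤ 4}ᶜ := by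
    refine (below.union above).mono_set fun t (ht : ¬|t| ≤ 4) => ?_
    exact (lt_abs.1 (not_le.1 ht)).symm.imp (fun h => lt_neg_of_lt_neg h) id
  have near : IntegrableOn (fun t => deriv strongWeight t ^ 2 + weakWeight t ^ 2)
      {t | |t| ≤ 4} :=
    ((((contDiff_strongWeight.continuous_deriv (by simp)).pow 2).add
      (contDiff_weakWeight.continuous.pow 2)).integrableOn_Icc (a := -4) (b := 4)).mono_set
      fun _ ht => abs_le.1 ht
  classical
  exact (Integrable.piecewise (measurableSet_le measurable_norm measurable_const) near far).congr
    (ae_of_all _ fun t => by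
      simp only [piecewise, mem_ofPred_eq, youngRemainder, Real.norm_eq_abs])

theorem young_far {t k q : ℝ} (ht : 4 < t) (hk : k ^ 2 ≤ 6) (hq : 1 / 2 ≤ q) (r b : ℝ) :
    b * (k * (t / Real.log t ^ 2) * r)
      ≤ q * (t ^ 3 / Real.log t ^ 2 * r ^ 2) + b ^ 2 * (3 * (1 / (t * Real.log t ^ 2))) := by
  have log_ge := one_le_log ht.le
  have young : b * k * (t ^ 2 * r) ≤ q * (t ^ 2 * r) ^ 2 + 3 * b ^ 2 :=
    calc b * k * (t ^ 2 * r) ≤ 1 / 2 * (t ^ 2 * r) ^ 2 + 1 / 2 * (b ^ 2 * k ^ 2) := by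
          nlinarith [sq_nonneg (t ^ 2 * r - b * k)]
      _ ≤ q * (t ^ 2 * r) ^ 2 + 1 / 2 * (b ^ 2 * 6) := by gcongr
      _ = q * (t ^ 2 * r) ^ 2 + 3 * b ^ 2 := by ring
  calc b * (k * (t / Real.log t ^ 2) * r)
      = b * k * (t ^ 2 * r) / (t * Real.log t ^ 2) := by field_simp
    _ ≤ (q * (t ^ 2 * r) ^ 2 + 3 * b ^ 2) / (t * Real.log t ^ 2) := by gcongr
    _ = _ := by field_simp

section Young

variable (t : ℝ) {r b : ℝ}

theorem mul_sq_mul_le_of_le_one {x y : ℝ} (hxy : x ≤ y) (hx : 0 ≤ x) (hr : r ≤ 1) (hb : 1 ≤ b) :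
    b * (x * r) ≤ b ^ 2 * y :=
  calc b * (x * r) ≤ b * (x * 1) := by gcongr
    _ = b * x := by rw [mul_one]
    _ ≤ b ^ 2 * y := mul_le_mul (le_self_pow₀ hb two_ne_zero) hxy hx (sq_nonneg b)

theorem young_deriv_strongWeight (hr : 0 ≤ r) (hr1 : r ≤ 1) (hb : 1 ≤ b) :
    b * (deriv strongWeight t ^ 2 * r)
      ≤ 1 / 2 * (strongWeight t ^ 2 * r ^ 2) + b ^ 2 * youngRemainder t := by
  rw [youngRemainder]
  split_ifs with h4
  · exact (mul_sq_mul_le_of_le_one (le_add_of_nonneg_right (sq_nonneg _)) (sq_nonneg _) hr1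
      hb).trans (le_add_of_nonneg_left (by positivity))
  · have h4 := not_le.1 h4
    rw [strongWeight_sq h4.le]
    refine le_trans ?_ (young_far h4 (k := 9 / 4) (by norm_num) le_rfl r b)
    gcongr
    exact deriv_strongWeight_sq_le h4.le

theorem young_weakWeight (hr1 : r ≤ 1) (hb : 1 ≤ b) :
    b * (weakWeight t ^ 2 * r) ≤ strongWeight t ^ 2 * r ^ 2 + b ^ 2 * youngRemainder t := by
  rw [youngRemainder]
  split_ifs with h4
  · exact (mul_sq_mul_le_of_le_one (le_add_of_nonneg_left (sq_nonneg _)) (sq_nonneg _) hr1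
      hb).trans (le_add_of_nonneg_left (by positivity))
  · have h4 := not_le.1 h4
    rw [strongWeight_sq h4.le, weakWeight_sq h4.le]
    simpa using young_far h4 (k := 1) (q := 1) (by norm_num) (by norm_num) r b

end Young

/-! ### A priori estimates for near-minimizers -/

section IntegralBound

variable {R κ : ℝ} {W : ℝ → ℝ}

/-- The function `W(x₂)` restricted to the strip. -/
def stripWeight (R : ℝ) (W : ℝ → ℝ) (x : ℝ × ℝ) : ℝ :=
  (Ioo (-R / 2) (R / 2)).indicator 1 x.1 * W x.2

theorem integrable_stripWeight (R : ℝ) (hW : Integrable W) : Integrable (stripWeight R W) :=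
  Integrable.mul_prod (μ := volume) (ν := volume)
    ((integrable_indicator_iff measurableSet_Ioo).2 (integrableOn_const (by simp))) hW

theorem integral_stripWeight (hR : 0 ≤ R) (W : ℝ → ℝ) :
    ∫ x, stripWeight R W x = R * ∫ t, W t := by
  have width : ∫ t, (Ioo (-R / 2) (R / 2)).indicator (1 : ℝ → ℝ) t = R := by
    rw [integral_indicator_one measurableSet_Ioo, Real.volume_real_Ioo_of_le (by linarith)]
    ring
  conv_rhs => rw [← width]
  exact integral_prod_mul (μ := volume) (ν := volume) ((Ioo (-R / 2) (R / 2)).indicator 1) W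

theorem stripWeight_nonneg (R : ℝ) (hW : ∀ t, 0 ≤ W t) (x : ℝ × ℝ) : 0 ≤ stripWeight R W x :=
  mul_nonneg (indicator_nonneg (fun _ _ => zero_le_one) _) (hW _)

theorem IsTest.integral_le_add_stripWeight (h : IsTest (strip R) ψ) (hR : 0 ≤ R) (hκ : 0 ≤ κ)
    (hW : Integrable W) (hW_nonneg : ∀ t, 0 ≤ W t) {f g : ℝ × ℝ → ℝ} (hf : Integrable f)
    (hg : Integrable g) (hfg : ∀ x, f x ≤ g x + κ * W x.2) (hzero : ∀ x, ψ x = 0 → f x ≤ g x) :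
    ∫ x, f x ≤ (∫ x, g x) + κ * (R * ∫ t, W t) := by
  have hκW := (integrable_stripWeight R hW).const_mul κ
  rw [← integral_stripWeight hR, ← integral_const_mul, ← integral_add hg hκW]
  refine integral_mono hf (hg.add hκW) fun x => ?_
  by_cases hx : ψ x = 0
  · exact (hzero x hx).trans
      (le_add_of_nonneg_right (mul_nonneg hκ (stripWeight_nonneg R hW_nonneg x)))
  · have hx₁ : x.1 ∈ Ioo (-R / 2) (R / 2) := (h.supp (subset_tsupport _ hx)).1
    simpa [stripWeight, hx₁] using hfg x

end IntegralBound

theorem deriv_sq_comp {χ : ℝ → ℝ} (hχ : ContDiff ℝ ∞ χ) (t : ℝ) :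
    deriv (fun t => χ t ^ 2) t = 2 * χ t * deriv χ t := by
  simpa using (hχ.differentiable (by simp) t).hasDerivAt.fun_pow 2 |>.deriv

theorem IsTest.firstVariation_sq_eq (h : IsTest U ψ) (a b : ℝ) {χ : ℝ → ℝ}
    (hχ : ContDiff ℝ ∞ χ) :
    firstVariation a b (fun t => χ t ^ 2) ψ
      = b * (∫ x, covGradSqSmooth a (MagneticStep.sndMul χ ψ) x)
        - b * (∫ x : ℝ × ℝ, deriv χ x.2 ^ 2 * ‖ψ x‖ ^ 2)
        - (∫ x : ℝ × ℝ, χ x.2 ^ 2 * ‖ψ x‖ ^ 2) + ∫ x : ℝ × ℝ, χ x.2 ^ 2 * ‖ψ x‖ ^ 4 := by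
  have hχ_sq : Continuous fun t => χ t ^ 2 := hχ.continuous.pow 2
  have hχ'_sq : Continuous fun t => deriv χ t ^ 2 := (hχ.continuous_deriv (by simp)).pow 2
  have iG := ((h.sndMul hχ).integrable_covGradSqSmooth a).const_mul b
  have iD := (h.integrable_snd_mul_norm_pow hχ'_sq two_ne_zero).const_mul b
  have i2 := h.integrable_snd_mul_norm_pow hχ_sq two_ne_zero
  have i4 := h.integrable_snd_mul_norm_pow hχ_sq four_ne_zero
  have iGD : Integrable fun x => b * covGradSqSmooth a (MagneticStep.sndMul χ ψ) x
    - b * (deriv χ x.2 ^ 2 * ‖ψ x‖ ^ 2) := iG.sub iD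
  have iGD2 : Integrable fun x => b * covGradSqSmooth a (MagneticStep.sndMul χ ψ) x
    - b * (deriv χ x.2 ^ 2 * ‖ψ x‖ ^ 2) - χ x.2 ^ 2 * ‖ψ x‖ ^ 2 := iGD.sub i2
  rw [← integral_const_mul, ← integral_const_mul, ← integral_sub iG iD,
    ← integral_sub iGD i2, ← integral_add iGD2 i4, firstVariation]
  refine integral_congr_ae (ae_of_all _ fun x => ?_)
  simp only [covGradSqSmooth_sndMul (hχ.differentiable (by simp) _) (h.differentiable x),
    deriv_sq_comp hχ]
  ring

theorem notMem_tsupport_sndMul_strongWeight {x : ℝ × ℝ} (hx : x.2 = 0) :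
    x ∉ tsupport (sndMul strongWeight ψ) := by
  rw [notMem_tsupport_iff_eventuallyEq]
  have near : ∀ᶠ y : ℝ × ℝ in 𝓝 x, |y.2| < 2 :=
    (continuous_snd.abs.tendsto x).eventually_lt_const (by simp [hx])
  filter_upwards [near] with y hy
  rw [sndMul, strongWeight, stepMul_of_le hy.le, Complex.ofReal_zero, zero_mul, Pi.zero_apply]

section Strip

variable {a b R δ : ℝ}

theorem IsTest.integral_strongWeight_le (h : IsTest (strip R) ψ) (hle : ∀ x, ‖ψ x‖ ≤ 1)
    (hb : 1 ≤ b) (hab : 1 ≤ b * |a|) (hR : 0 ≤ R)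
    (hv : firstVariation a b (fun t => strongWeight t ^ 2) ψ ≤ δ) :
    ∫ x : ℝ × ℝ, strongWeight x.2 ^ 2 * ‖ψ x‖ ^ 4
      ≤ 2 * (b ^ 2 * (R * ∫ t, youngRemainder t)) + 2 * δ := by
  have hχ := contDiff_strongWeight
  have hχ'_sq : Continuous fun t => deriv strongWeight t ^ 2 :=
    (hχ.continuous_deriv (by simp)).pow 2
  have magnetic : ∫ x : ℝ × ℝ, strongWeight x.2 ^ 2 * ‖ψ x‖ ^ 2
      ≤ b * ∫ x, covGradSqSmooth a (MagneticStep.sndMul strongWeight ψ) x := by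
    have hmin : 1 ≤ b * min 1 |a| := by
      rw [mul_min_of_nonneg _ _ (by linarith), mul_one]
      exact le_min hb hab
    have bound := (h.sndMul hχ).min_mul_integral_normSq_le a
      fun x hx hx₂ => notMem_tsupport_sndMul_strongWeight hx₂ hx
    simp only [norm_sndMul, mul_pow, sq_abs] at bound
    calc ∫ x : ℝ × ℝ, strongWeight x.2 ^ 2 * ‖ψ x‖ ^ 2
        ≤ b * min 1 |a| * ∫ x : ℝ × ℝ, strongWeight x.2 ^ 2 * ‖ψ x‖ ^ 2 :=
          le_mul_of_one_le_left (integral_nonneg fun x => by positivity) hmin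
      _ = b * (min 1 |a| * ∫ x : ℝ × ℝ, strongWeight x.2 ^ 2 * ‖ψ x‖ ^ 2) := mul_assoc _ _ _
      _ ≤ _ := by gcongr
  have young := h.integral_le_add_stripWeight (κ := b ^ 2) hR (by positivity)
    integrable_youngRemainder youngRemainder_nonneg
    ((h.integrable_snd_mul_norm_pow hχ'_sq two_ne_zero).const_mul b)
    ((h.integrable_snd_mul_norm_pow continuous_strongWeight_sq four_ne_zero).const_mul (1 / 2))
    (fun x => by
      simpa only [← pow_mul] using young_deriv_strongWeight x.2 (sq_nonneg ‖ψ x‖)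
        (pow_le_one₀ (norm_nonneg _) (hle x)) hb)
    (fun x hx => by simp [hx])
  rw [integral_const_mul, integral_const_mul] at young
  rw [h.firstVariation_sq_eq a b hχ] at hv
  linarith

theorem IsTest.integral_weakWeight_le (h : IsTest (strip R) ψ) (hle : ∀ x, ‖ψ x‖ ≤ 1)
    (hb : 1 ≤ b) (hR : 0 ≤ R) :
    b * ∫ x : ℝ × ℝ, weakWeight x.2 ^ 2 * ‖ψ x‖ ^ 2
      ≤ (∫ x : ℝ × ℝ, strongWeight x.2 ^ 2 * ‖ψ x‖ ^ 4)
        + b ^ 2 * (R * ∫ t, youngRemainder t) := by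
  rw [← integral_const_mul]
  exact h.integral_le_add_stripWeight hR (by positivity)
    integrable_youngRemainder youngRemainder_nonneg
    ((h.integrable_snd_mul_norm_pow continuous_weakWeight_sq
      two_ne_zero).const_mul b)
    (h.integrable_snd_mul_norm_pow continuous_strongWeight_sq four_ne_zero)
    (fun x => by
      simpa only [← pow_mul] using young_weakWeight x.2
        (pow_le_one₀ (norm_nonneg _) (hle x)) hb)
    (fun x hx => by simp [hx])

theorem IsTest.integral_normSq_le_weakWeight (h : IsTest (strip R) ψ) (hle : ∀ x, ‖ψ x‖ ≤ 1)
    (hR : 0 ≤ R) :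
    ∫ x, ‖ψ x‖ ^ 2 ≤ 4 * (∫ x : ℝ × ℝ, weakWeight x.2 ^ 2 * ‖ψ x‖ ^ 2) + R * (2 * 4) * 1 := by
  rw [← integral_const_mul]
  refine integral_le_add_of_box (m := 4) hR (by norm_num) h.integrable_normSq
    ((h.integrable_snd_mul_norm_pow continuous_weakWeight_sq
      two_ne_zero).const_mul 4) (fun x _ => ?_) (fun x hx => ?_)
  · have : ‖ψ x‖ ^ 2 ≤ 1 := pow_le_one₀ (norm_nonneg _) (hle x)
    exact this.trans (le_add_of_nonneg_left (by positivity))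
  · by_cases h0 : ψ x = 0
    · simp [h0]
    have far : 4 ≤ |x.2| := by
      by_contra! near
      exact hx ⟨(h.supp (subset_tsupport _ h0)).1, abs_le.1 near.le⟩
    have := mul_le_mul_of_nonneg_right (quarter_le_weakWeight_sq far) (sq_nonneg ‖ψ x‖)
    linarith

end Strip

theorem IsTest.integral_weakWeight_covGradSqSmooth_le (h : IsTest U ψ) {a b c δ : ℝ}
    (hb : 0 ≤ b) (hc : ∀ t, deriv weakWeight t ^ 2 ≤ c)
    (hv : firstVariation a b (fun t => weakWeight t ^ 2) ψ ≤ δ) :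
    b * ∫ x : ℝ × ℝ, weakWeight x.2 ^ 2 * covGradSqSmooth a ψ x
      ≤ 2 * (∫ x : ℝ × ℝ, weakWeight x.2 ^ 2 * ‖ψ x‖ ^ 2)
        + 4 * b * c * (∫ x, ‖ψ x‖ ^ 2) + 2 * δ := by
  have hη := contDiff_weakWeight
  have iN := (h.integrable_snd_mul_norm_pow continuous_weakWeight_sq two_ne_zero).const_mul 2
  have iM := h.integrable_normSq.const_mul (4 * b * c)
  have iNM : Integrable fun x => 2 * (weakWeight x.2 ^ 2 * ‖ψ x‖ ^ 2) + 4 * b * c * ‖ψ x‖ ^ 2 :=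
    iN.add iM
  have iV := (h.integrable_firstVariation a b (hη.pow 2)).const_mul 2
  have hvar : b * ∫ x : ℝ × ℝ, weakWeight x.2 ^ 2 * covGradSqSmooth a ψ x
      ≤ 2 * (∫ x : ℝ × ℝ, weakWeight x.2 ^ 2 * ‖ψ x‖ ^ 2) + 4 * b * c * (∫ x, ‖ψ x‖ ^ 2)
        + 2 * firstVariation a b (fun t => weakWeight t ^ 2) ψ := by
    rw [← integral_const_mul, ← integral_const_mul, ← integral_const_mul, firstVariation,
      ← integral_const_mul, ← integral_add iN iM, ← integral_add iNM iV]
    refine integral_mono ((h.integrable_snd_mul_covGradSqSmooth a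
      continuous_weakWeight_sq).const_mul b) (iNM.add iV) fun x => ?_
    simp only [deriv_sq_comp hη]
    set y := weakWeight x.2
    set y' := deriv weakWeight x.2
    set g := covGradSqSmooth a ψ x
    set p := inner ℝ (ψ x) (fderiv ℝ ψ x (0, 1))
    have hg : 0 ≤ g := covGradSqSmooth_nonneg a ψ x
    have cross : 2 * (-(2 * y * y' * p)) ≤ y ^ 2 * g + 4 * (y' ^ 2 * ‖ψ x‖ ^ 2) :=
      two_mul_le_add_of_sq_le_mul (by positivity) (by positivity) <|
        calc (-(2 * y * y' * p)) ^ 2 = 4 * y ^ 2 * y' ^ 2 * p ^ 2 := by ring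
          _ ≤ 4 * y ^ 2 * y' ^ 2 * (‖ψ x‖ ^ 2 * g) := by
            gcongr
            exact inner_fderiv_sq_le a ψ x
          _ = _ := by ring
    have hy' : b * (y' ^ 2 * ‖ψ x‖ ^ 2) ≤ b * (c * ‖ψ x‖ ^ 2) := by
      gcongr
      exact hc x.2
    have quartic : 0 ≤ y ^ 2 * ‖ψ x‖ ^ 4 := by positivity
    linear_combination b * cross + 4 * hy' + 2 * quartic
  linarith

theorem weighted_bounds_arith {I c b R N G Q X Y Z : ℝ} (hI : 0 ≤ I) (hc : 0 ≤ c) (hb : 1 ≤ b)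
    (hR : 0 ≤ R) (hQ : 0 ≤ Q) (hX : X ≤ 2 * (b ^ 2 * (R * I)) + 2 * R)
    (hY : b * Y ≤ X + b ^ 2 * (R * I)) (hN : N ≤ 4 * Y + R * (2 * 4) * 1)
    (hZ : b * Z ≤ 2 * Y + 4 * b * c * N + 2 * R) (hE : b * G - N + 1 / 2 * Q ≤ R) :
    X ≤ b ^ 2 * R * (2 * (I + 1)) ∧ Z + Y ≤ b * R * (9 * (I + 1) + 4 * c * (12 * (I + 1) + 8) + 2) ∧
      b * G + N ≤ b * R * (2 * (12 * (I + 1) + 8) + 1) := by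
  have hb0 : 0 < b := by linarith
  have hR_le : R ≤ b * R := le_mul_of_one_le_left hR hb
  have hbR_le : b * R ≤ b * (b * R) := le_mul_of_one_le_left (by positivity) hb
  have X_le : X ≤ b ^ 2 * R * (2 * (I + 1)) := by linarith
  have Y_le : Y ≤ b * R * (3 * (I + 1)) := by
    refine le_of_mul_le_mul_left ?_ hb0
    linarith
  have N_le : N ≤ b * R * (12 * (I + 1) + 8) := by linarith
  have Z_le : Z ≤ b * R * (6 * (I + 1) + 4 * c * (12 * (I + 1) + 8) + 2) := by
    refine le_of_mul_le_mul_left ?_ hb0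
    have hbY : Y ≤ b * (b * R * (3 * (I + 1))) :=
      Y_le.trans (le_mul_of_one_le_left (by positivity) hb)
    have hcN : 4 * b * c * N ≤ 4 * b * c * (b * R * (12 * (I + 1) + 8)) := by gcongr
    linarith
  exact ⟨X_le, by linarith, by linarith⟩

theorem exists_weighted_bounds : ∃ C : ℝ, 0 < C ∧ ∀ (a b R : ℝ) (ψ : ℝ × ℝ → ℂ), 1 ≤ b →
    1 ≤ b * |a| → 0 ≤ R → IsTest (strip R) ψ → (∀ x, ‖ψ x‖ ≤ 1) → energySmooth a b ψ ≤ R →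
    firstVariation a b (fun t => strongWeight t ^ 2) ψ ≤ R →
    firstVariation a b (fun t => weakWeight t ^ 2) ψ ≤ R →
    ∫ x : ℝ × ℝ, weakWeight x.2 ^ 2 * (covGradSqSmooth a ψ x + ‖ψ x‖ ^ 2) ≤ C * b * R ∧
      ∫ x : ℝ × ℝ, strongWeight x.2 ^ 2 * ‖ψ x‖ ^ 4 ≤ C * b ^ 2 * R ∧
      b * (∫ x, covGradSqSmooth a ψ x) + (∫ x, ‖ψ x‖ ^ 2) ≤ C * b * R := by
  obtain ⟨c, hc⟩ := exists_deriv_weakWeight_sq_le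
  have hc0 : 0 ≤ c := (sq_nonneg _).trans (hc 0)
  have hI : 0 ≤ ∫ t, youngRemainder t := integral_nonneg youngRemainder_nonneg
  set I := ∫ t, youngRemainder t
  set C := 24 * (I + 1) + 4 * c * (12 * (I + 1) + 8) + 17
  refine ⟨C, by positivity, fun a b R ψ hb hab hR h hle hE hstrong hweak => ?_⟩
  rw [h.energySmooth_eq] at hE
  obtain ⟨hX, hZY, hGN⟩ := weighted_bounds_arith hI hc0 hb hR
    (integral_nonneg fun x => by positivity) (h.integral_strongWeight_le hle hb hab hR hstrong)
    (h.integral_weakWeight_le hle hb hR) (h.integral_normSq_le_weakWeight hle hR)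
    (h.integral_weakWeight_covGradSqSmooth_le (by linarith) hc hweak) hE
  have le_C {B K : ℝ} (hB : 0 ≤ B) (hK : K ≤ C) : B * R * K ≤ C * B * R := by
    rw [mul_assoc C, mul_comm C]
    gcongr
  have hcI : 0 ≤ 4 * c * (12 * (I + 1) + 8) := by positivity
  refine ⟨?_, hX.trans (le_C (sq_nonneg b) (by linarith)),
    hGN.trans (le_C (by linarith) (by linarith))⟩
  have hη := continuous_weakWeight_sq
  have split := integral_add (h.integrable_snd_mul_covGradSqSmooth a hη)
    (h.integrable_snd_mul_norm_pow hη two_ne_zero)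
  simp only [← mul_add] at split
  exact split.trans_le (hZY.trans (le_C (by linarith) (by linarith)))

theorem exists_bound_smooth {f : ℝ → ℝ} (hf : ContDiff ℝ ∞ f) (m : ℝ) :
    ∃ M, ∀ t, |t| ≤ m → f t ≤ M ∧ |deriv f t| ≤ M := by
  obtain ⟨c, hc⟩ := isCompact_Icc.exists_bound_of_continuousOn (s := Icc (-m) m)
    (hf.continuous.prodMk (hf.continuous_deriv (by simp))).continuousOn
  exact ⟨c, fun t ht =>
    ⟨(le_abs_self _).trans ((norm_fst_le _).trans (hc t (abs_le.1 ht))),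
      (norm_snd_le (f t, deriv f t)).trans (hc t (abs_le.1 ht))⟩⟩

theorem setLIntegral_ofReal_le {S : Set (ℝ × ℝ)} (hS : MeasurableSet S) {f F : ℝ × ℝ → ℝ}
    (hF : Integrable F) (hF_nonneg : ∀ x, 0 ≤ F x) (hfF : ∀ x ∈ S, f x ≤ F x) {K : ℝ}
    (hK : ∫ x, F x ≤ K) : ∫⁻ x in S, ENNReal.ofReal (f x) ≤ ENNReal.ofReal K :=
  calc ∫⁻ x in S, ENNReal.ofReal (f x) ≤ ∫⁻ x in S, ENNReal.ofReal (F x) :=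
        setLIntegral_mono' hS fun x hx => ENNReal.ofReal_le_ofReal (hfF x hx)
    _ ≤ ∫⁻ x, ENNReal.ofReal (F x) := setLIntegral_le_lintegral _ _
    _ = ENNReal.ofReal (∫ x, F x) :=
        (ofReal_integral_eq_lintegral_ofReal hF (ae_of_all _ hF_nonneg)).symm
    _ ≤ ENNReal.ofReal K := ENNReal.ofReal_le_ofReal hK

theorem measurableSet_far (L : ℝ) : MeasurableSet {x : ℝ × ℝ | L ≤ |x.2|} :=
  (isClosed_le continuous_const continuous_snd.abs).measurableSet

/-- The bounds of the theorem for a smooth function `ψ`, with constant `C`. -/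
structure WeightedBounds (C a b R : ℝ) (ψ : ℝ × ℝ → ℂ) : Prop where
  weak : ∫⁻ x in {x : ℝ × ℝ | 4 ≤ |x.2|}, ENNReal.ofReal (|x.2| / Real.log |x.2| ^ 2 *
    (covGradSqSmooth a ψ x + ‖ψ x‖ ^ 2)) ≤ ENNReal.ofReal (C * b * R)
  strong : ∫⁻ x in {x : ℝ × ℝ | 4 ≤ |x.2|}, ENNReal.ofReal (|x.2| ^ 3 / Real.log |x.2| ^ 2 *
    ‖ψ x‖ ^ 4) ≤ ENNReal.ofReal (C * b ^ 2 * R)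
  total : b * (∫ x, covGradSqSmooth a ψ x) + (∫ x, ‖ψ x‖ ^ 2) ≤ C * b * R

theorem IsTest.weightedBounds (h : IsTest U ψ) {C a b R : ℝ}
    (hweak : ∫ x : ℝ × ℝ, weakWeight x.2 ^ 2 * (covGradSqSmooth a ψ x + ‖ψ x‖ ^ 2) ≤ C * b * R)
    (hstrong : ∫ x : ℝ × ℝ, strongWeight x.2 ^ 2 * ‖ψ x‖ ^ 4 ≤ C * b ^ 2 * R)
    (htotal : b * (∫ x, covGradSqSmooth a ψ x) + (∫ x, ‖ψ x‖ ^ 2) ≤ C * b * R) :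
    WeightedBounds C a b R ψ where
  weak := by
    have iη : Integrable fun x : ℝ × ℝ =>
        weakWeight x.2 ^ 2 * (covGradSqSmooth a ψ x + ‖ψ x‖ ^ 2) :=
      h.integrable_snd_mul continuous_weakWeight_sq
        ((h.continuous_covGradSqSmooth a).add (h.continuous.norm.pow 2)) fun x hx => by
        simp [covGradSqSmooth_eq_zero_of_notMem_tsupport a hx, image_eq_zero_of_notMem_tsupport hx]
    refine setLIntegral_ofReal_le (measurableSet_far 4) iη (fun x => ?_)
      (fun x hx => by rw [weakWeight_sq hx]) hweak
    have := covGradSqSmooth_nonneg a ψ x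
    positivity
  strong := setLIntegral_ofReal_le (measurableSet_far 4)
    (h.integrable_snd_mul_norm_pow continuous_strongWeight_sq four_ne_zero)
    (fun x => by positivity)
    (fun x hx => by rw [strongWeight_sq hx]) hstrong
  total := htotal

theorem exists_near_min_weightedBounds : ∃ C : ℝ, 0 < C ∧ ∀ a b R : ℝ, 1 ≤ b → 1 ≤ b * |a| →
    0 < R → ∀ m : ℝ, 0 ≤ m → ∀ ε : ℝ, 0 < ε → ∃ ψ : ℝ × ℝ → ℂ, IsBoxTest R m ψ ∧
      (∀ x, ‖ψ x‖ ≤ 1) ∧ (∀ v, IsBoxTest R m v → energySmooth a b ψ ≤ energySmooth a b v + ε) ∧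
      WeightedBounds C a b R ψ := by
  obtain ⟨C, hC, bounds⟩ := exists_weighted_bounds
  refine ⟨C, hC, fun a b R hb hab hR m hm ε hε => ?_⟩
  have hb0 : 0 ≤ b := by linarith
  have hχ := contDiff_strongWeight.pow 2
  have hη := contDiff_weakWeight.pow 2
  obtain ⟨M₁, hM₁⟩ := exists_bound_smooth hχ m
  obtain ⟨M₂, hM₂⟩ := exists_bound_smooth hη m
  obtain ⟨ε₁, hε₁, hvar₁⟩ := exists_near_min_firstVariation_le hR.le hm hb0 a M₁ hR
  obtain ⟨ε₂, hε₂, hvar₂⟩ := exists_near_min_firstVariation_le hR.le hm hb0 a M₂ hR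
  obtain ⟨ψ, hψ, hle, hmin⟩ := exists_isBoxTest_near_min (ε := min (min ε R) (min ε₁ ε₂))
    hR.le hm hb0 a (by positivity)
  have near_min {ε' : ℝ} (h : min (min ε R) (min ε₁ ε₂) ≤ ε') (v) (hv : IsBoxTest R m v) :
      energySmooth a b ψ ≤ energySmooth a b v + ε' := (hmin v hv).trans (by gcongr)
  have hE : energySmooth a b ψ ≤ R := by
    simpa [energySmooth_zero] using near_min ((min_le_left _ _).trans (min_le_right _ _)) _
      (isBoxTest_zero R m)
  have strong := hvar₁ ψ hψ hle (near_min ((min_le_right _ _).trans (min_le_left _ _))) _ hχ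
    (fun t => sq_nonneg _) (fun t ht => (hM₁ t ht).1) fun t ht => (hM₁ t ht).2
  have weak := hvar₂ ψ hψ hle (near_min ((min_le_right _ _).trans (min_le_right _ _))) _ hη
    (fun t => sq_nonneg _) (fun t ht => (hM₂ t ht).1) fun t ht => (hM₂ t ht).2
  obtain ⟨B₁, B₂, B₃⟩ := bounds a b R ψ hb hab hR.le hψ.test hle hE strong weak
  exact ⟨ψ, hψ, hle, near_min ((min_le_left _ _).trans (min_le_left _ _)),
    hψ.test.weightedBounds B₁ B₂ B₃⟩

/-! ### A Poincaré inequality on rectangles -/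

theorem norm_sub_sq_le {E : Type*} [SeminormedAddCommGroup E] (x y : E) :
    ‖x - y‖ ^ 2 ≤ 2 * ‖x‖ ^ 2 + 2 * ‖y‖ ^ 2 := by
  nlinarith [norm_sub_le x y, norm_nonneg (x - y), sq_nonneg (‖x‖ - ‖y‖)]

section Interval

variable {E : Type*} [NormedAddCommGroup E] {p q r s : ℝ}

theorem sq_intervalIntegral_le {f : ℝ → ℝ} (hf : Continuous f) (hpq : p < q) :
    (∫ t in p..q, f t) ^ 2 ≤ (q - p) * ∫ t in p..q, f t ^ 2 := by
  have hpq' : 0 < q - p := sub_pos.2 hpq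
  have jensen := (even_two.convexOn_pow (𝕜 := ℝ)).map_set_average_le (t := Ioc p q) (f := f)
    (μ := volume) (continuous_pow 2).continuousOn isClosed_univ (by simp [hpq]) (by simp)
    (ae_of_all _ fun _ => mem_univ _)
    ((intervalIntegrable_iff_integrableOn_Ioc_of_le hpq.le).1 (hf.intervalIntegrable p q))
    ((intervalIntegrable_iff_integrableOn_Ioc_of_le hpq.le).1
      ((hf.pow 2).intervalIntegrable p q))
  simp only [setAverage_eq, Real.volume_real_Ioc_of_le hpq.le, smul_eq_mul, mul_pow,
    ← intervalIntegral.integral_of_le hpq.le] at jensen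
  field_simp at jensen
  exact jensen

theorem intervalIntegrable_slice {F : ℝ × ℝ → E} (hF : Continuous F) (r s x : ℝ) :
    IntervalIntegrable (fun y => F (x, y)) volume r s :=
  (hF.comp (Continuous.prodMk_right x)).intervalIntegrable r s

variable [NormedSpace ℝ E]

theorem sq_norm_intervalIntegral_le {f : ℝ → E} (hf : Continuous f) (hpq : p < q) :
    ‖∫ t in p..q, f t‖ ^ 2 ≤ (q - p) * ∫ t in p..q, ‖f t‖ ^ 2 :=
  (pow_le_pow_left₀ (norm_nonneg _)
    (intervalIntegral.norm_integral_le_integral_norm hpq.le) 2).trans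
    (sq_intervalIntegral_le hf.norm hpq)

theorem norm_sub_le_intervalIntegral_deriv [CompleteSpace E] {g g' : ℝ → E}
    (hg : ∀ t, HasDerivAt g (g' t) t) (hg' : Continuous g') (hr : r ∈ Icc p q) (hs : s ∈ Icc p q) :
    ‖g r - g s‖ ≤ ∫ t in p..q, ‖g' t‖ := by
  wlog hrs : s ≤ r generalizing r s
  · rw [norm_sub_rev]
    exact this hs hr (le_of_not_ge hrs)
  rw [← intervalIntegral.integral_eq_sub_of_hasDerivAt (fun x _ => hg x)
    (hg'.intervalIntegrable _ _)]
  exact (intervalIntegral.norm_integral_le_integral_norm hrs).trans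
    (intervalIntegral.integral_mono_interval hs.1 hrs hr.2 (ae_of_all _ fun x => norm_nonneg _)
      (hg'.norm.intervalIntegrable _ _))

theorem poincare_interval [CompleteSpace E] {g g' : ℝ → E} (hg : ∀ t, HasDerivAt g (g' t) t)
    (hg' : Continuous g') (hpq : p < q) :
    ∫ t in p..q, ‖g t‖ ^ 2
      ≤ 2 / (q - p) * ‖∫ t in p..q, g t‖ ^ 2 + 2 * (q - p) ^ 2 * ∫ t in p..q, ‖g' t‖ ^ 2 := by
  have hpq' : 0 < q - p := sub_pos.2 hpq
  have cg : Continuous g := continuous_iff_continuousAt.2 fun t => (hg t).continuousAt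
  set c : E := (q - p)⁻¹ • ∫ t in p..q, g t with hc
  have osc : ∀ s ∈ Icc p q, ‖g s - c‖ ≤ ∫ t in p..q, ‖g' t‖ := fun s hs => by
    have mean : g s - c = (q - p)⁻¹ • ∫ t in p..q, (g s - g t) := by
      rw [intervalIntegral.integral_sub (by simp) (cg.intervalIntegrable _ _),
        intervalIntegral.integral_const, smul_sub, inv_smul_smul₀ hpq'.ne']
    have h := intervalIntegral.norm_integral_le_of_norm_le_const (a := p) (b := q)
      (f := fun t => g s - g t) fun t ht =>
        norm_sub_le_intervalIntegral_deriv hg hg' hs (uIcc_of_le hpq.le ▸ uIoc_subset_uIcc ht)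
    rw [mean, norm_smul, norm_inv, Real.norm_eq_abs, inv_mul_le_iff₀ (abs_pos.2 hpq'.ne')]
    linarith
  have pointwise : ∀ s ∈ Icc p q,
      ‖g s‖ ^ 2 ≤ 2 * ((q - p) * ∫ t in p..q, ‖g' t‖ ^ 2) + 2 * ‖c‖ ^ 2 := fun s hs =>
    calc ‖g s‖ ^ 2 ≤ 2 * ‖g s - c‖ ^ 2 + 2 * ‖c‖ ^ 2 := by
          simpa using norm_sub_sq_le (g s - c) (-c)
      _ ≤ 2 * (∫ t in p..q, ‖g' t‖) ^ 2 + 2 * ‖c‖ ^ 2 := by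
          gcongr
          exact osc s hs
      _ ≤ _ := by
          gcongr
          exact sq_intervalIntegral_le hg'.norm hpq
  refine (intervalIntegral.integral_mono_on hpq.le ((cg.norm.pow 2).intervalIntegrable _ _)
    (by simp) pointwise).trans_eq ?_
  rw [intervalIntegral.integral_const, smul_eq_mul, hc, norm_smul, norm_inv,
    Real.norm_of_nonneg hpq'.le]
  field_simp
  ring

/-- The iterated integral over the rectangle `[p, q] × [r, s]`. -/
def rectInt (p q r s : ℝ) (F : ℝ × ℝ → E) : E := ∫ x in p..q, ∫ y in r..s, F (x, y)

variable {F G : ℝ × ℝ → E}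

theorem continuous_integral_slice (hF : Continuous F) (r s : ℝ) :
    Continuous fun x => ∫ y in r..s, F (x, y) :=
  intervalIntegral.continuous_parametric_intervalIntegral_of_continuous'
    (f := fun x y => F (x, y)) hF r s

theorem rectInt_sub (hF : Continuous F) (hG : Continuous G) (p q r s : ℝ) :
    rectInt p q r s (fun x => F x - G x) = rectInt p q r s F - rectInt p q r s G := by
  simp only [rectInt, intervalIntegral.integral_sub (intervalIntegrable_slice hF r s _)
    (intervalIntegrable_slice hG r s _)]
  exact intervalIntegral.integral_sub ((continuous_integral_slice hF r s).intervalIntegrable _ _)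
    ((continuous_integral_slice hG r s).intervalIntegrable _ _)

theorem norm_rectInt_le (h1 : ∀ x, ‖F x‖ ≤ 1) (p q r s : ℝ) :
    ‖rectInt p q r s F‖ ≤ |s - r| * |q - p| :=
  intervalIntegral.norm_integral_le_of_norm_le_const fun x _ => by
    simpa using intervalIntegral.norm_integral_le_of_norm_le_const (a := r) (b := s) (C := 1)
      (f := fun y => F (x, y)) fun y _ => h1 _

theorem rectInt_eq_setIntegral (hF : Continuous F) (hpq : p ≤ q) (hrs : r ≤ s) :
    rectInt p q r s F = ∫ x in Ioc p q ×ˢ Ioc r s, F x := by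
  have hint : IntegrableOn F (Ioc p q ×ˢ Ioc r s) :=
    (hF.continuousOn.integrableOn_compact (isCompact_Icc.prod isCompact_Icc)).mono_set
      (prod_mono Ioc_subset_Icc_self Ioc_subset_Icc_self)
  rw [Measure.volume_eq_prod] at hint ⊢
  rw [setIntegral_prod _ hint, rectInt, intervalIntegral.integral_of_le hpq]
  simp only [intervalIntegral.integral_of_le hrs]

theorem sum_integral_equal_intervals {f : ℝ → E} (hf : Continuous f) (p d : ℝ) (k : ℕ) :
    ∑ i ∈ Finset.range k, ∫ x in (p + i * d)..(p + i * d + d), f x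
      = ∫ x in p..(p + k * d), f x := by
  simpa [add_mul, ← add_assoc] using intervalIntegral.sum_integral_adjacent_intervals
    (μ := volume) (f := f) (a := fun i : ℕ => p + i * d) (n := k)
    fun _ _ => hf.intervalIntegrable _ _

theorem sum_rectInt_cells (hF : Continuous F) (p r d : ℝ) (k : ℕ) :
    ∑ i ∈ Finset.range k, ∑ j ∈ Finset.range k,
      rectInt (p + i * d) (p + i * d + d) (r + j * d) (r + j * d + d) F
      = rectInt p (p + k * d) r (r + k * d) F := by
  rw [rectInt, ← sum_integral_equal_intervals (continuous_integral_slice hF _ _)]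
  refine Finset.sum_congr rfl fun i _ => ?_
  have cells (x : ℝ) : ∫ y in r..(r + k * d), F (x, y)
      = ∑ j ∈ Finset.range k, ∫ y in (r + j * d)..(r + j * d + d), F (x, y) :=
    (sum_integral_equal_intervals (hF.comp (Continuous.prodMk_right x)) r d k).symm
  simp only [rectInt, cells]
  exact (intervalIntegral.integral_finsetSum fun j _ =>
    (continuous_integral_slice hF _ _).intervalIntegrable _ _).symm

end Interval

theorem IsTest.hasDerivAt_fst (h : IsTest U ψ) (x y : ℝ) :
    HasDerivAt (fun x => ψ (x, y)) (fderiv ℝ ψ (x, y) (1, 0)) x :=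
  (h.differentiable (x, y)).hasFDerivAt.comp_hasDerivAt x
    ((hasDerivAt_id x).prodMk (hasDerivAt_const x y))

theorem IsTest.hasDerivAt_snd (h : IsTest U ψ) (x y : ℝ) :
    HasDerivAt (fun y => ψ (x, y)) (fderiv ℝ ψ (x, y) (0, 1)) y :=
  (h.differentiable (x, y)).hasFDerivAt.comp_hasDerivAt y
    ((hasDerivAt_const y x).prodMk (hasDerivAt_id y))

theorem IsTest.hasDerivAt_integral_slice (h : IsTest U ψ) (r s x : ℝ) :
    HasDerivAt (fun x => ∫ y in r..s, ψ (x, y)) (∫ y in r..s, fderiv ℝ ψ (x, y) (1, 0)) x := by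
  have cD := h.continuous_fderiv_apply (1, 0)
  obtain ⟨M, hM⟩ := (h.compact.fderiv_apply ℝ (1, 0)).exists_bound_of_continuous cD
  exact (intervalIntegral.hasDerivAt_integral_of_dominated_loc_of_deriv_le univ_mem
    (Eventually.of_forall fun x =>
      (h.continuous.comp (Continuous.prodMk_right x)).aestronglyMeasurable)
    (intervalIntegrable_slice h.continuous r s x)
    (cD.comp (Continuous.prodMk_right x)).aestronglyMeasurable
    (ae_of_all _ fun y _ z _ => hM (z, y)) intervalIntegrable_const
    (ae_of_all _ fun y _ z _ => h.hasDerivAt_fst z y)).2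

theorem IsTest.integral_sq_norm_integral_slice_le (h : IsTest U ψ) {p q r s : ℝ} (hpq : p < q)
    (hrs : r < s) :
    ∫ x in p..q, ‖∫ y in r..s, ψ (x, y)‖ ^ 2
      ≤ 2 / (q - p) * ‖rectInt p q r s ψ‖ ^ 2 + 2 * (q - p) ^ 2 *
        ((s - r) * rectInt p q r s fun x => ‖fderiv ℝ ψ x (1, 0)‖ ^ 2) := by
  have cD := h.continuous_fderiv_apply (1, 0)
  refine (poincare_interval (h.hasDerivAt_integral_slice r s)
    (continuous_integral_slice cD r s) hpq).trans ?_
  unfold rectInt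
  rw [← intervalIntegral.integral_const_mul (s - r)]
  gcongr
  exact intervalIntegral.integral_mono_on hpq.le
    (((continuous_integral_slice cD r s).norm.pow 2).intervalIntegrable _ _)
    (((continuous_integral_slice (cD.norm.pow 2) r s).const_mul _).intervalIntegrable _ _)
    fun x _ => sq_norm_intervalIntegral_le (cD.comp (Continuous.prodMk_right x)) hrs

theorem IsTest.poincare_rect (h : IsTest U ψ) {p q r s : ℝ} (hpq : p < q) (hrs : r < s) :
    rectInt p q r s (fun x => ‖ψ x‖ ^ 2)
      ≤ 4 / ((q - p) * (s - r)) * ‖rectInt p q r s ψ‖ ^ 2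
        + 4 * (q - p) ^ 2 * (rectInt p q r s fun x => ‖fderiv ℝ ψ x (1, 0)‖ ^ 2)
        + 2 * (s - r) ^ 2 * (rectInt p q r s fun x => ‖fderiv ℝ ψ x (0, 1)‖ ^ 2) := by
  have hpq' : 0 < q - p := sub_pos.2 hpq
  have hrs' : 0 < s - r := sub_pos.2 hrs
  have cD := h.continuous_fderiv_apply (0, 1)
  have cG : Continuous fun x => 2 / (s - r) * ‖∫ y in r..s, ψ (x, y)‖ ^ 2 :=
    ((continuous_integral_slice h.continuous r s).norm.pow 2).const_mul _
  have cD' : Continuous fun x =>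
      2 * (s - r) ^ 2 * ∫ y in r..s, ‖fderiv ℝ ψ (x, y) (0, 1)‖ ^ 2 :=
    (continuous_integral_slice (cD.norm.pow 2) r s).const_mul _
  calc rectInt p q r s (fun x => ‖ψ x‖ ^ 2)
      ≤ ∫ x in p..q, (2 / (s - r) * ‖∫ y in r..s, ψ (x, y)‖ ^ 2
          + 2 * (s - r) ^ 2 * ∫ y in r..s, ‖fderiv ℝ ψ (x, y) (0, 1)‖ ^ 2) :=
        intervalIntegral.integral_mono_on hpq.le
          ((continuous_integral_slice (h.continuous.norm.pow 2) r s).intervalIntegrable _ _)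
          ((cG.add cD').intervalIntegrable _ _) fun x _ =>
          poincare_interval (h.hasDerivAt_snd x) (cD.comp (Continuous.prodMk_right x)) hrs
    _ = 2 / (s - r) * (∫ x in p..q, ‖∫ y in r..s, ψ (x, y)‖ ^ 2)
        + 2 * (s - r) ^ 2 * (rectInt p q r s fun x => ‖fderiv ℝ ψ x (0, 1)‖ ^ 2) := by
        rw [intervalIntegral.integral_add (cG.intervalIntegrable _ _) (cD'.intervalIntegrable _ _),
          intervalIntegral.integral_const_mul, intervalIntegral.integral_const_mul, rectInt]
    _ ≤ 2 / (s - r) * (2 / (q - p) * ‖rectInt p q r s ψ‖ ^ 2 + 2 * (q - p) ^ 2 *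
          ((s - r) * rectInt p q r s fun x => ‖fderiv ℝ ψ x (1, 0)‖ ^ 2))
        + 2 * (s - r) ^ 2 * (rectInt p q r s fun x => ‖fderiv ℝ ψ x (0, 1)‖ ^ 2) := by
        gcongr
        exact h.integral_sq_norm_integral_slice_le hpq hrs
    _ = _ := by
        field_simp
        ring

/-! ### Compactness in `L²` -/

section Sub

variable {f g : ℝ × ℝ → ℂ}

theorem IsTest.sub (hf : IsTest U f) (hg : IsTest U g) : IsTest U fun x => f x - g x := by
  simpa only [sub_eq_add_neg] using hf.add (hg.comp_left contDiff_neg neg_zero)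

theorem IsTest.covDerivSmooth_sub (hf : IsTest U f) (hg : IsTest U g) (a : ℝ) (j : Fin 2)
    (x : ℝ × ℝ) : covDerivSmooth a j (fun x => f x - g x) x
      = covDerivSmooth a j f x - covDerivSmooth a j g x := by
  simp only [covDerivSmooth, fderiv_fun_sub (hf.differentiable x) (hg.differentiable x),
    sub_apply]
  ring

theorem IsTest.covGradSqSmooth_sub_le (hf : IsTest U f) (hg : IsTest U g) (a : ℝ) (x : ℝ × ℝ) :
    covGradSqSmooth a (fun x => f x - g x) x
      ≤ 2 * covGradSqSmooth a f x + 2 * covGradSqSmooth a g x := by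
  simp only [covGradSqSmooth_eq, hf.covDerivSmooth_sub hg]
  linarith [norm_sub_sq_le (covDerivSmooth a 0 f x) (covDerivSmooth a 0 g x),
    norm_sub_sq_le (covDerivSmooth a 1 f x) (covDerivSmooth a 1 g x)]

theorem integral_le_two_mul_add {α : Type*} [MeasurableSpace α] {μ : Measure α} {u v w : α → ℝ}
    (hu : Integrable u μ) (hv : Integrable v μ) (hw : Integrable w μ)
    (h : ∀ x, w x ≤ 2 * u x + 2 * v x) :
    ∫ x, w x ∂μ ≤ 2 * (∫ x, u x ∂μ) + 2 * ∫ x, v x ∂μ := by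
  have hu2 : Integrable (fun x => 2 * u x) μ := hu.const_mul 2
  have hv2 : Integrable (fun x => 2 * v x) μ := hv.const_mul 2
  rw [← integral_const_mul, ← integral_const_mul, ← integral_add hu2 hv2]
  exact integral_mono hw (hu2.add hv2) h

theorem IsTest.integral_covGradSqSmooth_sub_le (hf : IsTest U f) (hg : IsTest U g) (a : ℝ) :
    ∫ x, covGradSqSmooth a (fun x => f x - g x) x
      ≤ 2 * (∫ x, covGradSqSmooth a f x) + 2 * ∫ x, covGradSqSmooth a g x :=
  integral_le_two_mul_add (hf.integrable_covGradSqSmooth a) (hg.integrable_covGradSqSmooth a)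
    ((hf.sub hg).integrable_covGradSqSmooth a) (hf.covGradSqSmooth_sub_le hg a)

theorem IsTest.setIntegral_normSq_sub_le (hf : IsTest U f) (hg : IsTest U g) (S : Set (ℝ × ℝ)) :
    ∫ x in S, ‖f x - g x‖ ^ 2 ≤ 2 * (∫ x in S, ‖f x‖ ^ 2) + 2 * ∫ x in S, ‖g x‖ ^ 2 :=
  integral_le_two_mul_add hf.integrable_normSq.integrableOn hg.integrable_normSq.integrableOn
    (hf.sub hg).integrable_normSq.integrableOn fun _ => norm_sub_sq_le _ _

theorem IsTest.integral_normSq_sub_le (hf : IsTest U f) (hg : IsTest U g) :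
    ∫ x, ‖f x - g x‖ ^ 2 ≤ 2 * (∫ x, ‖f x‖ ^ 2) + 2 * ∫ x, ‖g x‖ ^ 2 := by
  simpa only [setIntegral_univ] using hf.setIntegral_normSq_sub_le hg univ

end Sub

theorem IsTest.fderiv_apply (h : IsTest U ψ) (v : ℝ × ℝ) : IsTest U fun x => fderiv ℝ ψ x v :=
  h.of_tsupport_subset (h.contDiff_fderiv_apply v) (tsupport_fderiv_apply_subset ℝ v)

theorem sq_norm_fderiv_le (a : ℝ) (ψ : ℝ × ℝ → ℂ) {N : ℝ} {x : ℝ × ℝ} (hx : |x.2| ≤ N) :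
    ‖fderiv ℝ ψ x (1, 0)‖ ^ 2 + ‖fderiv ℝ ψ x (0, 1)‖ ^ 2
      ≤ 2 * covGradSqSmooth a ψ x + 2 * (max 1 |a| * N) ^ 2 * ‖ψ x‖ ^ 2 := by
  have split : fderiv ℝ ψ x (1, 0)
      = covDerivSmooth a 0 ψ x - Complex.I * (stepPotential a x.2 : ℝ) * ψ x := by
    rw [covDerivSmooth_zero]
    ring
  have potential :
      ‖Complex.I * (stepPotential a x.2 : ℝ) * ψ x‖ ^ 2 ≤ (max 1 |a| * N) ^ 2 * ‖ψ x‖ ^ 2 := by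
    rw [norm_mul, norm_mul, Complex.norm_I, one_mul, Complex.norm_real, Real.norm_eq_abs, mul_pow]
    gcongr
    exact (abs_stepPotential_le a _).trans (by gcongr)
  rw [split, covGradSqSmooth_eq, ← covDerivSmooth_one a]
  linarith [norm_sub_sq_le (covDerivSmooth a 0 ψ x) (Complex.I * (stepPotential a x.2 : ℝ) * ψ x),
    sq_nonneg ‖covDerivSmooth a 1 ψ x‖]

/-- The square `(-N, N]²`. -/
def square (N : ℝ) : Set (ℝ × ℝ) := Ioc (-N) N ×ˢ Ioc (-N) N

theorem measurableSet_square (N : ℝ) : MeasurableSet (square N) :=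
  measurableSet_Ioc.prod measurableSet_Ioc

/-- The integral of `F` over the cell `(i, j)` of the subdivision of `square N` into `k²` cells. -/
def cellInt {E : Type*} [NormedAddCommGroup E] [NormedSpace ℝ E] (N : ℝ) (k i j : ℕ)
    (F : ℝ × ℝ → E) : E :=
  rectInt (-N + i * (2 * N / k)) (-N + i * (2 * N / k) + 2 * N / k)
    (-N + j * (2 * N / k)) (-N + j * (2 * N / k) + 2 * N / k) F

theorem norm_cellInt_le (h1 : ∀ x, ‖ψ x‖ ≤ 1) (N : ℝ) (k i j : ℕ) :
    ‖cellInt N k i j ψ‖ ≤ |2 * N / k| * |2 * N / k| := by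
  have hrect := norm_rectInt_le h1 (-N + i * (2 * N / k)) (-N + i * (2 * N / k) + 2 * N / k)
    (-N + j * (2 * N / k)) (-N + j * (2 * N / k) + 2 * N / k)
  simpa only [add_sub_cancel_left, cellInt] using hrect

theorem setIntegral_square_eq_sum {E : Type*} [NormedAddCommGroup E] [NormedSpace ℝ E]
    {F : ℝ × ℝ → E} (hF : Continuous F) {N : ℝ} (hN : 0 ≤ N) {k : ℕ}
    (hk : k ≠ 0) :
    ∫ x in square N, F x
      = ∑ i ∈ Finset.range k, ∑ j ∈ Finset.range k, cellInt N k i j F := by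
  have right_end : -N + k * (2 * N / k) = N := by
    field_simp
    ring
  simp only [cellInt]
  rw [sum_rectInt_cells hF, right_end,
    rectInt_eq_setIntegral hF (neg_le_self hN) (neg_le_self hN), square]

theorem IsTest.poincare_cell (h : IsTest U ψ) {N : ℝ} (hN : 0 < N) {k : ℕ} (hk : k ≠ 0)
    (i j : ℕ) :
    cellInt N k i j (fun x => ‖ψ x‖ ^ 2)
      ≤ 4 / (2 * N / k) ^ 2 * ‖cellInt N k i j ψ‖ ^ 2 + 4 * (2 * N / k) ^ 2 *
        (cellInt N k i j (fun x => ‖fderiv ℝ ψ x (1, 0)‖ ^ 2)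
          + cellInt N k i j fun x => ‖fderiv ℝ ψ x (0, 1)‖ ^ 2) := by
  have hd : 0 < 2 * N / k := by positivity
  have hrect := h.poincare_rect (p := -N + i * (2 * N / k)) (r := -N + j * (2 * N / k))
    (lt_add_of_pos_right _ hd) (lt_add_of_pos_right _ hd)
  simp only [add_sub_cancel_left] at hrect
  have hnonneg : 0 ≤ (2 * N / k) ^ 2 * cellInt N k i j fun x => ‖fderiv ℝ ψ x (0, 1)‖ ^ 2 :=
    mul_nonneg (sq_nonneg _) <| intervalIntegral.integral_nonneg (by linarith) fun x _ =>
      intervalIntegral.integral_nonneg (by linarith) fun y _ => by positivity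
  rw [sq (2 * N / k)] at hnonneg ⊢
  simp only [cellInt] at hnonneg ⊢
  linarith

theorem IsTest.setIntegral_square_fderiv_le (h : IsTest U ψ) (a N : ℝ) :
    (∫ x in square N, ‖fderiv ℝ ψ x (1, 0)‖ ^ 2) + ∫ x in square N, ‖fderiv ℝ ψ x (0, 1)‖ ^ 2
      ≤ 2 * (∫ x, covGradSqSmooth a ψ x) + 2 * (max 1 |a| * N) ^ 2 * ∫ x, ‖ψ x‖ ^ 2 := by
  have iD v := (h.fderiv_apply v).integrable_normSq
  have i1 : Integrable fun x => 2 * covGradSqSmooth a ψ x :=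
    (h.integrable_covGradSqSmooth a).const_mul 2
  have i2 : Integrable fun x => 2 * (max 1 |a| * N) ^ 2 * ‖ψ x‖ ^ 2 :=
    h.integrable_normSq.const_mul _
  rw [← integral_const_mul, ← integral_const_mul, ← integral_add i1 i2,
    ← integral_add (iD _).integrableOn (iD _).integrableOn]
  refine (setIntegral_mono_on ((iD _).add (iD _)).integrableOn (i1.add i2).integrableOn
    (measurableSet_square N) fun x hx =>
      sq_norm_fderiv_le a ψ (abs_le.2 ⟨hx.2.1.le, hx.2.2⟩)).trans ?_
  refine setIntegral_le_integral (i1.add i2) (ae_of_all _ fun x => ?_)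
  have := covGradSqSmooth_nonneg a ψ x
  simp only [Pi.zero_apply, Pi.add_apply]
  positivity

theorem IsTest.setIntegral_square_le (h : IsTest U ψ) (a : ℝ) {N : ℝ} (hN : 0 < N) {k : ℕ}
    (hk : k ≠ 0) :
    ∫ x in square N, ‖ψ x‖ ^ 2
      ≤ 4 / (2 * N / k) ^ 2
          * (∑ i ∈ Finset.range k, ∑ j ∈ Finset.range k, ‖cellInt N k i j ψ‖ ^ 2)
        + 4 * (2 * N / k) ^ 2
          * (2 * (∫ x, covGradSqSmooth a ψ x) + 2 * (max 1 |a| * N) ^ 2 * ∫ x, ‖ψ x‖ ^ 2) := by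
  have cψ : Continuous fun x => ‖ψ x‖ ^ 2 := h.continuous.norm.pow 2
  have cD v : Continuous fun x => ‖fderiv ℝ ψ x v‖ ^ 2 := (h.fderiv_apply v).continuous.norm.pow 2
  calc ∫ x in square N, ‖ψ x‖ ^ 2
      ≤ ∑ i ∈ Finset.range k, ∑ j ∈ Finset.range k,
          (4 / (2 * N / k) ^ 2 * ‖cellInt N k i j ψ‖ ^ 2 + 4 * (2 * N / k) ^ 2 *
            (cellInt N k i j (fun x => ‖fderiv ℝ ψ x (1, 0)‖ ^ 2)
              + cellInt N k i j fun x => ‖fderiv ℝ ψ x (0, 1)‖ ^ 2)) := by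
        rw [setIntegral_square_eq_sum cψ hN.le hk]
        exact Finset.sum_le_sum fun i _ => Finset.sum_le_sum fun j _ => h.poincare_cell hN hk i j
    _ = 4 / (2 * N / k) ^ 2
          * (∑ i ∈ Finset.range k, ∑ j ∈ Finset.range k, ‖cellInt N k i j ψ‖ ^ 2)
        + 4 * (2 * N / k) ^ 2 * ((∫ x in square N, ‖fderiv ℝ ψ x (1, 0)‖ ^ 2)
          + ∫ x in square N, ‖fderiv ℝ ψ x (0, 1)‖ ^ 2) := by
        simp only [setIntegral_square_eq_sum (cD _) hN.le hk,
          Finset.mul_sum, Finset.sum_add_distrib, mul_add]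
    _ ≤ _ := by
        gcongr _ + _ * ?_
        exact h.setIntegral_square_fderiv_le a N

theorem IsTest.setIntegral_compl_square_le {R N : ℝ} (h : IsTest (strip R) ψ) (hRN : R / 2 ≤ N) :
    ∫ x in (square N)ᶜ, ‖ψ x‖ ^ 2 ≤ ∫ x in {x : ℝ × ℝ | N ≤ |x.2|}, ‖ψ x‖ ^ 2 := by
  rw [← integral_indicator (measurableSet_square N).compl,
    ← integral_indicator (measurableSet_far N)]
  refine integral_mono (h.integrable_normSq.indicator (measurableSet_square N).compl)
    (h.integrable_normSq.indicator (measurableSet_far N)) fun x => ?_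
  have nonneg (y : ℝ × ℝ) : 0 ≤ Set.indicator {x : ℝ × ℝ | N ≤ |x.2|} (fun x => ‖ψ x‖ ^ 2) y :=
    Set.indicator_nonneg (fun _ _ => by positivity) y
  refine Set.indicator_le' (fun x hx => ?_) (fun x _ => nonneg x) x
  by_cases hfar : N ≤ |x.2|
  · exact (Set.indicator_of_mem (s := {x : ℝ × ℝ | N ≤ |x.2|}) hfar fun x => ‖ψ x‖ ^ 2).ge
  have hψ : ψ x = 0 := by
    by_contra h0
    have hx1 := (h.supp (subset_tsupport _ h0)).1
    have hx2 := abs_lt.1 (not_le.1 hfar)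
    exact hx ⟨⟨by linarith [hx1.1], by linarith [hx1.2]⟩, hx2.1, hx2.2.le⟩
  simpa only [hψ, norm_zero, zero_pow two_ne_zero] using nonneg x

theorem IsTest.integral_normSq_le_cells {R N : ℝ} (h : IsTest (strip R) ψ) (a : ℝ) (hN : 0 < N)
    (hRN : R / 2 ≤ N) {k : ℕ} (hk : k ≠ 0) :
    ∫ x, ‖ψ x‖ ^ 2
      ≤ 4 / (2 * N / k) ^ 2
          * (∑ i ∈ Finset.range k, ∑ j ∈ Finset.range k, ‖cellInt N k i j ψ‖ ^ 2)
        + 4 * (2 * N / k) ^ 2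
          * (2 * (∫ x, covGradSqSmooth a ψ x) + 2 * (max 1 |a| * N) ^ 2 * ∫ x, ‖ψ x‖ ^ 2)
        + ∫ x in {x : ℝ × ℝ | N ≤ |x.2|}, ‖ψ x‖ ^ 2 := by
  rw [← integral_add_compl (measurableSet_square N) h.integrable_normSq]
  exact add_le_add (by
    rw [integral_add_compl (measurableSet_square N) h.integrable_normSq]
    exact h.setIntegral_square_le a hN hk) (h.setIntegral_compl_square_le hRN)

theorem exists_subseq_forall_cauchySeq {ι E : Type*} [Countable ι] [NormedAddCommGroup E]
    [ProperSpace E] {Φ : ℕ → ι → E} {B : ι → ℝ} (hΦ : ∀ n i, ‖Φ n i‖ ≤ B i) :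
    ∃ s : ℕ → ℕ, StrictMono s ∧ ∀ i, CauchySeq fun n => Φ (s n) i := by
  obtain ⟨ξ, -, s, hs, hlim⟩ := (isCompact_univ_pi fun i =>
    isCompact_closedBall (0 : E) (B i)).tendsto_subseq fun n i _ =>
      mem_closedBall_zero_iff.2 (hΦ n i)
  exact ⟨s, hs, fun i => (tendsto_pi_nhds.1 hlim i).cauchySeq⟩

section Rellich

variable {a R M : ℝ} {ψ : ℕ → ℝ × ℝ → ℂ}

theorem tendsto_sum_cellInt_sub_sq {U : Set (ℝ × ℝ)} (hT : ∀ n, IsTest U (ψ n)) {N : ℝ} {k : ℕ}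
    (hcells : ∀ i j, CauchySeq fun n => cellInt N k i j (ψ n)) :
    Tendsto (fun q : ℕ × ℕ => ∑ i ∈ Finset.range k, ∑ j ∈ Finset.range k,
      ‖cellInt N k i j fun x => ψ q.1 x - ψ q.2 x‖ ^ 2) atTop (𝓝 0) := by
  have hcell (i j : ℕ) : Tendsto (fun q : ℕ × ℕ =>
      ‖cellInt N k i j fun x => ψ q.1 x - ψ q.2 x‖ ^ 2) atTop (𝓝 0) := by
    have h := (cauchySeq_iff_tendsto_dist_atTop_0.1 (hcells i j)).pow 2
    simp only [dist_eq_norm, zero_pow two_ne_zero] at h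
    refine h.congr fun q => ?_
    simp only [cellInt, rectInt_sub (hT q.1).continuous (hT q.2).continuous]
  simpa using tendsto_finsetSum (Finset.range k) fun i _ =>
    tendsto_finsetSum (Finset.range k) fun j _ => hcell i j

theorem eventually_integral_normSq_sub_le (hT : ∀ n, IsTest (strip R) (ψ n))
    (hG : ∀ n, ∫ x, covGradSqSmooth a (ψ n) x ≤ M) (hN : ∀ n, ∫ x, ‖ψ n x‖ ^ 2 ≤ M)
    (htight : ∀ ε > 0, ∀ᶠ N : ℕ in atTop, ∀ n,
      ∫ x in {x : ℝ × ℝ | (N : ℝ) ≤ |x.2|}, ‖ψ n x‖ ^ 2 ≤ ε)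
    (hcells : ∀ N k i j : ℕ, CauchySeq fun n => cellInt N k i j (ψ n)) {ε : ℝ} (hε : 0 < ε) :
    ∀ᶠ q : ℕ × ℕ in atTop, ∫ x, ‖ψ q.1 x - ψ q.2 x‖ ^ 2 ≤ ε := by
  obtain ⟨N, hfar, hN0, hRN⟩ := ((htight (ε / 12) (by positivity)).and
    ((eventually_gt_atTop 0).and (eventually_ge_atTop ⌈R / 2⌉₊))).exists
  have hRN' : R / 2 ≤ N := (Nat.le_ceil _).trans (Nat.cast_le.2 hRN)
  have hN0' : (0 : ℝ) < N := Nat.cast_pos.2 hN0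
  set B := 2 * (4 * M) + 2 * (max 1 |a| * N) ^ 2 * (4 * M) with hB
  have hmesh : Tendsto (fun k : ℕ => 4 * (2 * N / k : ℝ) ^ 2 * B) atTop (𝓝 0) := by
    simpa using (((tendsto_const_div_atTop_nhds_zero_nat (2 * N : ℝ)).pow 2).const_mul
      4).mul_const B
  obtain ⟨k, hk, hk0⟩ := ((hmesh.eventually_le_const (by positivity : 0 < ε / 3)).and
    (eventually_ne_atTop 0)).exists
  have hsum := (tendsto_sum_cellInt_sub_sq hT (hcells N k)).const_mul (4 / (2 * N / k : ℝ) ^ 2)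
  rw [mul_zero] at hsum
  filter_upwards [hsum.eventually_le_const (by positivity : 0 < ε / 3)] with q hq
  have hL2 : ∫ x, ‖ψ q.1 x - ψ q.2 x‖ ^ 2 ≤ 4 * M := by
    linarith [(hT q.1).integral_normSq_sub_le (hT q.2), hN q.1, hN q.2]
  have hgrad : ∫ x, covGradSqSmooth a (fun x => ψ q.1 x - ψ q.2 x) x ≤ 4 * M := by
    linarith [(hT q.1).integral_covGradSqSmooth_sub_le (hT q.2) a, hG q.1, hG q.2]
  have htail : ∫ x in {x : ℝ × ℝ | (N : ℝ) ≤ |x.2|}, ‖ψ q.1 x - ψ q.2 x‖ ^ 2 ≤ ε / 3 := by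
    linarith [(hT q.1).setIntegral_normSq_sub_le (hT q.2) {x : ℝ × ℝ | (N : ℝ) ≤ |x.2|},
      hfar q.1, hfar q.2]
  have hosc : 4 * (2 * N / k : ℝ) ^ 2
      * (2 * (∫ x, covGradSqSmooth a (fun x => ψ q.1 x - ψ q.2 x) x)
        + 2 * (max 1 |a| * N) ^ 2 * ∫ x, ‖ψ q.1 x - ψ q.2 x‖ ^ 2) ≤ ε / 3 := by
    refine le_trans ?_ hk
    rw [hB]
    gcongr
  linarith [((hT q.1).sub (hT q.2)).integral_normSq_le_cells a hN0' hRN' hk0]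

theorem exists_subseq_tendsto_integral_normSq_sub (hT : ∀ n, IsTest (strip R) (ψ n))
    (h1 : ∀ n x, ‖ψ n x‖ ≤ 1) (hG : ∀ n, ∫ x, covGradSqSmooth a (ψ n) x ≤ M)
    (hN : ∀ n, ∫ x, ‖ψ n x‖ ^ 2 ≤ M)
    (htight : ∀ ε > 0, ∀ᶠ N : ℕ in atTop, ∀ n,
      ∫ x in {x : ℝ × ℝ | (N : ℝ) ≤ |x.2|}, ‖ψ n x‖ ^ 2 ≤ ε) :
    ∃ s : ℕ → ℕ, StrictMono s ∧ Tendsto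
      (fun q : ℕ × ℕ => ∫ x, ‖ψ (s q.1) x - ψ (s q.2) x‖ ^ 2) atTop (𝓝 0) := by
  obtain ⟨s, hs, hcells⟩ := exists_subseq_forall_cauchySeq (ι := ℕ × ℕ × ℕ × ℕ)
    fun n q => norm_cellInt_le (h1 n) q.1 q.2.1 q.2.2.1 q.2.2.2
  refine ⟨s, hs, Metric.tendsto_nhds.2 fun ε hε => ?_⟩
  filter_upwards [eventually_integral_normSq_sub_le (a := a) (fun n => hT (s n))
    (fun n => hG (s n)) (fun n => hN (s n)) (fun δ hδ => (htight δ hδ).mono fun N h n => h (s n))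
    (fun N k i j => hcells (N, k, i, j)) (half_pos hε)] with q hq
  rw [Real.dist_eq, sub_zero, abs_of_nonneg (integral_nonneg fun x => by positivity)]
  linarith

end Rellich

/-! ### Convergence in `Lᵖ` -/

section Lp

variable {α : Type*} [MeasurableSpace α] {μ : Measure α} {f : ℕ → α → ℂ} {u g : α → ℂ}
  {p : ℕ} [NeZero p]

theorem fact_one_le_natCast : Fact (1 ≤ (p : ℝ≥0∞)) :=
  ⟨Nat.one_le_cast.2 (Nat.one_le_iff_ne_zero.2 (NeZero.ne p))⟩

attribute [local instance] fact_one_le_natCast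

theorem norm_toLp_pow (hu : MemLp u p μ) : ‖hu.toLp u‖ ^ p = ∫ x, ‖u x‖ ^ p ∂μ := by
  have h : eLpNorm u p μ ^ p = ∫⁻ x, ‖u x‖ₑ ^ p ∂μ := by
    simpa using eLpNorm_nnreal_pow_eq_lintegral (μ := μ) (f := u) (p := p)
      (Nat.cast_ne_zero.2 (NeZero.ne p))
  have meas : AEStronglyMeasurable (fun x => ‖u x‖ ^ p) μ := hu.1.norm.pow p
  rw [Lp.norm_toLp, ← ENNReal.toReal_pow, h, integral_eq_lintegral_of_nonneg_ae
    (ae_of_all _ fun x => by simp only [Pi.zero_apply]; positivity) meas]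
  simp only [ENNReal.ofReal_pow (norm_nonneg _), ofReal_norm]

theorem cauchySeq_toLp_iff (hf : ∀ n, MemLp (f n) p μ) :
    CauchySeq (fun n => (hf n).toLp (f n)) ↔
      Tendsto (fun q : ℕ × ℕ => ∫ x, ‖f q.1 x - f q.2 x‖ ^ p ∂μ) atTop (𝓝 0) := by
  have hdist (q : ℕ × ℕ) : ∫ x, ‖f q.1 x - f q.2 x‖ ^ p ∂μ
      = dist ((hf q.1).toLp (f q.1)) ((hf q.2).toLp (f q.2)) ^ p := by
    rw [dist_eq_norm, ← MemLp.toLp_sub, norm_toLp_pow]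
    rfl
  simp only [cauchySeq_iff_tendsto_dist_atTop_0, hdist]
  refine ⟨fun h => by simpa only [zero_pow (NeZero.ne p)] using h.pow p, fun h => ?_⟩
  have hroot := h.rpow_const (p := (p : ℝ)⁻¹) (Or.inr (by positivity))
  rw [Real.zero_rpow (inv_ne_zero (Nat.cast_ne_zero.2 (NeZero.ne p)))] at hroot
  exact hroot.congr fun q => Real.pow_rpow_inv_natCast dist_nonneg (NeZero.ne p)

theorem exists_tendsto_eLpNorm (hf : ∀ n, MemLp (f n) p μ)
    (hc : Tendsto (fun q : ℕ × ℕ => ∫ x, ‖f q.1 x - f q.2 x‖ ^ p ∂μ) atTop (𝓝 0)) :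
    ∃ u, MemLp u p μ ∧ Tendsto (fun n => eLpNorm (f n - u) p μ) atTop (𝓝 0) := by
  obtain ⟨F, hF⟩ := cauchySeq_tendsto_of_complete ((cauchySeq_toLp_iff hf).2 hc)
  refine ⟨F, Lp.memLp F, ?_⟩
  rwa [← Lp.tendsto_Lp_iff_tendsto_eLpNorm'' f hf F (Lp.memLp F), Lp.toLp_coeFn]

theorem tendsto_integral_norm_sub_pow (hf : ∀ n, MemLp (f n) p μ)
    (hu : MemLp u p μ) (h : Tendsto (fun n => eLpNorm (f n - u) p μ) atTop (𝓝 0)) :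
    Tendsto (fun q : ℕ × ℕ => ∫ x, ‖f q.1 x - f q.2 x‖ ^ p ∂μ) atTop (𝓝 0) :=
  (cauchySeq_toLp_iff hf).1 ((Lp.tendsto_Lp_iff_tendsto_eLpNorm'' f hf u hu).2 h).cauchySeq

theorem tendsto_integral_norm_pow (hf : ∀ n, MemLp (f n) p μ)
    (hu : MemLp u p μ) (h : Tendsto (fun n => eLpNorm (f n - u) p μ) atTop (𝓝 0)) :
    Tendsto (fun n => ∫ x, ‖f n x‖ ^ p ∂μ) atTop (𝓝 (∫ x, ‖u x‖ ^ p ∂μ)) := by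
  simpa only [norm_toLp_pow] using
    ((Lp.tendsto_Lp_iff_tendsto_eLpNorm'' f hf u hu).2 h).norm.pow p

theorem tendsto_integral_mul (hf : ∀ n, MemLp (f n) 2 μ) (hu : MemLp u 2 μ) (hg : MemLp g 2 μ)
    (h : Tendsto (fun n => eLpNorm (f n - u) 2 μ) atTop (𝓝 0)) :
    Tendsto (fun n => ∫ x, g x * f n x ∂μ) atTop (𝓝 (∫ x, g x * u x ∂μ)) := by
  have holder (n : ℕ) : eLpNorm ((fun x => g x * f n x) - fun x => g x * u x) 1 μ
      ≤ eLpNorm g 2 μ * eLpNorm (f n - u) 2 μ := by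
    have factor : ((fun x => g x * f n x) - fun x => g x * u x) = g • (f n - u) := by
      ext x
      simp [mul_sub]
    rw [factor]
    exact eLpNorm_smul_le_mul_eLpNorm ((hf n).1.sub hu.1) hg.1
  refine tendsto_integral_of_L1' _ (hg.integrable_mul hu).1
    (Eventually.of_forall fun n => hg.integrable_mul (hf n))
    (tendsto_of_tendsto_of_tendsto_of_le_of_le tendsto_const_nhds ?_ (fun _ => zero_le) holder)
  simpa only [mul_zero] using ENNReal.Tendsto.const_mul h (Or.inr hg.2.ne)

end Lp

theorem measurableSet_strip (R : ℝ) : MeasurableSet (strip R) :=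
  measurableSet_Ioo.prod MeasurableSet.univ

theorem isOpen_strip (R : ℝ) : IsOpen (strip R) := isOpen_Ioo.prod isOpen_univ

theorem IsTest.memLp (h : IsTest U ψ) (p : ℝ≥0∞) (μ : Measure (ℝ × ℝ))
    [IsFiniteMeasureOnCompacts μ] : MemLp ψ p μ :=
  h.continuous.memLp_of_hasCompactSupport h.compact

theorem IsTest.memLp_covDerivSmooth (h : IsTest U ψ) (a : ℝ) (j : Fin 2) (p : ℝ≥0∞)
    (μ : Measure (ℝ × ℝ)) [IsFiniteMeasureOnCompacts μ] : MemLp (covDerivSmooth a j ψ) p μ :=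
  (h.continuous_covDerivSmooth a j).memLp_of_hasCompactSupport
    (HasCompactSupport.intro h.compact fun _ hx =>
      covDerivSmooth_eq_zero_of_notMem_tsupport a j hx)

theorem IsTest.setIntegral_eq {E F : Type*} [NormedAddCommGroup E] [NormedSpace ℝ E]
    [NormedAddCommGroup F] [NormedSpace ℝ F] {ψ : ℝ × ℝ → F}
    (h : IsTest U ψ) {f : ℝ × ℝ → E} (h0 : ∀ x, x ∉ tsupport ψ → f x = 0) :
    ∫ x in U, f x = ∫ x, f x :=
  setIntegral_eq_integral_of_forall_compl_eq_zero fun x hx => h0 x fun h' => hx (h.supp h')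

theorem IsTest.setIntegral_norm_pow (h : IsTest U ψ) {p : ℕ} (hp : p ≠ 0) :
    ∫ x in U, ‖ψ x‖ ^ p = ∫ x, ‖ψ x‖ ^ p :=
  h.setIntegral_eq fun x hx => by simp [image_eq_zero_of_notMem_tsupport hx, hp]

theorem IsTest.integral_covGradSqSmooth (h : IsTest U ψ) (a : ℝ) :
    ∫ x, covGradSqSmooth a ψ x = ∑ j, ∫ x in U, ‖covDerivSmooth a j ψ x‖ ^ 2 := by
  rw [← h.setIntegral_eq fun x hx => covGradSqSmooth_eq_zero_of_notMem_tsupport a hx]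
  exact integral_finsetSum _ fun j _ =>
    (h.memLp_covDerivSmooth a j 2 _).integrable_norm_pow (p := 2) two_ne_zero

/-! ### A Ladyzhenskaya inequality -/

theorem IsTest.abs_fderiv_normSq_le (h : IsTest U ψ) (a : ℝ) (x : ℝ × ℝ) (j : Fin 2) :
    |fderiv ℝ (fun x => ‖ψ x‖ ^ 2) x (e j)| ≤ ‖ψ x‖ ^ 2 + ‖covDerivSmooth a j ψ x‖ ^ 2 := by
  rw [h.fderiv_normSq, ← real_inner_covDerivSmooth a j, abs_mul, abs_two]
  linarith [abs_real_inner_le_norm (ψ x) (covDerivSmooth a j ψ x),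
    two_mul_le_add_sq ‖ψ x‖ ‖covDerivSmooth a j ψ x‖]

theorem opNorm_le_abs_add_abs (T : ℝ × ℝ →L[ℝ] ℝ) : ‖T‖ ≤ |T (e 0)| + |T (e 1)| := by
  refine T.opNorm_le_bound (by positivity) fun v => ?_
  have expand : T v = v.1 * T (e 0) + v.2 * T (e 1) := by
    simp only [← smul_eq_mul, ← map_smul, ← map_add]
    congr 1
    ext <;> simp [e]
  calc ‖T v‖ ≤ |v.1| * |T (e 0)| + |v.2| * |T (e 1)| := by
        rw [expand, Real.norm_eq_abs, ← abs_mul, ← abs_mul]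
        exact abs_add_le _ _
    _ ≤ ‖v‖ * |T (e 0)| + ‖v‖ * |T (e 1)| := by
        gcongr
        exacts [norm_fst_le v, norm_snd_le v]
    _ = _ := by ring

theorem IsTest.norm_fderiv_normSq_le (h : IsTest U ψ) (a : ℝ) (x : ℝ × ℝ) :
    ‖fderiv ℝ (fun x => ‖ψ x‖ ^ 2) x‖ ≤ 2 * ‖ψ x‖ ^ 2 + covGradSqSmooth a ψ x := by
  rw [covGradSqSmooth_eq]
  linarith [opNorm_le_abs_add_abs (fderiv ℝ (fun x => ‖ψ x‖ ^ 2) x),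
    h.abs_fderiv_normSq_le a x 0, h.abs_fderiv_normSq_le a x 1]

theorem IsTest.lintegral_enorm_fderiv_normSq_le (h : IsTest U ψ) (a : ℝ) :
    ∫⁻ x, ‖fderiv ℝ (fun x => ‖ψ x‖ ^ 2) x‖ₑ
      ≤ ENNReal.ofReal (2 * (∫ x, ‖ψ x‖ ^ 2) + ∫ x, covGradSqSmooth a ψ x) := by
  have i₁ : Integrable fun x => 2 * ‖ψ x‖ ^ 2 := h.integrable_normSq.const_mul 2
  have i₁₂ : Integrable fun x => 2 * ‖ψ x‖ ^ 2 + covGradSqSmooth a ψ x :=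
    i₁.add (h.integrable_covGradSqSmooth a)
  rw [← integral_const_mul, ← integral_add i₁ (h.integrable_covGradSqSmooth a),
    ofReal_integral_eq_lintegral_ofReal i₁₂
      (ae_of_all _ fun x => (norm_nonneg _).trans (h.norm_fderiv_normSq_le a x))]
  refine lintegral_mono fun x => ?_
  rw [← ofReal_norm]
  exact ENNReal.ofReal_le_ofReal (h.norm_fderiv_normSq_le a x)

/-- The constant of the `L¹` Gagliardo–Nirenberg–Sobolev inequality
`∫ f² ≤ K (∫ ‖∇f‖)²` in the plane. -/
def sobolevConst : ℝ := lintegralPowLePowLIntegralFDerivConst (volume : Measure (ℝ × ℝ)) 2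

theorem IsTest.integral_norm_pow_four_le (h : IsTest U ψ) (a : ℝ) :
    ∫ x, ‖ψ x‖ ^ 4
      ≤ sobolevConst * (2 * (∫ x, ‖ψ x‖ ^ 2) + ∫ x, covGradSqSmooth a ψ x) ^ 2 := by
  have conj : Real.HolderConjugate (Module.finrank ℝ (ℝ × ℝ)) 2 := by
    rw [Module.finrank_prod, Module.finrank_self, Nat.cast_add, Nat.cast_one, one_add_one_eq_two]
    exact Real.HolderConjugate.two_two
  have sobolev := lintegral_pow_le_pow_lintegral_fderiv (μ := (volume : Measure (ℝ × ℝ)))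
    (h.normSq.smooth.of_le (by simp)) h.normSq.compact conj
  have quartic : ENNReal.ofReal (∫ x, ‖ψ x‖ ^ 4) = ∫⁻ x, ‖‖ψ x‖ ^ 2‖ₑ ^ (2 : ℝ) := by
    rw [ofReal_integral_eq_lintegral_ofReal h.integrable_norm_pow_four
      (ae_of_all _ fun x => by simp only [Pi.zero_apply]; positivity)]
    refine lintegral_congr fun x => ?_
    rw [ENNReal.rpow_ofNat, enorm_pow, enorm_norm, ← pow_mul, ← ofReal_norm,
      ENNReal.ofReal_pow (norm_nonneg _)]
  set B := 2 * (∫ x, ‖ψ x‖ ^ 2) + ∫ x, covGradSqSmooth a ψ x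
  have B_nonneg : 0 ≤ B := add_nonneg
    (mul_nonneg two_pos.le (integral_nonneg fun x => by positivity))
    (integral_nonneg fun x => covGradSqSmooth_nonneg a ψ x)
  have K_nonneg : 0 ≤ sobolevConst := NNReal.coe_nonneg _
  refine (ENNReal.ofReal_le_ofReal_iff (by positivity)).1 ?_
  rw [quartic, ENNReal.ofReal_mul K_nonneg, ENNReal.ofReal_pow B_nonneg]
  refine sobolev.trans ?_
  rw [sobolevConst, ENNReal.ofReal_coe_nnreal, ENNReal.rpow_ofNat]
  gcongr
  exact h.lintegral_enorm_fderiv_normSq_le a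

/-! ### Weak derivatives -/

theorem IsTest.integrableOn_mul {θ : ℝ × ℝ → ℝ} (hθ : IsTest U θ) {w : ℝ × ℝ → ℂ}
    (hw : LocallyIntegrableOn w U) : IntegrableOn (fun x => (θ x : ℂ) * w x) U := by
  have hK : IntegrableOn (fun x => (θ x : ℂ) * w x) (tsupport θ) :=
    (hw.integrableOn_compact_subset hθ.supp hθ.compact).continuousOn_mul
      (Complex.continuous_ofReal.comp hθ.continuous).continuousOn hθ.compact
  rw [integrableOn_iff_integrable_of_support_subset fun x hx =>
    subset_tsupport θ fun h0 => hx (by simp [h0])] at hK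
  exact hK.integrableOn

theorem HasWeakPartial.ae_eq (hU : IsOpen U) {j : Fin 2} {u w₁ w₂ : ℝ × ℝ → ℂ}
    (h₁ : HasWeakPartial U j u w₁) (h₂ : HasWeakPartial U j u w₂) :
    w₁ =ᵐ[volume.restrict U] w₂ := by
  have key := hU.ae_eq_zero_of_integral_contDiff_smul_eq_zero (μ := volume)
    (f := fun x => w₁ x - w₂ x) (h₁.locInt_deriv.sub h₂.locInt_deriv) fun θ hθ hθc hθU => by
      have test : IsTest U θ := ⟨hθ, hθc, hθU⟩
      have parts := (h₁.byParts θ test).symm.trans (h₂.byParts θ test)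
      rw [← test.setIntegral_eq fun x hx => by simp [image_eq_zero_of_notMem_tsupport hx]]
      simp only [Complex.real_smul, mul_sub]
      rw [integral_sub (test.integrableOn_mul h₁.locInt_deriv)
        (test.integrableOn_mul h₂.locInt_deriv), neg_inj.1 parts, sub_self]
  rw [EventuallyEq, ae_restrict_iff' hU.measurableSet]
  filter_upwards [key] with x hx hxU using sub_eq_zero.1 (hx hxU)

theorem HasWeakPartial.weakPartial_ae_eq (hU : IsOpen U) {j : Fin 2} {u w : ℝ × ℝ → ℂ}
    (h : HasWeakPartial U j u w) : weakPartial U j u =ᵐ[volume.restrict U] w := by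
  have hex : ∃ w, HasWeakPartial U j u w := ⟨w, h⟩
  rw [weakPartial, dif_pos hex]
  exact hex.choose_spec.ae_eq hU h

theorem hasWeakPartial_of_contDiff (U : Set (ℝ × ℝ)) (j : Fin 2) (hψ : ContDiff ℝ 1 ψ) :
    HasWeakPartial U j ψ fun x => fderiv ℝ ψ x (e j) := by
  have hψ' : Continuous fun x => fderiv ℝ ψ x (e j) :=
    (hψ.continuous_fderiv one_ne_zero).clm_apply continuous_const
  refine ⟨hψ.continuous.locallyIntegrable.locallyIntegrableOn U,
    hψ'.locallyIntegrable.locallyIntegrableOn U, fun θ hθ => ?_⟩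
  have θ_zero : ∀ x, x ∉ tsupport θ → θ x = 0 := fun _ => image_eq_zero_of_notMem_tsupport
  have dθ_zero : ∀ x, x ∉ tsupport θ → fderiv ℝ θ x (e j) = 0 := fun x hx => by
    simp [fderiv_of_notMem_tsupport ℝ hx]
  rw [hθ.setIntegral_eq fun x hx => by simp [dθ_zero x hx],
    hθ.setIntegral_eq fun x hx => by simp [θ_zero x hx], eq_comm, neg_eq_iff_eq_neg]
  exact integral_smul_fderiv_eq_neg_fderiv_smul_of_integrable
    (hθ.integrable ((hθ.continuous_fderiv_apply _).smul hψ.continuous)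
      fun x hx => by simp [dθ_zero x hx])
    (hθ.integrable (hθ.continuous.smul hψ') fun x hx => by simp [θ_zero x hx])
    (hθ.integrable (hθ.continuous.smul hψ.continuous) fun x hx => by simp [θ_zero x hx])
    (fun x _ => hθ.differentiable x) (fun x _ => hψ.differentiable one_ne_zero x)

/-! ### Limits in the graph norm -/

/-- `L²(U)`-convergence of the test functions `ψ n` to `u` and of their covariant derivatives to
`w`, that is, convergence in the graph norm of `∇ - iσA₀`. -/
structure GraphTendsto (a : ℝ) (U : Set (ℝ × ℝ)) (ψ : ℕ → ℝ × ℝ → ℂ) (u : ℝ × ℝ → ℂ)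
    (w : Fin 2 → ℝ × ℝ → ℂ) : Prop where
  test : ∀ n, IsTest U (ψ n)
  memLp : MemLp u 2 (volume.restrict U)
  memLp_deriv : ∀ j, MemLp (w j) 2 (volume.restrict U)
  tendsto : Tendsto (fun n => eLpNorm (ψ n - u) 2 (volume.restrict U)) atTop (𝓝 0)
  tendsto_deriv : ∀ j, Tendsto (fun n => eLpNorm (covDerivSmooth a j (ψ n) - w j) 2
    (volume.restrict U)) atTop (𝓝 0)

theorem locallyIntegrableOn_of_memLp {u : ℝ × ℝ → ℂ} (hu : MemLp u 2 (volume.restrict U)) :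
    LocallyIntegrableOn u U :=
  locallyIntegrableOn_of_locallyIntegrable_restrict (hu.locallyIntegrable one_le_two)

theorem IsTest.memLp_ofReal_mul {θ : ℝ × ℝ → ℝ} (hθ : IsTest U θ) (p : ℝ≥0∞)
    (μ : Measure (ℝ × ℝ)) [IsFiniteMeasureOnCompacts μ] {g : ℝ × ℝ → ℂ} (hg : Continuous g) :
    MemLp (fun x => (θ x : ℂ) * g x) p μ :=
  ((Complex.continuous_ofReal.comp hθ.continuous).mul hg).memLp_of_hasCompactSupport
    (HasCompactSupport.intro hθ.compact fun x hx => by simp [image_eq_zero_of_notMem_tsupport hx])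

theorem IsTest.integral_covGradSqSmooth_sub {f g : ℝ × ℝ → ℂ} (hf : IsTest U f) (hg : IsTest U g)
    (a : ℝ) : ∫ x, covGradSqSmooth a (fun x => f x - g x) x
      = ∑ j, ∫ x in U, ‖covDerivSmooth a j f x - covDerivSmooth a j g x‖ ^ 2 := by
  simp only [(hf.sub hg).integral_covGradSqSmooth, hf.covDerivSmooth_sub hg]

namespace GraphTendsto

variable {a b R : ℝ} {ψ : ℕ → ℝ × ℝ → ℂ} {u : ℝ × ℝ → ℂ} {w : Fin 2 → ℝ × ℝ → ℂ}

theorem hasWeakPartial (h : GraphTendsto a U ψ u w) (hU : IsOpen U) (j : Fin 2) :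
    HasWeakPartial U j u fun x => w j x + Complex.I * (sigma a x * A0 x j : ℝ) * u x := by
  set A : ℝ × ℝ → ℂ := fun x => Complex.I * (sigma a x * A0 x j : ℝ)
  have cA : Continuous A := by
    have := continuous_sigma_mul_A0 a j
    fun_prop
  have locu := locallyIntegrableOn_of_memLp h.memLp
  refine ⟨locu, (locallyIntegrableOn_of_memLp (h.memLp_deriv j)).add
    (locu.continuousOn_mul cA.continuousOn hU.isLocallyClosed), fun θ hθ => ?_⟩
  have m_dθ : MemLp (fun x => (fderiv ℝ θ x (e j) : ℂ)) 2 (volume.restrict U) :=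
    (Complex.continuous_ofReal.comp (hθ.continuous_fderiv_apply (e j))).memLp_of_hasCompactSupport
      (HasCompactSupport.intro hθ.compact fun x hx => by simp [fderiv_of_notMem_tsupport ℝ hx])
  have m_θ : MemLp (fun x => (θ x : ℂ)) 2 (volume.restrict U) := by
    simpa only [mul_one] using hθ.memLp_ofReal_mul 2 _ (continuous_const (y := (1 : ℂ)))
  have m_θA : MemLp (fun x => (θ x : ℂ) * A x) 2 (volume.restrict U) := hθ.memLp_ofReal_mul 2 _ cA
  have split {v D : ℝ × ℝ → ℂ} (hv : MemLp v 2 (volume.restrict U))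
      (hD : MemLp D 2 (volume.restrict U)) :
      ∫ x in U, (θ x : ℂ) * (D x + A x * v x)
        = (∫ x in U, (θ x : ℂ) * D x) + ∫ x in U, (θ x : ℂ) * A x * v x := by
    have iD : Integrable (fun x => (θ x : ℂ) * D x) (volume.restrict U) := m_θ.integrable_mul hD
    have iA : Integrable (fun x => (θ x : ℂ) * A x * v x) (volume.restrict U) :=
      m_θA.integrable_mul hv
    rw [← integral_add iD iA]
    simp only [mul_add, mul_assoc]
  have mψ (n : ℕ) := (h.test n).memLp 2 (volume.restrict U)
  have mD (n : ℕ) := (h.test n).memLp_covDerivSmooth a j 2 (volume.restrict U)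
  have lhs := tendsto_integral_mul mψ h.memLp m_dθ h.tendsto
  have rhs := ((tendsto_integral_mul mD (h.memLp_deriv j) m_θ (h.tendsto_deriv j)).add
    (tendsto_integral_mul mψ h.memLp m_θA h.tendsto)).neg
  rw [split h.memLp (h.memLp_deriv j)]
  refine tendsto_nhds_unique (lhs.congr fun n => ?_) rhs
  rw [(hasWeakPartial_of_contDiff U j ((h.test n).smooth.of_le (by simp))).byParts θ hθ,
    ← split (mψ n) (mD n)]
  simp only [A, covDerivSmooth, sub_add_cancel]

theorem covDeriv_ae_eq (h : GraphTendsto a U ψ u w) (hU : IsOpen U) (j : Fin 2) :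
    covDeriv a U j u =ᵐ[volume.restrict U] w j := by
  filter_upwards [(h.hasWeakPartial hU j).weakPartial_ae_eq hU] with x hx
  rw [covDeriv, hx, add_sub_cancel_right]

theorem to_covDeriv (h : GraphTendsto a U ψ u w) (hU : IsOpen U) :
    GraphTendsto a U ψ u fun j => covDeriv a U j u where
  test := h.test
  memLp := h.memLp
  memLp_deriv j := (memLp_congr_ae (h.covDeriv_ae_eq hU j)).2 (h.memLp_deriv j)
  tendsto := h.tendsto
  tendsto_deriv j := (h.tendsto_deriv j).congr fun _ =>
    eLpNorm_congr_ae (EventuallyEq.rfl.sub (h.covDeriv_ae_eq hU j).symm)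

theorem memMagSobolev (h : GraphTendsto a U ψ u w) (hU : IsOpen U) : MemMagSobolev a U u where
  memLp := h.memLp
  weakDiff j := ⟨_, h.hasWeakPartial hU j⟩
  memLp_covDeriv := (h.to_covDeriv hU).memLp_deriv

theorem mem_domainD (h : GraphTendsto a (strip R) ψ u w) : u ∈ domainD a R :=
  ⟨h.memMagSobolev (isOpen_strip R), ψ, h.test, h.tendsto,
    (h.to_covDeriv (isOpen_strip R)).tendsto_deriv⟩

theorem tendsto_integral_normSq_sub (h : GraphTendsto a U ψ u w) :
    Tendsto (fun q : ℕ × ℕ => ∫ x, ‖ψ q.1 x - ψ q.2 x‖ ^ 2) atTop (𝓝 0) :=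
  (tendsto_integral_norm_sub_pow (p := 2) (fun n => (h.test n).memLp _ _) h.memLp h.tendsto).congr
    fun q => ((h.test q.1).sub (h.test q.2)).setIntegral_norm_pow two_ne_zero

theorem tendsto_integral_covGradSqSmooth_sub (h : GraphTendsto a U ψ u w) :
    Tendsto (fun q : ℕ × ℕ => ∫ x, covGradSqSmooth a (fun x => ψ q.1 x - ψ q.2 x) x) atTop
      (𝓝 0) := by
  have lim := tendsto_finsetSum Finset.univ fun j _ => tendsto_integral_norm_sub_pow (p := 2)
    (fun n => (h.test n).memLp_covDerivSmooth a j _ _) (h.memLp_deriv j) (h.tendsto_deriv j)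
  rw [Finset.sum_const_zero] at lim
  exact lim.congr fun q => ((h.test q.1).integral_covGradSqSmooth_sub (h.test q.2) a).symm

theorem tendsto_integral_sub_pow_four (h : GraphTendsto a U ψ u w) :
    Tendsto (fun q : ℕ × ℕ => ∫ x in U, ‖ψ q.1 x - ψ q.2 x‖ ^ 4) atTop (𝓝 0) := by
  have lim := (((h.tendsto_integral_normSq_sub.const_mul 2).add
    h.tendsto_integral_covGradSqSmooth_sub).pow 2).const_mul sobolevConst
  rw [mul_zero, add_zero, zero_pow two_ne_zero, mul_zero] at lim
  refine squeeze_zero (fun q => integral_nonneg fun x => by positivity) (fun q => ?_) lim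
  have test := (h.test q.1).sub (h.test q.2)
  rw [test.setIntegral_norm_pow four_ne_zero]
  exact test.integral_norm_pow_four_le a

theorem memLp_four (h : GraphTendsto a U ψ u w) :
    MemLp u 4 (volume.restrict U) ∧
      Tendsto (fun n => eLpNorm (ψ n - u) 4 (volume.restrict U)) atTop (𝓝 0) := by
  obtain ⟨v, hv, lim⟩ := exists_tendsto_eLpNorm (p := 4) (fun n => (h.test n).memLp _ _)
    h.tendsto_integral_sub_pow_four
  have meas (n : ℕ) : AEStronglyMeasurable (ψ n) (volume.restrict U) :=
    (h.test n).continuous.aestronglyMeasurable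
  have huv : u =ᵐ[volume.restrict U] v := tendstoInMeasure_ae_unique
    (tendstoInMeasure_of_tendsto_eLpNorm two_ne_zero meas h.memLp.1 h.tendsto)
    (tendstoInMeasure_of_tendsto_eLpNorm (by simp) meas hv.1 lim)
  exact ⟨(memLp_congr_ae huv).2 hv,
    lim.congr fun _ => eLpNorm_congr_ae (EventuallyEq.rfl.sub huv.symm)⟩

theorem tendsto_energySmooth (h : GraphTendsto a (strip R) ψ u fun j => covDeriv a (strip R) j u) :
    Tendsto (fun n => energySmooth a b (ψ n)) atTop (𝓝 (energyG a b R u)) := by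
  obtain ⟨hu4, lim4⟩ := h.memLp_four
  have i_grad (j : Fin 2) : IntegrableOn (fun x => ‖covDeriv a (strip R) j u x‖ ^ 2) (strip R) :=
    (h.memLp_deriv j).integrable_norm_pow (p := 2) two_ne_zero
  have i_sum : IntegrableOn (fun x => b * covGradSq a (strip R) u x) (strip R) :=
    (integrable_finsetSum _ fun j _ => i_grad j).const_mul b
  have i_sq : IntegrableOn (fun x => ‖u x‖ ^ 2) (strip R) :=
    h.memLp.integrable_norm_pow (p := 2) two_ne_zero
  have i_four : IntegrableOn (fun x => 1 / 2 * ‖u x‖ ^ 4) (strip R) :=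
    (hu4.integrable_norm_pow (p := 4) four_ne_zero).const_mul _
  have i_diff : IntegrableOn (fun x => b * covGradSq a (strip R) u x - ‖u x‖ ^ 2) (strip R) :=
    i_sum.sub i_sq
  have energyG_eq : energyG a b R u = b * (∑ j, ∫ x in strip R, ‖covDeriv a (strip R) j u x‖ ^ 2)
      - (∫ x in strip R, ‖u x‖ ^ 2) + 1 / 2 * ∫ x in strip R, ‖u x‖ ^ 4 := by
    rw [energyG, integral_add i_diff i_four, integral_sub i_sum i_sq, integral_const_mul,
      integral_const_mul, ← integral_finsetSum _ fun j _ => i_grad j]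
    rfl
  have lim_grad := tendsto_finsetSum Finset.univ fun j _ => tendsto_integral_norm_pow (p := 2)
    (fun n => (h.test n).memLp_covDerivSmooth a j _ _) (h.memLp_deriv j) (h.tendsto_deriv j)
  have lim_sq := tendsto_integral_norm_pow (p := 2) (fun n => (h.test n).memLp _ _) h.memLp
    h.tendsto
  have lim_four := tendsto_integral_norm_pow (p := 4) (fun n => (h.test n).memLp _ _) hu4 lim4
  rw [energyG_eq]
  refine (((lim_grad.const_mul b).sub lim_sq).add (lim_four.const_mul (1 / 2))).congr fun n => ?_
  have test := h.test n
  rw [test.energySmooth_eq, test.integral_covGradSqSmooth, test.setIntegral_norm_pow two_ne_zero,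
    test.setIntegral_norm_pow four_ne_zero]

theorem exists_seq_tendsto_ae (h : GraphTendsto a U ψ u w) :
    ∃ s : ℕ → ℕ, ∀ᵐ x ∂volume.restrict U, Tendsto (fun n => ψ (s n) x) atTop (𝓝 (u x)) ∧
      ∀ j, Tendsto (fun n => covDerivSmooth a j (ψ (s n)) x) atTop (𝓝 (w j x)) := by
  have conv := tendstoInMeasure_of_tendsto_eLpNorm two_ne_zero
    (fun n => (h.test n).continuous.aestronglyMeasurable) h.memLp.1 h.tendsto
  have conv_deriv (j : Fin 2) := tendstoInMeasure_of_tendsto_eLpNorm two_ne_zero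
    (fun n => ((h.test n).continuous_covDerivSmooth a j).aestronglyMeasurable) (h.memLp_deriv j).1
    (h.tendsto_deriv j)
  obtain ⟨r, hr, lim⟩ := conv.exists_seq_tendsto_ae
  obtain ⟨s, hs, lim₀⟩ := ((conv_deriv 0).comp hr.tendsto_atTop).exists_seq_tendsto_ae
  obtain ⟨t, ht, lim₁⟩ := ((conv_deriv 1).comp
    (hr.tendsto_atTop.comp hs.tendsto_atTop)).exists_seq_tendsto_ae
  refine ⟨r ∘ s ∘ t, ?_⟩
  filter_upwards [lim, lim₀, lim₁] with x hx hx₀ hx₁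
  exact ⟨hx.comp (hs.tendsto_atTop.comp ht.tendsto_atTop),
    Fin.forall_fin_two.2 ⟨hx₀.comp ht.tendsto_atTop, hx₁⟩⟩

end GraphTendsto

theorem exists_graphTendsto_of_mem_domainD {a R : ℝ} {u : ℝ × ℝ → ℂ} (hu : u ∈ domainD a R) :
    ∃ ψ, GraphTendsto a (strip R) ψ u fun j => covDeriv a (strip R) j u := by
  obtain ⟨mem, ψ, test, lim, lim_deriv⟩ := hu
  exact ⟨ψ, test, mem.memLp, mem.memLp_covDeriv, lim, lim_deriv⟩

theorem exists_graphTendsto {a : ℝ} {ψ : ℕ → ℝ × ℝ → ℂ} (hT : ∀ n, IsTest U (ψ n))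
    (hψ : Tendsto (fun q : ℕ × ℕ => ∫ x, ‖ψ q.1 x - ψ q.2 x‖ ^ 2) atTop (𝓝 0))
    (hG : Tendsto (fun q : ℕ × ℕ => ∫ x, covGradSqSmooth a (fun x => ψ q.1 x - ψ q.2 x) x) atTop
      (𝓝 0)) : ∃ u w, GraphTendsto a U ψ u w := by
  have cauchy : Tendsto (fun q : ℕ × ℕ => ∫ x in U, ‖ψ q.1 x - ψ q.2 x‖ ^ 2) atTop (𝓝 0) :=
    hψ.congr fun q => (((hT q.1).sub (hT q.2)).setIntegral_norm_pow two_ne_zero).symm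
  have cauchy_deriv (j : Fin 2) : Tendsto (fun q : ℕ × ℕ => ∫ x in U,
      ‖covDerivSmooth a j (ψ q.1) x - covDerivSmooth a j (ψ q.2) x‖ ^ 2) atTop (𝓝 0) := by
    refine squeeze_zero (fun q => integral_nonneg fun x => by positivity) (fun q => ?_) hG
    rw [(hT q.1).integral_covGradSqSmooth_sub (hT q.2)]
    exact Finset.single_le_sum (f := fun j => ∫ x in U,
      ‖covDerivSmooth a j (ψ q.1) x - covDerivSmooth a j (ψ q.2) x‖ ^ 2)
      (fun i _ => integral_nonneg fun x => by positivity) (Finset.mem_univ j)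
  obtain ⟨u, hu, lim⟩ := exists_tendsto_eLpNorm (p := 2) (fun n => (hT n).memLp _ _) cauchy
  choose w hw lim_deriv using fun j => exists_tendsto_eLpNorm (p := 2)
    (fun n => (hT n).memLp_covDerivSmooth a j _ _) (cauchy_deriv j)
  exact ⟨u, w, hT, hu, hw, lim, lim_deriv⟩

/-! ### Existence of a minimizer -/

theorem norm_half_smul_add_sq {H : Type*} [NormedAddCommGroup H] [InnerProductSpace ℝ H]
    (z w : H) :
    ‖(1 / 2 : ℝ) • (z + w)‖ ^ 2 = 1 / 2 * (‖z‖ ^ 2 + ‖w‖ ^ 2) - 1 / 4 * ‖z - w‖ ^ 2 := by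
  rw [norm_smul, Real.norm_of_nonneg (by norm_num)]
  linarith [parallelogram_law_with_norm ℝ z w]

theorem norm_half_smul_add_pow_le {E : Type*} [NormedAddCommGroup E] [NormedSpace ℝ E] (n : ℕ)
    (z w : E) : ‖(1 / 2 : ℝ) • (z + w)‖ ^ n ≤ 1 / 2 * (‖z‖ ^ n + ‖w‖ ^ n) := by
  have convex := (convexOn_univ_norm (E := E)).pow (fun _ _ => norm_nonneg _) n
  simpa only [smul_add, smul_eq_mul, mul_add, Pi.pow_apply] using
    convex.2 (mem_univ z) (mem_univ w) one_half_pos.le one_half_pos.le (add_halves 1)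

section Midpoint

variable {f g : ℝ × ℝ → ℂ}

theorem IsTest.half_smul_add (hf : IsTest U f) (hg : IsTest U g) :
    IsTest U fun x => (1 / 2 : ℝ) • (f x + g x) :=
  (hf.add hg).comp_left (contDiff_const_smul _) (smul_zero _)

theorem IsTest.covDerivSmooth_half_smul_add (hf : IsTest U f) (hg : IsTest U g) (a : ℝ)
    (j : Fin 2) (x : ℝ × ℝ) : covDerivSmooth a j (fun x => (1 / 2 : ℝ) • (f x + g x)) x
      = (1 / 2 : ℝ) • (covDerivSmooth a j f x + covDerivSmooth a j g x) := by
  simp only [covDerivSmooth]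
  rw [fderiv_fun_const_smul ((hf.differentiable x).fun_add (hg.differentiable x)),
    fderiv_fun_add (hf.differentiable x) (hg.differentiable x)]
  simp only [smul_apply, add_apply, Complex.real_smul]
  ring

theorem IsTest.covGradSqSmooth_half_smul_add (hf : IsTest U f) (hg : IsTest U g) (a : ℝ)
    (x : ℝ × ℝ) : covGradSqSmooth a (fun x => (1 / 2 : ℝ) • (f x + g x)) x
      = 1 / 2 * (covGradSqSmooth a f x + covGradSqSmooth a g x)
        - 1 / 4 * covGradSqSmooth a (fun x => f x - g x) x := by
  simp only [covGradSqSmooth_eq, hf.covDerivSmooth_half_smul_add hg, hf.covDerivSmooth_sub hg,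
    norm_half_smul_add_sq]
  ring

theorem IsTest.energySmooth_half_smul_add_le (hf : IsTest U f) (hg : IsTest U g) (a b : ℝ) :
    energySmooth a b (fun x => (1 / 2 : ℝ) • (f x + g x))
        + b / 4 * ∫ x, covGradSqSmooth a (fun x => f x - g x) x
      ≤ 1 / 2 * (energySmooth a b f + energySmooth a b g) + 1 / 4 * ∫ x, ‖f x - g x‖ ^ 2 := by
  have iMid := (hf.half_smul_add hg).integrable_energySmooth a b
  have iGrad := ((hf.sub hg).integrable_covGradSqSmooth a).const_mul (b / 4)
  have iSum := ((hf.integrable_energySmooth a b).add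
    (hg.integrable_energySmooth a b)).const_mul (1 / 2)
  have iSub := (hf.sub hg).integrable_normSq.const_mul (1 / 4)
  have pointwise := integral_mono (iMid.add iGrad) (iSum.add iSub) fun x => by
    simp only [Pi.add_apply, hf.covGradSqSmooth_half_smul_add hg, norm_half_smul_add_sq]
    linarith [norm_half_smul_add_pow_le 4 (f x) (g x)]
  rw [integral_add' iMid iGrad, integral_add' iSum iSub, integral_const_mul, integral_const_mul,
    integral_const_mul, integral_add' (hf.integrable_energySmooth a b)
    (hg.integrable_energySmooth a b)] at pointwise
  exact pointwise

end Midpoint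

section Minimizing

variable {a b R e₀ : ℝ} {ψ : ℕ → ℝ × ℝ → ℂ}

theorem tendsto_integral_covGradSqSmooth_sub (hb : 0 < b) (hT : ∀ n, IsTest U (ψ n))
    (hlow : ∀ v, IsTest U v → e₀ ≤ energySmooth a b v)
    (hE : Tendsto (fun n => energySmooth a b (ψ n)) atTop (𝓝 e₀))
    (hψ : Tendsto (fun q : ℕ × ℕ => ∫ x, ‖ψ q.1 x - ψ q.2 x‖ ^ 2) atTop (𝓝 0)) :
    Tendsto (fun q : ℕ × ℕ => ∫ x, covGradSqSmooth a (fun x => ψ q.1 x - ψ q.2 x) x) atTop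
      (𝓝 0) := by
  have lim : Tendsto (fun q : ℕ × ℕ => 4 / b * (1 / 2 * (energySmooth a b (ψ q.1)
      + energySmooth a b (ψ q.2)) - e₀ + 1 / 4 * ∫ x, ‖ψ q.1 x - ψ q.2 x‖ ^ 2)) atTop (𝓝 0) := by
    rw [← prod_atTop_atTop_eq] at hψ ⊢
    have limit_eq : 4 / b * (1 / 2 * (e₀ + e₀) - e₀ + 1 / 4 * 0) = 0 := by ring
    rw [← limit_eq]
    exact (((((hE.comp tendsto_fst).add (hE.comp tendsto_snd)).const_mul (1 / 2)).sub_const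
      e₀).add (hψ.const_mul (1 / 4))).const_mul (4 / b)
  refine squeeze_zero (fun q => integral_nonneg (covGradSqSmooth_nonneg a _)) (fun q => ?_) lim
  have midpoint := (hT q.1).energySmooth_half_smul_add_le (hT q.2) a b
  have low := hlow _ ((hT q.1).half_smul_add (hT q.2))
  rw [div_mul_eq_mul_div, le_div_iff₀ hb]
  linarith

theorem GraphTendsto.isMinOn {φ : ℝ × ℝ → ℂ} {w : Fin 2 → ℝ × ℝ → ℂ}
    (h : GraphTendsto a (strip R) ψ φ w)
    (hlow : ∀ v, IsTest (strip R) v → e₀ ≤ energySmooth a b v)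
    (hE : Tendsto (fun n => energySmooth a b (ψ n)) atTop (𝓝 e₀)) :
    IsMinOn (energyG a b R) (domainD a R) φ := by
  intro v hv
  obtain ⟨θ, hθ⟩ := exists_graphTendsto_of_mem_domainD hv
  rw [mem_ofPred_eq, tendsto_nhds_unique (h.to_covDeriv (isOpen_strip R)).tendsto_energySmooth hE]
  exact ge_of_tendsto' hθ.tendsto_energySmooth fun n => hlow _ (hθ.test n)

theorem IsTest.eventually_isBoxTest {v : ℝ × ℝ → ℂ} (hv : IsTest (strip R) v) :
    ∀ᶠ m : ℕ in atTop, IsBoxTest R m v := by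
  obtain ⟨r, hr⟩ := hv.compact.isBounded.exists_norm_le
  filter_upwards [tendsto_natCast_atTop_atTop.eventually_ge_atTop r] with m hm
  refine ⟨hv, fun x hx => ?_⟩
  contrapose! hx
  calc |x.2| ≤ ‖x‖ := norm_snd_le x
    _ ≤ r := hr x (subset_tsupport _ hx)
    _ ≤ m := hm

theorem exists_tendsto_energySmooth_of_near_min {M : ℝ} (hψ : ∀ n : ℕ, IsBoxTest R n (ψ n))
    (hmin : ∀ (n : ℕ) v, IsBoxTest R n v →
      energySmooth a b (ψ n) ≤ energySmooth a b v + 1 / ((n : ℝ) + 1))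
    (hM : ∀ n, M ≤ energySmooth a b (ψ n)) :
    ∃ e₀, (∀ v, IsTest (strip R) v → e₀ ≤ energySmooth a b v) ∧
      Tendsto (fun n => energySmooth a b (ψ n)) atTop (𝓝 e₀) := by
  have near_min {v} (hv : IsTest (strip R) v) : ∀ᶠ n : ℕ in atTop,
      energySmooth a b (ψ n) ≤ energySmooth a b v + 1 / ((n : ℝ) + 1) :=
    hv.eventually_isBoxTest.mono fun n => hmin n v
  have lim (v) : Tendsto (fun n : ℕ => energySmooth a b v + 1 / ((n : ℝ) + 1)) atTop
      (𝓝 (energySmooth a b v)) := by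
    simpa only [add_zero] using tendsto_const_nhds (x := energySmooth a b v) |>.add
      (tendsto_one_div_add_atTop_nhds_zero_nat (𝕜 := ℝ))
  set S := energySmooth a b '' {v | IsTest (strip R) v}
  have bddBelow : BddBelow S := ⟨M, forall_mem_image.2 fun v hv =>
    ge_of_tendsto (lim v) ((near_min hv).mono fun n => (hM n).trans)⟩
  have low (v) (hv : IsTest (strip R) v) : sInf S ≤ energySmooth a b v :=
    csInf_le bddBelow (mem_image_of_mem _ hv)
  refine ⟨sInf S, low, tendsto_order.2
    ⟨fun t ht => .of_forall fun n => ht.trans_le (low _ (hψ n).test), fun t ht => ?_⟩⟩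
  obtain ⟨_, ⟨v, hv, rfl⟩, hvt⟩ := exists_lt_of_csInf_lt ⟨_, mem_image_of_mem _ (hψ 0).test⟩ ht
  filter_upwards [near_min hv, (lim v).eventually_lt_const hvt] with n using lt_of_le_of_lt

end Minimizing

theorem tendsto_div_log_sq : Tendsto (fun t : ℝ => t / Real.log t ^ 2) atTop atTop := by
  have lim := (Real.isLittleO_pow_log_id_atTop (n := 2)).tendsto_div_nhds_zero
  have pos : ∀ᶠ t : ℝ in atTop, 0 < Real.log t ^ 2 / id t := by
    filter_upwards [eventually_gt_atTop 1] with t ht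
    exact div_pos (pow_pos (Real.log_pos ht) 2) (one_pos.trans ht)
  simpa only [Pi.inv_def, inv_div, id] using
    (tendsto_nhdsWithin_iff.2 ⟨lim, pos⟩).inv_tendsto_nhdsGT_zero

theorem IsTest.mul_integral_far_normSq_le (h : IsTest U ψ) {a B K L : ℝ} (hB : 0 ≤ B) (hK : 0 ≤ K)
    (hL : 4 ≤ L) (hKL : ∀ t, L ≤ t → K ≤ t / Real.log t ^ 2)
    (hw : ∫⁻ x in {x : ℝ × ℝ | 4 ≤ |x.2|}, ENNReal.ofReal (|x.2| / Real.log |x.2| ^ 2 *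
      (covGradSqSmooth a ψ x + ‖ψ x‖ ^ 2)) ≤ ENNReal.ofReal B) :
    K * ∫ x in {x : ℝ × ℝ | L ≤ |x.2|}, ‖ψ x‖ ^ 2 ≤ B := by
  have i : Integrable (fun x => K * ‖ψ x‖ ^ 2) (volume.restrict {x : ℝ × ℝ | L ≤ |x.2|}) :=
    (h.integrable_normSq.const_mul _).integrableOn
  rw [← ENNReal.ofReal_le_ofReal_iff hB, ← integral_const_mul,
    ofReal_integral_eq_lintegral_ofReal i (ae_of_all _ fun x => by positivity)]
  refine (setLIntegral_mono' (measurableSet_far L) fun x hx => ENNReal.ofReal_le_ofReal ?_).trans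
    ((lintegral_mono_set fun x hx => hL.trans hx).trans hw)
  have weight := hKL |x.2| hx
  have grad_nonneg := covGradSqSmooth_nonneg a ψ x
  calc K * ‖ψ x‖ ^ 2 ≤ |x.2| / Real.log |x.2| ^ 2 * ‖ψ x‖ ^ 2 := by gcongr
    _ ≤ |x.2| / Real.log |x.2| ^ 2 * (covGradSqSmooth a ψ x + ‖ψ x‖ ^ 2) := by
      gcongr
      linarith

theorem eventually_forall_integral_far_normSq_le {ι : Type*} {ψ : ι → ℝ × ℝ → ℂ} {a B ε : ℝ}
    (hT : ∀ i, IsTest U (ψ i)) (hB : 0 < B) (hε : 0 < ε)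
    (hw : ∀ i, ∫⁻ x in {x : ℝ × ℝ | 4 ≤ |x.2|}, ENNReal.ofReal (|x.2| / Real.log |x.2| ^ 2 *
      (covGradSqSmooth a (ψ i) x + ‖ψ i x‖ ^ 2)) ≤ ENNReal.ofReal B) :
    ∀ᶠ N : ℕ in atTop, ∀ i, ∫ x in {x : ℝ × ℝ | (N : ℝ) ≤ |x.2|}, ‖ψ i x‖ ^ 2 ≤ ε := by
  obtain ⟨L, hL⟩ := eventually_atTop.1 (tendsto_div_log_sq.eventually_ge_atTop (B / ε))
  filter_upwards [tendsto_natCast_atTop_atTop.eventually_ge_atTop (max L 4)] with N hN i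
  have bound := (hT i).mul_integral_far_normSq_le hB.le (by positivity)
    ((le_max_right _ _).trans hN) (fun t ht => hL t ((le_max_left _ _).trans (hN.trans ht))) (hw i)
  rw [div_mul_eq_mul_div, div_le_iff₀ hε] at bound
  exact le_of_mul_le_mul_left bound hB

namespace WeightedBounds

variable {C a b R : ℝ}

theorem integral_covGradSqSmooth_le (h : WeightedBounds C a b R ψ) (hb : 1 ≤ b) :
    ∫ x, covGradSqSmooth a ψ x ≤ C * b * R := by
  have grad_nonneg : 0 ≤ ∫ x, covGradSqSmooth a ψ x := integral_nonneg (covGradSqSmooth_nonneg a ψ)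
  have sq_nonneg : 0 ≤ ∫ x, ‖ψ x‖ ^ 2 := integral_nonneg fun x => by positivity
  linarith [h.total, le_mul_of_one_le_left grad_nonneg hb]

theorem integral_normSq_le (h : WeightedBounds C a b R ψ) (hb : 0 ≤ b) :
    ∫ x, ‖ψ x‖ ^ 2 ≤ C * b * R := by
  have grad_nonneg : 0 ≤ ∫ x, covGradSqSmooth a ψ x := integral_nonneg (covGradSqSmooth_nonneg a ψ)
  linarith [h.total, mul_nonneg hb grad_nonneg]

theorem neg_le_energySmooth (h : WeightedBounds C a b R ψ) (hb : 0 ≤ b) (hψ : IsTest U ψ) :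
    -(C * b * R) ≤ energySmooth a b ψ := by
  have grad_nonneg : 0 ≤ ∫ x, covGradSqSmooth a ψ x := integral_nonneg (covGradSqSmooth_nonneg a ψ)
  have four_nonneg : 0 ≤ ∫ x, ‖ψ x‖ ^ 4 := integral_nonneg fun x => by positivity
  rw [hψ.energySmooth_eq]
  linarith [h.integral_normSq_le hb, mul_nonneg hb grad_nonneg]

end WeightedBounds

theorem exists_graphTendsto_isMinOn {C a b R : ℝ} {ψ : ℕ → ℝ × ℝ → ℂ} (hb : 1 ≤ b)
    (hC : 0 < C) (hR : 0 < R) (hψ : ∀ n : ℕ, IsBoxTest R n (ψ n)) (h1 : ∀ n x, ‖ψ n x‖ ≤ 1)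
    (hmin : ∀ (n : ℕ) v, IsBoxTest R n v →
      energySmooth a b (ψ n) ≤ energySmooth a b v + 1 / ((n : ℝ) + 1))
    (hbd : ∀ n, WeightedBounds C a b R (ψ n)) :
    ∃ φ w, ∃ s : ℕ → ℕ, GraphTendsto a (strip R) (fun n => ψ (s n)) φ w ∧
      IsMinOn (energyG a b R) (domainD a R) φ := by
  have hb0 : 0 < b := one_pos.trans_le hb
  have hT (n : ℕ) := (hψ n).test
  obtain ⟨e₀, low, lim⟩ := exists_tendsto_energySmooth_of_near_min hψ hmin fun n =>
    (hbd n).neg_le_energySmooth hb0.le (hT n)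
  obtain ⟨s, hs, cauchy⟩ := exists_subseq_tendsto_integral_normSq_sub hT h1
    (fun n => (hbd n).integral_covGradSqSmooth_le hb) (fun n => (hbd n).integral_normSq_le hb0.le)
    fun ε hε => eventually_forall_integral_far_normSq_le hT (by positivity) hε fun n => (hbd n).weak
  have hTs (n : ℕ) := hT (s n)
  have lim_s : Tendsto (fun n => energySmooth a b (ψ (s n))) atTop (𝓝 e₀) :=
    lim.comp hs.tendsto_atTop
  have cauchy_grad := tendsto_integral_covGradSqSmooth_sub hb0 hTs low lim_s cauchy
  obtain ⟨φ, w, hφ⟩ := exists_graphTendsto hTs cauchy cauchy_grad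
  exact ⟨φ, w, s, hφ, hφ.isMinOn low lim_s⟩

/-! ### Passage to the limit in the bounds -/

theorem lintegral_ofReal_le_of_tendsto {α : Type*} [MeasurableSpace α] {μ : Measure α}
    {f : ℕ → α → ℝ} {g : α → ℝ} {K : ℝ≥0∞} (hf : ∀ n, Measurable (f n))
    (hlim : ∀ᵐ x ∂μ, Tendsto (fun n => f n x) atTop (𝓝 (g x)))
    (hK : ∀ n, ∫⁻ x, ENNReal.ofReal (f n x) ∂μ ≤ K) : ∫⁻ x, ENNReal.ofReal (g x) ∂μ ≤ K := by
  calc ∫⁻ x, ENNReal.ofReal (g x) ∂μ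
      = ∫⁻ x, liminf (fun n => ENNReal.ofReal (f n x)) atTop ∂μ := by
        refine lintegral_congr_ae ?_
        filter_upwards [hlim] with x hx
        exact ((ENNReal.continuous_ofReal.tendsto _).comp hx).liminf_eq.symm
    _ ≤ liminf (fun n => ∫⁻ x, ENNReal.ofReal (f n x) ∂μ) atTop :=
        lintegral_liminf_le fun n => (hf n).ennreal_ofReal
    _ ≤ K := liminf_le_of_le (by isBoundedDefault) fun c hc => by
        obtain ⟨n, hn⟩ := hc.exists
        exact hn.trans (hK n)

theorem GraphTendsto.exists_seq_tendsto_norm_ae {a : ℝ} {ψ : ℕ → ℝ × ℝ → ℂ} {φ : ℝ × ℝ → ℂ}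
    {w : Fin 2 → ℝ × ℝ → ℂ} (h : GraphTendsto a U ψ φ w) (hU : IsOpen U) :
    ∃ s : ℕ → ℕ, ∀ᵐ x ∂volume.restrict U, Tendsto (fun n => ‖ψ (s n) x‖) atTop (𝓝 ‖φ x‖) ∧
      Tendsto (fun n => covGradSqSmooth a (ψ (s n)) x) atTop (𝓝 (covGradSq a U φ x)) := by
  obtain ⟨s, hs⟩ := (h.to_covDeriv hU).exists_seq_tendsto_ae
  refine ⟨s, hs.mono fun x ⟨hx, hx_deriv⟩ => ⟨hx.norm, ?_⟩⟩
  exact tendsto_finsetSum _ fun j _ => (hx_deriv j).norm.pow 2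

section Limit

variable {C a b R : ℝ} {ψ : ℕ → ℝ × ℝ → ℂ} {φ : ℝ × ℝ → ℂ}

theorem eLpNorm_top_le_one_of_tendsto {α : Type*} [MeasurableSpace α] {μ : Measure α}
    {f : ℕ → α → ℂ} {u : α → ℂ} (h1 : ∀ n x, ‖f n x‖ ≤ 1)
    (hlim : ∀ᵐ x ∂μ, Tendsto (fun n => ‖f n x‖) atTop (𝓝 ‖u x‖)) : eLpNorm u ∞ μ ≤ 1 := by
  rw [eLpNorm_exponent_top, ← ENNReal.ofReal_one]
  exact eLpNormEssSup_le_of_ae_bound (hlim.mono fun x hx => le_of_tendsto' hx fun n => h1 n x)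

variable (hT : ∀ n, IsTest (strip R) (ψ n)) (hbd : ∀ n, WeightedBounds C a b R (ψ n))
  (hlim : ∀ᵐ x ∂volume.restrict (strip R), Tendsto (fun n => ‖ψ n x‖) atTop (𝓝 ‖φ x‖) ∧
    Tendsto (fun n => covGradSqSmooth a (ψ n) x) atTop (𝓝 (covGradSq a (strip R) φ x)))

include hT hbd hlim

theorem lintegral_weak_le_of_tendsto :
    ∫⁻ x in strip R ∩ {x | 4 ≤ |x.2|}, ENNReal.ofReal (|x.2| / Real.log |x.2| ^ 2 *
      (covGradSq a (strip R) φ x + ‖φ x‖ ^ 2)) ≤ ENNReal.ofReal (C * b * R) := by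
  refine lintegral_ofReal_le_of_tendsto (f := fun n x => |x.2| / Real.log |x.2| ^ 2 *
    (covGradSqSmooth a (ψ n) x + ‖ψ n x‖ ^ 2)) (fun n => ?_) ?_ fun n =>
      (lintegral_mono_set inter_subset_right).trans (hbd n).weak
  · have := ((hT n).continuous_covGradSqSmooth a).measurable
    have := (hT n).continuous.measurable
    fun_prop
  · filter_upwards [ae_restrict_of_ae_restrict_of_subset inter_subset_left hlim] with x hx
    exact (hx.2.add (hx.1.pow 2)).const_mul _

theorem lintegral_strong_le_of_tendsto :
    ∫⁻ x in strip R ∩ {x | 4 ≤ |x.2|}, ENNReal.ofReal (|x.2| ^ 3 / Real.log |x.2| ^ 2 *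
      ‖φ x‖ ^ 4) ≤ ENNReal.ofReal (C * b ^ 2 * R) := by
  refine lintegral_ofReal_le_of_tendsto (f := fun n x => |x.2| ^ 3 / Real.log |x.2| ^ 2 *
    ‖ψ n x‖ ^ 4) (fun n => ?_) ?_ fun n =>
      (lintegral_mono_set inter_subset_right).trans (hbd n).strong
  · have := (hT n).continuous.measurable
    fun_prop
  · filter_upwards [ae_restrict_of_ae_restrict_of_subset inter_subset_left hlim] with x hx
    exact (hx.1.pow 4).const_mul _

theorem lintegral_total_le_of_tendsto (hb : 0 ≤ b) :
    ∫⁻ x in strip R, ENNReal.ofReal (b * covGradSq a (strip R) φ x + ‖φ x‖ ^ 2)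
      ≤ ENNReal.ofReal (C * b * R) := by
  refine lintegral_ofReal_le_of_tendsto
    (f := fun n x => b * covGradSqSmooth a (ψ n) x + ‖ψ n x‖ ^ 2) (fun n => ?_) ?_ fun n => ?_
  · have := ((hT n).continuous_covGradSqSmooth a).measurable
    have := (hT n).continuous.measurable
    fun_prop
  · filter_upwards [hlim] with x hx using (hx.2.const_mul b).add (hx.1.pow 2)
  · have iGrad := ((hT n).integrable_covGradSqSmooth a).const_mul b
    have iSq := (hT n).integrable_normSq
    refine setLIntegral_ofReal_le (measurableSet_strip R) (iGrad.add iSq)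
      (fun x => add_nonneg (mul_nonneg hb (covGradSqSmooth_nonneg a _ x)) (by positivity))
      (fun x _ => le_rfl) ?_
    rw [integral_add' iGrad iSq, integral_const_mul]
    exact (hbd n).total

end Limit

end MagneticStep

end

open MagneticStep in
theorem proposition3p4_general :
    ∃ C : ℝ, 0 < C ∧
      ∀ a b : ℝ, 1 ≤ b → 1 ≤ b * |a| →
        ∀ R : ℝ, 0 < R →
          ∃ φ ∈ domainD a R,
            IsMinOn (energyG a b R) (domainD a R) φ ∧
            energyG a b R φ = groundEnergy a b R ∧
            eLpNorm φ ∞ (volume.restrict (strip R)) ≤ 1 ∧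
            ∫⁻ x in strip R ∩ {x | 4 ≤ |x.2|},
                ENNReal.ofReal (|x.2| / (Real.log |x.2|) ^ 2 *
                  (covGradSq a (strip R) φ x + ‖φ x‖ ^ 2))
              ≤ ENNReal.ofReal (C * b * R) ∧
            ∫⁻ x in strip R ∩ {x | 4 ≤ |x.2|},
                ENNReal.ofReal (|x.2| ^ 3 / (Real.log |x.2|) ^ 2 * ‖φ x‖ ^ 4)
              ≤ ENNReal.ofReal (C * b ^ 2 * R) ∧
            ∫⁻ x in strip R,
                ENNReal.ofReal (b * covGradSq a (strip R) φ x + ‖φ x‖ ^ 2)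
              ≤ ENNReal.ofReal (C * b * R) := by
  obtain ⟨C, hC, near_min⟩ := exists_near_min_weightedBounds
  refine ⟨C, hC, fun a b hb hab R hR => ?_⟩
  choose ψ hψ h1 hmin hbd using fun n : ℕ =>
    near_min a b R hb hab hR n n.cast_nonneg (1 / ((n : ℝ) + 1)) Nat.one_div_pos_of_nat
  obtain ⟨φ, w, s, hφ, isMinOn⟩ := exists_graphTendsto_isMinOn hb hC hR hψ h1 hmin hbd
  have isLeast : IsLeast (energyG a b R '' domainD a R) (energyG a b R φ) :=
    ⟨mem_image_of_mem _ hφ.mem_domainD, forall_mem_image.2 fun v hv => isMinOn hv⟩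
  obtain ⟨t, lim⟩ := hφ.exists_seq_tendsto_norm_ae (isOpen_strip R)
  have hT (n : ℕ) := hφ.test (t n)
  have hbd_t (n : ℕ) := hbd (s (t n))
  exact ⟨φ, hφ.mem_domainD, isMinOn, isLeast.csInf_eq.symm,
    eLpNorm_top_le_one_of_tendsto (fun n => h1 (s (t n))) (lim.mono fun x hx => hx.1),
    lintegral_weak_le_of_tendsto hT hbd_t lim, lintegral_strong_le_of_tendsto hT hbd_t lim,
    lintegral_total_le_of_tendsto hT hbd_t lim (one_pos.le.trans hb)⟩

open MagneticStep in
theorem proposition3p4 :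
    ∃ C : ℝ, 0 < C ∧
      ∀ a b : ℝ, -1 ≤ a → a < 0 → 1 / |a| ≤ b → b < 1 / beta a →
        ∀ R : ℝ, 0 < R →
          ∃ φ ∈ domainD a R,
            IsMinOn (energyG a b R) (domainD a R) φ ∧
            energyG a b R φ = groundEnergy a b R ∧
            eLpNorm φ ∞ (volume.restrict (strip R)) ≤ 1 ∧
            ∫⁻ x in strip R ∩ {x | 4 ≤ |x.2|},
                ENNReal.ofReal (|x.2| / (Real.log |x.2|) ^ 2 *
                  (covGradSq a (strip R) φ x + ‖φ x‖ ^ 2))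
              ≤ ENNReal.ofReal (C * b * R) ∧
            ∫⁻ x in strip R ∩ {x | 4 ≤ |x.2|},
                ENNReal.ofReal (|x.2| ^ 3 / (Real.log |x.2|) ^ 2 * ‖φ x‖ ^ 4)
              ≤ ENNReal.ofReal (C * b ^ 2 * R) ∧
            ∫⁻ x in strip R,
                ENNReal.ofReal (b * covGradSq a (strip R) φ x + ‖φ x‖ ^ 2)
              ≤ ENNReal.ofReal (C * b * R) := by
  obtain ⟨C, hC, bounds⟩ := proposition3p4_general
  refine ⟨C, hC, fun a b ha ha' hab _ R hR => ?_⟩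
  have one_le_mul : 1 ≤ b * |a| := (div_le_iff₀ (abs_pos.2 ha'.ne)).1 hab
  have abs_le_one : |a| ≤ 1 := abs_le.2 ⟨ha, ha'.le.trans zero_le_one⟩
  exact bounds a b (((one_le_div (abs_pos.2 ha'.ne)).2 abs_le_one).trans hab) one_le_mul R hR
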